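/- **Theorem 14.1 (Kato smoothness equivalences).** Let $\mathcal H$ be a complex separable Hilbert space, $H$ a (possibly unbounded) self-adjoint operator on $\mathcal H$, and $A$ a closed, densely defined operator on $\mathcal H$ with domain $D(A)$ and adjoint $A^*$. For $\mu\in\mathbb C\setminus\mathbb R$ put $R(\mu)=(H-\mu)^{-1}$, let $P_{(a,b)}(H)$ denote the spectral projections of $H$, and set $\|A\psi\|=\infty$ if $\psi\notin D(A)$. Then the following five quantities in $[0,\infty]$ are all equal (a supremum over the empty set being $0$): $$\sup_{\|\varphi\|=1,\ \varepsilon>0}\ \frac1{4\pi^2}\int_{-\infty}^\infty\Big(\|AR(\lambda+i\varepsilon)\varphi\|^2+\|AR(\lambda-i\varepsilon)\varphi\|^2\Big)\,d\lambda,$$ $$\sup_{\|\varphi\|=1}\ \frac1{2\pi}\int_{-\infty}^\infty\|Ae^{-itH}\varphi\|^2\,dt,$$ $$\sup_{\substack{\|\varphi\|=1,\ \varphi\in D(A^*)\\ -\infty<a<b<\infty}}\ \frac{\|P_{(a,b)}(H)A^*\varphi\|^2}{b-a},$$ $$\sup_{\substack{\mu\notin\mathbb R,\ \varphi\in D(A^*)\\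 \|\varphi\|=1}}\ \frac1{2\pi}\,\big|\langle A^*\varphi,[R(\mu)-R(\bar\mu)]A^*\varphi\rangle\big|,$$ $$\sup_{\substack{\mu\notin\mathbb R,\ \varphi\in D(A^*)\\ \|\varphi\|=1}}\ \frac1{\pi}\,\|R(\mu)A^*\varphi\|^2\,|\operatorname{Im}\mu|.$$ In particular, if one of them is finite (resp. infinite), then all are. Their common value is denoted $\|A\|_H^2$, and $A$ is called $H$-smooth if it is finite. -/

import Mathlib

open MeasureTheory
open scoped ENNReal

namespace KatoSmooth

/-- A projection-valued measure on the Borel sets of the real line. -/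
structure PVM (V : Type*) [NormedAddCommGroup V] [InnerProductSpace ℂ V] [CompleteSpace V] where
  proj : Set ℝ → V →L[ℂ] V
  isStarProjection : ∀ S, MeasurableSet S → IsStarProjection (proj S)
  proj_univ : proj Set.univ = 1
  proj_inter : ∀ S T, MeasurableSet S → MeasurableSet T → proj (S ∩ T) = proj S * proj T
  hasSum_proj : ∀ S : ℕ → Set ℝ, (∀ n, MeasurableSet (S n)) →
    Pairwise (Function.onFun Disjoint S) →
    ∀ v : V, HasSum (fun n => proj (S n) v) (proj (⋃ n, S n) v)

variable {V : Type*} [NormedAddCommGroup V] [InnerProductSpace ℂ V] [CompleteSpace V]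

namespace PVM

theorem inner_proj_eq (E : PVM V) {S : Set ℝ} (hS : MeasurableSet S) (v : V) :
    (inner ℂ v (E.proj S v)).re = ‖E.proj S v‖ ^ 2 := by
  have h := E.isStarProjection S hS
  have h1 : E.proj S (E.proj S v) = E.proj S v := by
    have h2 := congrArg (fun B : V →L[ℂ] V => B v) h.isIdempotentElem.eq
    simpa using h2
  have h3 : inner ℂ (E.proj S v) (E.proj S v) = inner ℂ v (E.proj S v) := by
    have h4 := ContinuousLinearMap.adjoint_inner_right (E.proj S) v (E.proj S v)
    rw [(ContinuousLinearMap.isSelfAdjoint_iff'.mp h.isSelfAdjoint), h1] at h4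
    exact h4.symm
  rw [← h3, inner_self_eq_norm_sq_to_K]
  norm_cast

theorem proj_empty (E : PVM V) : E.proj ∅ = 0 := by
  ext v
  have h := E.hasSum_proj (fun _ => ∅) (fun _ => MeasurableSet.empty)
    (fun _ _ _ => disjoint_bot_left) v
  have h2 := h.summable.tendsto_atTop_zero
  simpa using tendsto_nhds_unique (tendsto_const_nhds (α := ℕ)) h2

/-- The scalar spectral measure `S ↦ ‖E(S) v‖² = ⟨v, E(S) v⟩` of a vector `v`. -/
noncomputable def scalarMeasure (E : PVM V) (v : V) : Measure ℝ :=
  Measure.ofMeasurable (fun S _ => ENNReal.ofReal (‖E.proj S v‖ ^ 2))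
    (by simp [E.proj_empty])
    (by
      intro S hS hd
      have h := E.hasSum_proj S hS hd v
      have h2 : HasSum (fun n => (inner ℂ v (E.proj (S n) v)).re)
          (inner ℂ v (E.proj (⋃ n, S n) v)).re :=
        (h.mapL (innerSL ℂ v)).mapL Complex.reCLM
      simp only [E.inner_proj_eq (hS _), E.inner_proj_eq (MeasurableSet.iUnion hS)] at h2
      rw [← h2.tsum_eq, ENNReal.ofReal_tsum_of_nonneg (fun _ => by positivity) h2.summable])

/-- `E` is a spectral resolution of the operator `H`, that is, `H = ∫ x dE(x)`: a vector is in the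
domain of `H` iff `∫ x² dμ_v(x) < ∞`, and `⟨v, H v⟩ = ∫ x dμ_v(x)` for such `v`, where
`μ_v` is the scalar spectral measure of `v`. -/
def IsResolutionOf (E : PVM V) (H : V →ₗ.[ℂ] V) : Prop :=
  (∀ v : V, v ∈ H.domain ↔ Integrable (fun x : ℝ => x ^ 2) (E.scalarMeasure v)) ∧
  ∀ v : H.domain, inner ℂ (v : V) (H v) = ∫ x : ℝ, (x : ℂ) ∂(E.scalarMeasure (v : V))

/-- The projection-valued measure concentrated at the point `0`. -/
noncomputable def diracZero : PVM V := by
  classical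
  exact
  { proj := fun S => if (0 : ℝ) ∈ S then 1 else 0
    isStarProjection := by
      intro S _
      split_ifs
      · exact IsStarProjection.one _
      · exact IsStarProjection.zero _
    proj_univ := by simp
    proj_inter := by
      intro S T _ _
      by_cases h1 : (0 : ℝ) ∈ S <;> by_cases h2 : (0 : ℝ) ∈ T <;> simp [h1, h2]
    hasSum_proj := by
      intro S _ hd v
      by_cases h : ∃ n, (0 : ℝ) ∈ S n
      · obtain ⟨n, hn⟩ := h
        have h0 : (0 : ℝ) ∈ ⋃ n, S n := Set.mem_iUnion.mpr ⟨n, hn⟩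
        simp only [h0, if_true]
        have key := hasSum_single (f := fun m => (if (0 : ℝ) ∈ S m then (1 : V →L[ℂ] V) else 0) v) n
          (by
            intro m hm
            have h1 : (0 : ℝ) ∉ S m := fun h1 => Set.disjoint_left.mp (hd hm) h1 hn
            simp [h1])
        simpa [hn] using key
      · have h0 : (0 : ℝ) ∉ ⋃ n, S n := fun h1 => h (Set.mem_iUnion.mp h1)
        push Not at h
        simp only [h0, h, if_false]
        simp }

instance : Nonempty (PVM V) := ⟨diracZero⟩

/-- The operator `∫ f dE` for a bounded Borel function `f`: the (unique) bounded operator `B` with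
`⟨v, B v⟩ = ∫ f dμ_v` for every `v`. -/
noncomputable def integral (E : PVM V) (f : ℝ → ℂ) : V →L[ℂ] V :=
  Classical.epsilon fun B : V →L[ℂ] V =>
    ∀ v : V, inner ℂ v (B v) = ∫ x : ℝ, f x ∂(E.scalarMeasure v)

end PVM

/-- The spectral resolution of a self-adjoint operator `H`: the (unique) projection-valued
measure `E` with `H = ∫ x dE(x)`. -/
noncomputable def spectralResolution (H : V →ₗ.[ℂ] V) : PVM V :=
  Classical.epsilon fun E : PVM V => E.IsResolutionOf H

/-- The spectral projection `P_S(H)`. -/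
noncomputable def spectralProj (H : V →ₗ.[ℂ] V) (S : Set ℝ) : V →L[ℂ] V :=
  (spectralResolution H).proj S

/-- The unitary group `e^{-itH}`, by the functional calculus. -/
noncomputable def evolution (H : V →ₗ.[ℂ] V) (t : ℝ) : V →L[ℂ] V :=
  (spectralResolution H).integral fun x => Complex.exp (-Complex.I * t * x)

/-- The bounded operator `B` is a two-sided inverse of `H - μ : D(H) → V`. -/
def IsResolventAt (H : V →ₗ.[ℂ] V) (μ : ℂ) (B : V →L[ℂ] V) : Prop :=
  (∀ v : V, ∃ h : B v ∈ H.domain, H ⟨B v, h⟩ - μ • B v = v) ∧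
  ∀ x : H.domain, B (H x - μ • (x : V)) = x

/-- The resolvent `R(μ) = (H - μ)⁻¹`, for `μ` in the resolvent set of `H`. -/
noncomputable def resolventOp (H : V →ₗ.[ℂ] V) (μ : ℂ) : V →L[ℂ] V :=
  Classical.epsilon fun B : V →L[ℂ] V => IsResolventAt H μ B

open Classical in
/-- `‖A v‖`, with the convention `‖A v‖ = ∞` when `v` is not in the domain of `A`. -/
noncomputable def extNorm (A : V →ₗ.[ℂ] V) (v : V) : ℝ≥0∞ :=
  if h : v ∈ A.domain then ‖A ⟨v, h⟩‖ₑ else ⊤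

/-- `sup (4π²)⁻¹ ∫ (‖A R(s+iε) φ‖² + ‖A R(s-iε) φ‖²) ds` over unit vectors `φ` and `ε > 0`. -/
noncomputable def resolventIntegralSup (H A : V →ₗ.[ℂ] V) : ℝ≥0∞ :=
  ⨆ (φ : V) (_ : ‖φ‖ = 1) (ε : ℝ) (_ : 0 < ε),
    ENNReal.ofReal (1 / (4 * Real.pi ^ 2)) *
      ∫⁻ s : ℝ, (extNorm A (resolventOp H (s + ε * Complex.I) φ) ^ 2 +
        extNorm A (resolventOp H (s - ε * Complex.I) φ) ^ 2)

/-- `sup (2π)⁻¹ ∫ ‖A e^{-itH} φ‖² dt` over unit vectors `φ`. -/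
noncomputable def timeIntegralSup (H A : V →ₗ.[ℂ] V) : ℝ≥0∞ :=
  ⨆ (φ : V) (_ : ‖φ‖ = 1),
    ENNReal.ofReal (1 / (2 * Real.pi)) * ∫⁻ t : ℝ, extNorm A (evolution H t φ) ^ 2

/-- `sup ‖P_{(a,b)}(H) A* φ‖² / (b - a)` over unit vectors `φ ∈ D(A*)` and `a < b`. -/
noncomputable def spectralProjSup (H A : V →ₗ.[ℂ] V) : ℝ≥0∞ :=
  ⨆ (φ : A.adjoint.domain) (_ : ‖(φ : V)‖ = 1) (a : ℝ) (b : ℝ) (_ : a < b),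
    ENNReal.ofReal (‖spectralProj H (Set.Ioo a b) (A.adjoint φ)‖ ^ 2 / (b - a))

/-- `sup (2π)⁻¹ |⟨A* φ, [R(μ) - R(μ̄)] A* φ⟩|` over unit vectors `φ ∈ D(A*)` and non-real `μ`. -/
noncomputable def resolventDiffSup (H A : V →ₗ.[ℂ] V) : ℝ≥0∞ :=
  ⨆ (φ : A.adjoint.domain) (_ : ‖(φ : V)‖ = 1) (μ : ℂ) (_ : μ.im ≠ 0),
    ENNReal.ofReal (1 / (2 * Real.pi) *
      ‖inner ℂ (A.adjoint φ)
        ((resolventOp H μ - resolventOp H (starRingEnd ℂ μ)) (A.adjoint φ))‖)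

/-- `sup π⁻¹ ‖R(μ) A* φ‖² |Im μ|` over unit vectors `φ ∈ D(A*)` and non-real `μ`. -/
noncomputable def resolventNormSup (H A : V →ₗ.[ℂ] V) : ℝ≥0∞ :=
  ⨆ (φ : A.adjoint.domain) (_ : ‖(φ : V)‖ = 1) (μ : ℂ) (_ : μ.im ≠ 0),
    ENNReal.ofReal (1 / Real.pi * ‖resolventOp H μ (A.adjoint φ)‖ ^ 2 * |μ.im|)

/-- The squared smoothness norm `‖A‖_H²`. -/
noncomputable def smoothNormSq (H A : V →ₗ.[ℂ] V) : ℝ≥0∞ := resolventIntegralSup H A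

/-- `A` is `H`-smooth. -/
def IsHSmooth (H A : V →ₗ.[ℂ] V) : Prop := smoothNormSq H A < ⊤

end KatoSmooth

/-! Write T for the time integral supremum, S for the one over spectral projections and N for the
one over `‖R(μ)A*φ‖²`.

Everything is first reduced to scalar functions. There is an orthonormal family `e j` in `D(A*)`
with `‖A v‖² = ∑ |⟨A* e j, v⟩|²` for every `v`, including the value `∞` off `D(A)`
(`exists_orthonormal_extNorm_sq`). Identities between nonnegative integrals may therefore be proved
for one functional `⟨u, ·⟩` at a time and then summed.

Resolvent integrals and time integrals: `R(s ± iε)` is, up to a factor `∓i`, the Fourier transform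
at `s` of `exp(-ε|t|) exp(-itH)` cut off to `t > 0` or `t ≤ 0`. Plancherel turns the resolvent
integral into `2π ∫ exp(-2ε|t|) ‖A exp(-itH) φ‖² dt`, and the supremum over `ε` removes the weight.
The jump `R(s + iε) - R(s - iε)` corresponds to the weight on the whole line, so its square integral
has the same value.

The form of `R(μ) - R(μ̄)` and N agree term by term, since `R(μ) - R(μ̄) = (μ - μ̄) R(μ)* R(μ)`.
There remains the cycle T ≤ N ≤ S ≤ T.

T ≤ N: write the jump as `2iε R(s - iε) R(s + iε)`. The first factor, preceded by `A`, is bounded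
through the duality of `A R(μ)` with `R(μ̄) A*`; the second has square integral `π/ε`.

N ≤ S: `‖R(μ)A*φ‖²` is the integral of a Poisson kernel against the spectral measure of `A*φ`, and
the superlevel sets of that kernel are intervals.

S ≤ T: for `χ = P_{(a,b)} A*φ`, Stone's formula gives `2π‖χ‖²` as the limit of the integrals over
`(a,b)` of `|⟨A*φ, jump χ⟩|`. Cauchy-Schwarz and the Plancherel identity give `(2π‖χ‖²)² ≤ (b - a)
(2π)² ‖χ‖² T`.

Spectral projections, evolution and resolvent are all defined by choice, so the spectral theorem has
to be proved as well. It is obtained from the continuous functional calculus of the bounded normal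
operator `R(i)`, by way of Riesz measures (`exists_isResolutionOf`, `resolventOp_eq_integral`). -/

namespace KatoSmooth

/-! ### The extended norm computed through the adjoint -/

variable {V : Type*} [NormedAddCommGroup V] [InnerProductSpace ℂ V] [CompleteSpace V]

/-- The orthogonal complement of the graph of a closed operator determines it: a vector `v` is in
the domain, with `A v = w`, as soon as `⟨v, A* φ⟩ = ⟨w, φ⟩` for every `φ` in the domain of `A*`. -/
theorem mem_graph_of_inner_adjoint {A : V →ₗ.[ℂ] V} (hA : A.IsClosed)
    (hAd : Dense (A.domain : Set V)) {v w : V}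
    (h : ∀ φ : A.adjoint.domain, inner ℂ v (A.adjoint φ) = inner ℂ w (φ : V)) :
    (v, w) ∈ A.graph := by
  -- In the `ℓ²` norm the product is a Hilbert space, where the closed graph is its own double
  -- orthogonal complement.
  let e := (WithLp.prodContinuousLinearEquiv 2 ℂ V V)
  let G : Submodule ℂ (WithLp 2 (V × V)) := A.graph.comap (e : WithLp 2 (V × V) →ₗ[ℂ] V × V)
  have hG : IsClosed (G : Set (WithLp 2 (V × V))) := by
    have : (G : Set (WithLp 2 (V × V))) = e ⁻¹' (A.graph : Set (V × V)) := rfl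
    rw [this]
    exact hA.preimage e.continuous
  have : CompleteSpace G := hG.completeSpace_coe
  have hmem : WithLp.toLp 2 (v, w) ∈ Gᗮᗮ := by
    rw [Submodule.mem_orthogonal]
    intro u hu
    -- Orthogonality of `u` to the graph says exactly that `u.snd` lies in `D(A*)` with `A* u.snd =
    -- -u.fst`.
    have hu' : ∀ x : A.domain, inner ℂ (-u.fst) (x : V) = inner ℂ u.snd (A x) := by
      intro x
      have h1 : WithLp.toLp 2 ((x : V), A x) ∈ G := A.mem_graph x
      have h2 := (Submodule.mem_orthogonal' _ _).1 hu _ h1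
      rw [WithLp.prod_inner_apply] at h2
      rw [inner_neg_left, neg_eq_iff_add_eq_zero]
      exact h2
    have hd : u.snd ∈ A.adjoint.domain := LinearPMap.mem_adjoint_domain_of_exists _ ⟨_, hu'⟩
    have hval : A.adjoint ⟨u.snd, hd⟩ = -u.fst := LinearPMap.adjoint_apply_eq hAd _ hu'
    have h3 := h ⟨u.snd, hd⟩
    rw [hval, inner_neg_right, neg_eq_iff_add_eq_zero] at h3
    rw [← inner_conj_symm, WithLp.prod_inner_apply]
    exact (congrArg _ h3).trans (map_zero _)
  rw [Submodule.orthogonal_orthogonal] at hmem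
  exact hmem

/-- The functional `φ ↦ ⟨v, A* φ⟩` is bounded on `D(A*)`. A Hahn-Banach extension has the same norm,
and its Riesz vector is `A v`. Membership `v ∈ D(A)` is part of the conclusion, because the bound is
finite. -/
theorem extNorm_le_of_inner_adjoint {A : V →ₗ.[ℂ] V} (hA : A.IsClosed)
    (hAd : Dense (A.domain : Set V)) {v : V} {K : ℝ} (hK : 0 ≤ K)
    (h : ∀ φ : A.adjoint.domain, ‖inner ℂ (A.adjoint φ) v‖ ≤ K * ‖(φ : V)‖) :
    extNorm A v ≤ ENNReal.ofReal K := by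
  let l : A.adjoint.domain →ₗ[ℂ] ℂ := ((innerSL ℂ v : V →L[ℂ] ℂ) : V →ₗ[ℂ] ℂ).comp A.adjoint.toFun
  have hl : ∀ φ, ‖l φ‖ ≤ K * ‖φ‖ := by
    intro φ
    have : l φ = inner ℂ v (A.adjoint φ) := rfl
    rw [this, ← inner_conj_symm, RCLike.norm_conj]
    exact h φ
  obtain ⟨g, hg, hgn⟩ := exists_extension_norm_eq A.adjoint.domain (l.mkContinuous K hl)
  have hgK : ‖g‖ ≤ K := hgn.trans_le (LinearMap.mkContinuous_norm_le _ hK _)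
  let w := (InnerProductSpace.toDual ℂ V).symm g
  have hgr : (v, w) ∈ A.graph := by
    refine mem_graph_of_inner_adjoint hA hAd fun φ => ?_
    have h1 : inner ℂ w (φ : V) = g φ := InnerProductSpace.toDual_symm_apply
    rw [h1, hg]
    rfl
  obtain ⟨y, hy1, hy2⟩ := (A.mem_graph_iff).1 hgr
  have hy1' : (y : V) = v := hy1
  subst hy1'
  rw [extNorm, dif_pos y.2, ← ofReal_norm]
  refine ENNReal.ofReal_le_ofReal ?_
  have hy2' : A y = w := hy2
  calc ‖A y‖ = ‖w‖ := by rw [hy2']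
    _ = ‖g‖ := LinearIsometryEquiv.norm_map _ _
    _ ≤ K := hgK

theorem enorm_inner_adjoint_le_extNorm {A : V →ₗ.[ℂ] V} (hAd : Dense (A.domain : Set V)) (v : V)
    {φ : A.adjoint.domain} (hφ : ‖(φ : V)‖ = 1) :
    ‖inner ℂ (A.adjoint φ) v‖ₑ ≤ extNorm A v := by
  rw [extNorm]
  split_ifs with hv
  · rw [LinearPMap.adjoint_isFormalAdjoint hAd φ ⟨v, hv⟩, ← ofReal_norm, ← ofReal_norm]
    refine ENNReal.ofReal_le_ofReal ((norm_inner_le_norm _ _).trans ?_)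
    rw [hφ, one_mul]
  · exact le_top

/-- Subsets of a separable metric space are separable. Density in the graph, not merely in the
domain, makes the span of the sequence a core, so that bounds on `⟨B φ, v⟩` extend from the span to
the whole domain. -/
theorem exists_seq_graph_dense {V : Type*} [NormedAddCommGroup V] [InnerProductSpace ℂ V]
    [TopologicalSpace.SeparableSpace V] (B : V →ₗ.[ℂ] V) :
    ∃ f : ℕ → B.domain, ∀ φ : B.domain,
      ((φ : V), B φ) ∈ closure (Set.range fun n => ((f n : V), B (f n))) := by
  let g : B.domain → V × V := fun φ => ((φ : V), B φ)
  have hs : TopologicalSpace.IsSeparable (Set.range g) := TopologicalSpace.IsSeparable.of_separableSpace _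
  have : TopologicalSpace.SeparableSpace (Set.range g) := hs.separableSpace
  have : Nonempty (Set.range g) := ⟨⟨g 0, 0, rfl⟩⟩
  obtain ⟨u, hu⟩ := TopologicalSpace.exists_dense_seq (Set.range g)
  choose f hf using fun n => (u n).2
  refine ⟨f, fun φ => ?_⟩
  have h1 := hu ⟨g φ, φ, rfl⟩
  rw [closure_subtype] at h1
  convert h1 using 2
  ext x
  simp only [Set.mem_range, Set.mem_image]
  constructor
  · rintro ⟨n, rfl⟩
    exact ⟨u n, ⟨n, rfl⟩, (hf n).symm⟩
  · rintro ⟨_, ⟨n, rfl⟩, rfl⟩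
    exact ⟨n, hf n⟩

/-- There is an orthonormal family in the domain of `A*` that computes `‖A v‖²` for every `v`,
including the value `∞` off the domain of `A`. -/
theorem exists_orthonormal_extNorm_sq [TopologicalSpace.SeparableSpace V] {A : V →ₗ.[ℂ] V}
    (hA : A.IsClosed) (hAd : Dense (A.domain : Set V)) :
    ∃ (s : Set ℕ) (e : s → A.adjoint.domain), (∀ j, ‖(e j : V)‖ = 1) ∧
      ∀ v : V, extNorm A v ^ 2 = ∑' j, ‖inner ℂ (A.adjoint (e j)) v‖ₑ ^ 2 := by
  obtain ⟨f, hf⟩ := exists_seq_graph_dense A.adjoint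
  -- Gram-Schmidt runs inside `D(A*)`, so that `A*` applies to its output; the indices where it
  -- returns zero are discarded.
  let s : Set ℕ := {n | InnerProductSpace.gramSchmidtNormed ℂ f n ≠ 0}
  let e : s → A.adjoint.domain := fun j => InnerProductSpace.gramSchmidtNormed ℂ f j
  have he : Orthonormal ℂ e := InnerProductSpace.gramSchmidtNormed_orthonormal' f
  have heV : Orthonormal ℂ (fun j => (e j : V)) := he.comp_linearIsometry A.adjoint.domain.subtypeₗᵢ
  have hspan : ∀ n, f n ∈ Submodule.span ℂ (Set.range e) := by
    intro n
    have h1 : f n ∈ Submodule.span ℂ (Set.range (InnerProductSpace.gramSchmidtNormed ℂ f)) := by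
      rw [InnerProductSpace.span_gramSchmidtNormed_range, InnerProductSpace.span_gramSchmidt]
      exact Submodule.subset_span ⟨n, rfl⟩
    refine Submodule.span_le.2 ?_ h1
    rintro _ ⟨m, rfl⟩
    by_cases hm : InnerProductSpace.gramSchmidtNormed ℂ f m = 0
    · rw [hm]; exact Submodule.zero_mem _
    · exact Submodule.subset_span ⟨⟨m, hm⟩, rfl⟩
  refine ⟨s, e, fun j => heV.1 j, fun v => le_antisymm ?_ ?_⟩
  · by_cases htop : ∑' j, ‖inner ℂ (A.adjoint (e j)) v‖ₑ ^ 2 = ⊤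
    · rw [htop]; exact le_top
    have hsum : Summable fun j => ‖inner ℂ (A.adjoint (e j)) v‖ ^ 2 := by
      have h1 := ENNReal.summable_toReal htop
      simpa using h1
    set K2 : ℝ := ∑' j, ‖inner ℂ (A.adjoint (e j)) v‖ ^ 2 with hK2
    have hK0 : 0 ≤ K2 := tsum_nonneg fun j => by positivity
    have hval : ∑' j, ‖inner ℂ (A.adjoint (e j)) v‖ₑ ^ 2 = ENNReal.ofReal K2 := by
      rw [hK2, ENNReal.ofReal_tsum_of_nonneg (fun j => by positivity) hsum]
      refine tsum_congr fun j => ?_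
      rw [ENNReal.ofReal_pow (norm_nonneg _), ofReal_norm]
    -- Cauchy-Schwarz in the coefficients, whose `ℓ²` norm is `‖φ‖` by orthonormality.
    have hbound : ∀ φ ∈ Submodule.span ℂ (Set.range e),
        ‖inner ℂ (A.adjoint φ) v‖ ≤ √K2 * ‖(φ : V)‖ := by
      intro φ hφ
      obtain ⟨c, rfl⟩ := (Finsupp.mem_span_range_iff_exists_finsupp).1 hφ
      have hφn : ‖((c.sum fun i a => a • e i : A.adjoint.domain) : V)‖ ^ 2
          = ∑ i ∈ c.support, ‖c i‖ ^ 2 := by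
        have h2 : ((c.sum fun i a => a • e i : A.adjoint.domain) : V)
            = ∑ i ∈ c.support, c i • (e i : V) := by
          simp [Finsupp.sum]
        have h3 := heV.inner_sum (fun i => c i) (fun i => c i) c.support
        rw [← h2, inner_self_eq_norm_sq_to_K] at h3
        have h4 : ∀ i, (starRingEnd ℂ) (c i) * c i = ((‖c i‖ ^ 2 : ℝ) : ℂ) := fun i => by
          rw [Complex.conj_mul']; norm_cast
        simp only [h4] at h3
        refine Complex.ofReal_injective ?_
        rw [Complex.ofReal_sum, Complex.ofReal_pow]
        exact h3
      have hin : inner ℂ (A.adjoint (c.sum fun i a => a • e i)) v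
          = ∑ i ∈ c.support, (starRingEnd ℂ) (c i) * inner ℂ (A.adjoint (e i)) v := by
        have h2 : A.adjoint (∑ i ∈ c.support, c i • e i)
            = ∑ i ∈ c.support, c i • A.adjoint (e i) :=
          (map_sum A.adjoint.toFun (fun i => c i • e i) c.support).trans
            (Finset.sum_congr rfl fun i _ => map_smul A.adjoint.toFun (c i) (e i))
        rw [Finsupp.sum, h2, sum_inner]
        exact Finset.sum_congr rfl fun i _ => inner_smul_left _ _ _
      rw [hin]
      refine abs_le_of_sq_le_sq' ?_ (by positivity) |>.2
      rw [mul_pow, Real.sq_sqrt hK0, hφn]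
      calc ‖∑ i ∈ c.support, (starRingEnd ℂ) (c i) * inner ℂ (A.adjoint (e i)) v‖ ^ 2
          ≤ (∑ i ∈ c.support, ‖c i‖ * ‖inner ℂ (A.adjoint (e i)) v‖) ^ 2 := by
            gcongr
            refine (norm_sum_le _ _).trans (le_of_eq ?_)
            simp
        _ ≤ (∑ i ∈ c.support, ‖c i‖ ^ 2) *
            ∑ i ∈ c.support, ‖inner ℂ (A.adjoint (e i)) v‖ ^ 2 :=
            Finset.sum_mul_sq_le_sq_mul_sq _ _ _
        _ ≤ (∑ i ∈ c.support, ‖c i‖ ^ 2) * K2 := by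
            gcongr
            exact hsum.sum_le_tsum _ fun _ _ => by positivity
        _ = _ := mul_comm _ _
    have hall : ∀ φ : A.adjoint.domain, ‖inner ℂ (A.adjoint φ) v‖ ≤ √K2 * ‖(φ : V)‖ := by
      intro φ
      -- The estimate is a closed condition on the pair `(φ, A* φ)`, hence passes to graph limits.
      have hcl : IsClosed {p : V × V | ‖inner ℂ p.2 v‖ ≤ √K2 * ‖p.1‖} :=
        isClosed_le (by fun_prop) (by fun_prop)
      refine closure_minimal ?_ hcl (hf φ)
      rintro _ ⟨n, rfl⟩
      exact hbound _ (hspan n)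
    have h3 := extNorm_le_of_inner_adjoint hA hAd (Real.sqrt_nonneg K2) hall
    rw [hval]
    calc extNorm A v ^ 2 ≤ ENNReal.ofReal (√K2) ^ 2 := by gcongr
      _ = ENNReal.ofReal K2 := by
        rw [← ENNReal.ofReal_pow (Real.sqrt_nonneg _), Real.sq_sqrt hK0]
  -- The reverse inequality is Bessel's inequality for `A v`.
  · rw [extNorm]
    split_ifs with hv
    · have h1 : ∀ j, ‖inner ℂ (A.adjoint (e j)) v‖ₑ ^ 2
          = ENNReal.ofReal (‖inner ℂ (e j : V) (A ⟨v, hv⟩)‖ ^ 2) := by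
        intro j
        rw [LinearPMap.adjoint_isFormalAdjoint hAd (e j) ⟨v, hv⟩,
          ENNReal.ofReal_pow (norm_nonneg _), ofReal_norm]
      simp_rw [h1]
      rw [← ENNReal.ofReal_tsum_of_nonneg (fun j => by positivity)
        (heV.inner_products_summable _), ← ofReal_norm, ← ENNReal.ofReal_pow (norm_nonneg _)]
      exact ENNReal.ofReal_le_ofReal (heV.tsum_inner_products_le _)
    · simp

end KatoSmooth

/-! ### Plancherel for integrable square-integrable functions -/

namespace KatoSmooth

open scoped FourierTransform SchwartzMap ContDiff in
/-- Plancherel's theorem for the Fourier integral of a function in `L¹ ∩ L²`. -/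
theorem lintegral_fourier_sq {g : ℝ → ℂ} (h1 : Integrable g) (h2 : MemLp g 2) :
    ∫⁻ ξ, ‖𝓕 g ξ‖ₑ ^ 2 = ∫⁻ t, ‖g t‖ₑ ^ 2 := by
  have hcont : Continuous (𝓕 g) :=
    VectorFourier.fourierIntegral_continuous Real.continuous_fourierChar (by fun_prop) h1
  -- The `L²` Fourier transform and the Fourier integral are compared against smooth compactly
  -- supported functions: either way the transform can be moved onto the test function.
  have hae : ∀ᵐ ξ, (𝓕 (h2.toLp g) : Lp ℂ 2 (volume : Measure ℝ)) ξ = 𝓕 g ξ := by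
    refine ae_eq_of_integral_contDiff_smul_eq ?_ hcont.locallyIntegrable ?_
    · exact (Lp.memLp _).locallyIntegrable (by norm_num)
    · intro s hs hsc
      have hs' : ContDiff ℝ ∞ (fun x => (s x : ℂ)) := Complex.ofRealCLM.contDiff.comp hs
      have hsc' : HasCompactSupport (fun x => (s x : ℂ)) := hsc.comp_left (g := fun x : ℝ => (x : ℂ)) rfl
      let S : 𝓢(ℝ, ℂ) := hsc'.toSchwartzMap hs'
      have h3 := congrArg (fun T : 𝓢'(ℝ, ℂ) => T S) (Lp.fourier_toTemperedDistribution_eq (h2.toLp g))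
      simp only [TemperedDistribution.fourier_apply, Lp.toTemperedDistribution_apply] at h3
      have h4 : ∫ x, s x • (𝓕 (h2.toLp g) : Lp ℂ 2 (volume : Measure ℝ)) x
          = ∫ x, S x • (𝓕 (h2.toLp g) : Lp ℂ 2 (volume : Measure ℝ)) x := by
        refine integral_congr_ae (Filter.Eventually.of_forall fun x => ?_)
        simp [S]
      rw [h4, ← h3]
      have h5 : ∫ x, (𝓕 S) x • (h2.toLp g) x = ∫ x, (𝓕 S) x • g x := by
        refine integral_congr_ae ?_
        filter_upwards [h2.coeFn_toLp] with x hx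
        simp only [hx]
      rw [h5]
      have h6 := VectorFourier.integral_fourierIntegral_smul_eq_flip (μ := volume) (ν := volume)
        (L := innerₗ ℝ) (f := S) (g := g) Real.continuous_fourierChar (by fun_prop) S.integrable h1
      rw [flip_innerₗ] at h6
      have h7 : ∀ x, (𝓕 S) x = VectorFourier.fourierIntegral Real.fourierChar volume (innerₗ ℝ) S x := by
        intro x
        rw [SchwartzMap.fourier_coe]
        rfl
      simp_rw [h7]
      rw [h6]
      refine integral_congr_ae (Filter.Eventually.of_forall fun x => ?_)
      simp [S]
      left; rfl
  have h8 : eLpNorm (𝓕 (h2.toLp g) : Lp ℂ 2 (volume : Measure ℝ)) 2 volume = eLpNorm g 2 volume := by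
    have := Lp.norm_fourier_eq (h2.toLp g)
    rw [Lp.norm_def, Lp.norm_def, ENNReal.toReal_eq_toReal_iff' (Lp.eLpNorm_ne_top _) (Lp.eLpNorm_ne_top _)] at this
    rw [this]
    exact eLpNorm_congr_ae h2.coeFn_toLp
  rw [eLpNorm_congr_ae hae] at h8
  have h9 : ∀ u : ℝ → ℂ, ∫⁻ x, ‖u x‖ₑ ^ 2 = eLpNorm u 2 volume ^ 2 := by
    intro u
    have := eLpNorm_nnreal_pow_eq_lintegral (f := u) (μ := volume) (p := 2) (by norm_num)
    simpa using this.symm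
  rw [h9, h9, h8]

end KatoSmooth

/-! ### Quadratic forms and bounded operators -/

namespace KatoSmooth

open Filter Topology

section Forms

variable {V : Type*} [NormedAddCommGroup V] [InnerProductSpace ℂ V]

/-- The polarization of a function `q`, thought of as a quadratic form. -/
noncomputable def polar (q : V → ℂ) (u v : V) : ℂ :=
  (q (u + v) - q (u - v) - Complex.I * q (u + Complex.I • v) +
    Complex.I * q (u - Complex.I • v)) / 4

theorem inner_eq_polar (B : V →ₗ[ℂ] V) (u v : V) :
    inner ℂ u (B v) = polar (fun w => inner ℂ w (B w)) u v := by
  simp only [polar, map_add, map_sub, map_smul, inner_add_left, inner_add_right, inner_sub_left,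
    inner_sub_right, inner_smul_left, inner_smul_right, Complex.conj_I]
  linear_combination ((inner ℂ u (B v)) / 2 - inner ℂ v (B u) / 2) * Complex.I_sq

theorem ext_of_inner_self {B B' : V →L[ℂ] V} (h : ∀ v, inner ℂ v (B v) = inner ℂ v (B' v)) :
    B = B' := by
  ext v
  refine ext_inner_left ℂ fun u => ?_
  have h1 := inner_eq_polar (B : V →ₗ[ℂ] V) u v
  have h2 := inner_eq_polar (B' : V →ₗ[ℂ] V) u v
  simp only [ContinuousLinearMap.coe_coe, h] at h1 h2
  rw [h1, h2]

theorem tendsto_polar {ι : Type*} {l : Filter ι} {q : ι → V → ℂ} {q' : V → ℂ}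
    (h : ∀ v, Tendsto (fun i => q i v) l (𝓝 (q' v))) (u v : V) :
    Tendsto (fun i => polar (q i) u v) l (𝓝 (polar q' u v)) :=
  ((((h _).sub (h _)).sub ((h _).const_mul _)).add ((h _).const_mul _)).div_const _

theorem tendsto_inner_of_tendsto_inner_self {ι : Type*} {l : Filter ι} {B : ι → V →L[ℂ] V}
    {B' : V →L[ℂ] V} (h : ∀ v, Tendsto (fun i => inner ℂ v (B i v)) l (𝓝 (inner ℂ v (B' v))))
    (u v : V) : Tendsto (fun i => inner ℂ u (B i v)) l (𝓝 (inner ℂ u (B' v))) := by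
  have h1 := tendsto_polar h u v
  have h2 : ∀ B : V →L[ℂ] V, polar (fun w => inner ℂ w (B w)) u v = inner ℂ u (B v) :=
    fun B => (inner_eq_polar (B : V →ₗ[ℂ] V) u v).symm
  simpa only [h2] using h1

theorem norm_polar_le {q : V → ℂ} {C : ℝ} (hC : ∀ v, ‖q v‖ ≤ C * ‖v‖ ^ 2) (hC0 : 0 ≤ C) (u v : V) :
    ‖polar q u v‖ ≤ C * (‖u‖ + ‖v‖) ^ 2 := by
  have h1 : ∀ w : V, ‖w‖ ≤ ‖u‖ + ‖v‖ → ‖q w‖ ≤ C * (‖u‖ + ‖v‖) ^ 2 := fun w hw =>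
    (hC w).trans (by gcongr)
  have hI : ‖Complex.I • v‖ = ‖v‖ := by simp [norm_smul]
  have a1 := h1 (u + v) (norm_add_le _ _)
  have a2 := h1 (u - v) (norm_sub_le _ _)
  have a3 := h1 (u + Complex.I • v) ((norm_add_le _ _).trans_eq (by rw [hI]))
  have a4 := h1 (u - Complex.I • v) ((norm_sub_le _ _).trans_eq (by rw [hI]))
  rw [polar, norm_div]
  have h4 : ‖(4 : ℂ)‖ = 4 := by norm_num
  rw [h4, div_le_iff₀ (by norm_num)]
  refine (norm_add_le _ _).trans ?_
  refine (add_le_add_left ((norm_sub_le _ _).trans (add_le_add_left (norm_sub_le _ _) _)) _).trans ?_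
  simp only [norm_mul, Complex.norm_I, one_mul]
  linarith

/-- A pointwise limit of the quadratic forms of bounded operators that is a bounded form comes from
a bounded operator. -/
theorem exists_clm_of_tendsto [CompleteSpace V] {B : ℕ → V →L[ℂ] V} {q : V → ℂ} {C : ℝ}
    (h : ∀ v, Tendsto (fun n => inner ℂ v (B n v)) atTop (𝓝 (q v)))
    (hC : ∀ v, ‖q v‖ ≤ C * ‖v‖ ^ 2) (hC0 : 0 ≤ C) :
    ∃ B' : V →L[ℂ] V, ∀ v, inner ℂ v (B' v) = q v := by
  -- The polarization of `q` is a limit of sesquilinear forms, which is how it inherits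
  -- sesquilinearity.
  have hlim : ∀ u v, Tendsto (fun n => inner ℂ u (B n v)) atTop (𝓝 (polar q u v)) := by
    intro u v
    have h1 := tendsto_polar h u v
    have h2 : ∀ n, polar (fun w => inner ℂ w (B n w)) u v = inner ℂ u (B n v) :=
      fun n => (inner_eq_polar (B n : V →ₗ[ℂ] V) u v).symm
    simpa only [h2] using h1
  have hsmul1 : ∀ (c : ℂ) (u v : V), polar q (c • u) v = (starRingEnd ℂ) c * polar q u v := by
    intro c u v
    refine tendsto_nhds_unique (hlim (c • u) v) ?_
    simpa only [inner_smul_left] using (hlim u v).const_mul ((starRingEnd ℂ) c)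
  have hsmul2 : ∀ (c : ℂ) (u v : V), polar q u (c • v) = c * polar q u v := by
    intro c u v
    refine tendsto_nhds_unique (hlim u (c • v)) ?_
    simpa only [map_smul, inner_smul_right] using (hlim u v).const_mul c
  let b : V →ₗ⋆[ℂ] V →ₗ[ℂ] ℂ := LinearMap.mk₂'ₛₗ (starRingEnd ℂ) (RingHom.id ℂ) (polar q)
    (fun u u' v => by
      refine tendsto_nhds_unique (hlim (u + u') v) ?_
      simpa only [inner_add_left] using (hlim u v).add (hlim u' v))
    (fun c u v => hsmul1 c u v)
    (fun u v v' => by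
      refine tendsto_nhds_unique (hlim u (v + v')) ?_
      simpa only [map_add, inner_add_right] using (hlim u v).add (hlim u v'))
    (fun c u v => hsmul2 c u v)
  -- For unit vectors polarization gives `C (1 + 1)²`; homogeneity does the rest.
  have hbound : ∀ u v, ‖b u v‖ ≤ 4 * C * ‖u‖ * ‖v‖ := by
    intro u v
    change ‖polar q u v‖ ≤ _
    by_cases hu : u = 0
    · have := hsmul1 0 u v
      simp only [zero_smul, map_zero, zero_mul] at this
      rw [hu, this]
      simp
    by_cases hv : v = 0
    · have := hsmul2 0 u v
      simp only [zero_smul, zero_mul] at this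
      rw [hv, this]
      simp
    have hu' : ‖u‖ ≠ 0 := norm_ne_zero_iff.2 hu
    have hv' : ‖v‖ ≠ 0 := norm_ne_zero_iff.2 hv
    have h1 := norm_polar_le hC hC0 (((‖u‖⁻¹ : ℝ) : ℂ) • u) (((‖v‖⁻¹ : ℝ) : ℂ) • v)
    rw [hsmul1, hsmul2, norm_mul, norm_mul, RCLike.norm_conj, norm_smul, norm_smul,
      Complex.norm_real, Complex.norm_real, norm_inv, norm_inv, norm_norm, norm_norm,
      inv_mul_cancel₀ hu', inv_mul_cancel₀ hv', ← mul_assoc, ← mul_inv, inv_mul_le_iff₀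
        (by positivity)] at h1
    linarith
  let B' := (InnerProductSpace.continuousLinearMapOfBilin (b.mkContinuous₂ (4 * C) hbound))
  -- `B'` represents the form in the left slot of the inner product, hence the adjoint.
  refine ⟨ContinuousLinearMap.adjoint B', fun v => ?_⟩
  rw [ContinuousLinearMap.adjoint_inner_right, InnerProductSpace.continuousLinearMapOfBilin_apply]
  change polar q v v = q v
  refine tendsto_nhds_unique (hlim v v) (h v)

end Forms

/-! ### Bounded measurable functions -/

section BoundedMeasurable

variable {X : Type*} [MeasurableSpace X]

/-- Bounded measurable complex functions. -/
def BddMeas (f : X → ℂ) : Prop := Measurable f ∧ ∃ C, ∀ x, ‖f x‖ ≤ C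

theorem BddMeas.integrable {f : X → ℂ} (hf : BddMeas f) (μ : Measure X) [IsFiniteMeasure μ] :
    Integrable f μ := by
  obtain ⟨h1, C, hC⟩ := hf
  exact Integrable.of_bound h1.aestronglyMeasurable C (Eventually.of_forall hC)

theorem bddMeas_indicator {S : Set X} (hS : MeasurableSet S) :
    BddMeas (S.indicator fun _ => (1 : ℂ)) := by
  refine ⟨measurable_const.indicator hS, 1, fun x => ?_⟩
  refine (norm_indicator_le_norm_self _ _).trans ?_
  simp

theorem BddMeas.add {f g : X → ℂ} (hf : BddMeas f) (hg : BddMeas g) : BddMeas (f + g) := by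
  obtain ⟨h1, C, hC⟩ := hf
  obtain ⟨h2, D, hD⟩ := hg
  exact ⟨h1.add h2, C + D, fun x => (norm_add_le _ _).trans (add_le_add (hC x) (hD x))⟩

theorem BddMeas.mul {f g : X → ℂ} (hf : BddMeas f) (hg : BddMeas g) : BddMeas (f * g) := by
  obtain ⟨h1, C, hC⟩ := hf
  obtain ⟨h2, D, hD⟩ := hg
  refine ⟨h1.mul h2, C * D, fun x => (norm_mul_le _ _).trans ?_⟩
  exact mul_le_mul (hC x) (hD x) (norm_nonneg _) ((norm_nonneg _).trans (hC x))

theorem BddMeas.const_smul {f : X → ℂ} (hf : BddMeas f) (c : ℂ) : BddMeas (c • f) := by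
  obtain ⟨h1, C, hC⟩ := hf
  refine ⟨h1.const_smul c, ‖c‖ * C, fun x => ?_⟩
  rw [Pi.smul_apply, norm_smul]
  exact mul_le_mul_of_nonneg_left (hC x) (norm_nonneg _)

theorem BddMeas.conj {f : X → ℂ} (hf : BddMeas f) : BddMeas (fun x => (starRingEnd ℂ) (f x)) := by
  obtain ⟨h1, C, hC⟩ := hf
  exact ⟨Complex.continuous_conj.measurable.comp h1, C, fun x => by rw [RCLike.norm_conj]; exact hC x⟩

/-- Induction for bounded measurable functions: indicators, linear combinations and bounded
pointwise limits. -/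
theorem BddMeas.induction {P : (X → ℂ) → Prop}
    (hind : ∀ S, MeasurableSet S → P (S.indicator fun _ => 1))
    (hadd : ∀ f g, BddMeas f → BddMeas g → P f → P g → P (f + g))
    (hsmul : ∀ (c : ℂ) f, BddMeas f → P f → P (c • f))
    (hlim : ∀ (C : ℝ) (F : ℕ → X → ℂ) (f : X → ℂ), (∀ n, Measurable (F n)) →
      (∀ n x, ‖F n x‖ ≤ C) → BddMeas f → (∀ x, Tendsto (fun n => F n x) atTop (𝓝 (f x))) →
      (∀ n, P (F n)) → P f)
    {f : X → ℂ} (hf : BddMeas f) : P f := by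
  have hsimple : ∀ g : SimpleFunc X ℂ, BddMeas (g : X → ℂ) ∧ P g := by
    intro g
    induction g using SimpleFunc.induction with
    | const c hs =>
      rename_i S
      have h1 : ((SimpleFunc.piecewise S hs (SimpleFunc.const X c) (SimpleFunc.const X 0) :
          SimpleFunc X ℂ) : X → ℂ) = c • S.indicator fun _ => (1 : ℂ) := by
        ext x
        by_cases hx : x ∈ S <;> simp [hx]
      rw [h1]
      exact ⟨(bddMeas_indicator hs).const_smul c, hsmul c _ (bddMeas_indicator hs) (hind S hs)⟩
    | add _ h1 h2 =>
      rw [SimpleFunc.coe_add]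
      exact ⟨h1.1.add h2.1, hadd _ _ h1.1 h2.1 h1.2 h2.2⟩
  obtain ⟨hm, C, hC⟩ := hf
  -- The simple approximations satisfy only `‖F n x‖ ≤ ‖f x‖ + ‖f x‖`.
  refine hlim (C + C) (fun n => SimpleFunc.approxOn f hm Set.univ 0 (Set.mem_univ _) n) f
    (fun n => SimpleFunc.measurable _) (fun n x => ?_) ⟨hm, C, hC⟩ (fun x => ?_)
    (fun n => (hsimple _).2)
  · exact (SimpleFunc.norm_approxOn_zero_le hm _ x n).trans (add_le_add (hC x) (hC x))
  · exact SimpleFunc.tendsto_approxOn hm _ (by simp)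

end BoundedMeasurable

/-! ### Operators given by families of scalar measures -/

section Represents

variable {V : Type*} [NormedAddCommGroup V] [InnerProductSpace ℂ V] {X : Type*} [MeasurableSpace X]
  {μ : V → Measure X}

/-- The bounded operator `B` is the integral of `f` against the operator measure whose scalar
measures are `μ v`. -/
def Represents (μ : V → Measure X) (f : X → ℂ) (B : V →L[ℂ] V) : Prop :=
  ∀ v, inner ℂ v (B v) = ∫ x, f x ∂(μ v)

theorem Represents.unique {f : X → ℂ} {B B' : V →L[ℂ] V} (h : Represents μ f B)
    (h' : Represents μ f B') : B = B' :=
  ext_of_inner_self fun v => (h v).trans (h' v).symm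

theorem Represents.adjoint [CompleteSpace V] {f : X → ℂ} {B : V →L[ℂ] V} (h : Represents μ f B) :
    Represents μ (fun x => (starRingEnd ℂ) (f x)) (ContinuousLinearMap.adjoint B) := by
  intro v
  rw [ContinuousLinearMap.adjoint_inner_right, ← inner_conj_symm, h v, integral_conj]

theorem Represents.const_smul {f : X → ℂ} {B : V →L[ℂ] V} (h : Represents μ f B) (c : ℂ) :
    Represents μ (c • f) (c • B) := by
  intro v
  simp only [smul_apply, inner_smul_right, h v, Pi.smul_apply]
  rw [integral_smul, smul_eq_mul]

theorem isFiniteMeasure_of_univ {V : Type*} [NormedAddCommGroup V] {μ : V → Measure X}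
    (hμ : ∀ v, μ v Set.univ = ENNReal.ofReal (‖v‖ ^ 2)) (v : V) : IsFiniteMeasure (μ v) :=
  ⟨by rw [hμ]; exact ENNReal.ofReal_lt_top⟩

theorem measureReal_univ_of_univ {V : Type*} [NormedAddCommGroup V] {μ : V → Measure X}
    (hμ : ∀ v, μ v Set.univ = ENNReal.ofReal (‖v‖ ^ 2)) (v : V) : (μ v).real Set.univ = ‖v‖ ^ 2 := by
  rw [Measure.real, hμ, ENNReal.toReal_ofReal (by positivity)]

theorem Represents.add (hμ : ∀ v, μ v Set.univ = ENNReal.ofReal (‖v‖ ^ 2))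
    {f g : X → ℂ} {B B' : V →L[ℂ] V} (hf : BddMeas f) (hg : BddMeas g)
    (h : Represents μ f B) (h' : Represents μ g B') : Represents μ (f + g) (B + B') := by
  intro v
  have := isFiniteMeasure_of_univ hμ v
  simp only [add_apply, inner_add_right, h v, h' v, Pi.add_apply]
  rw [integral_add (hf.integrable _) (hg.integrable _)]

theorem tendsto_integral_of_bdd {V : Type*} [NormedAddCommGroup V] {μ : V → Measure X}
    (hμ : ∀ v, μ v Set.univ = ENNReal.ofReal (‖v‖ ^ 2))
    {F : ℕ → X → ℂ} {f : X → ℂ} {C : ℝ} (hF : ∀ n, Measurable (F n))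
    (hC : ∀ n x, ‖F n x‖ ≤ C) (hlim : ∀ x, Tendsto (fun n => F n x) atTop (𝓝 (f x))) (v : V) :
    Tendsto (fun n => ∫ x, F n x ∂(μ v)) atTop (𝓝 (∫ x, f x ∂(μ v))) := by
  have := isFiniteMeasure_of_univ hμ v
  exact tendsto_integral_of_dominated_convergence (fun _ => C)
    (fun n => (hF n).aestronglyMeasurable) (integrable_const _)
    (fun n => Eventually.of_forall (hC n)) (Eventually.of_forall hlim)

/-- Each `μ v` has mass `‖v‖²`, so dominated convergence applies to every quadratic form and the
limiting form is bounded by `|C| ‖v‖²`. The absolute value covers an empty `X`, where `C` may be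
negative. -/
theorem exists_represents_of_tendsto [CompleteSpace V]
    (hμ : ∀ v, μ v Set.univ = ENNReal.ofReal (‖v‖ ^ 2))
    {F : ℕ → X → ℂ} {f : X → ℂ} {C : ℝ}
    (hF : ∀ n, Measurable (F n)) (hC : ∀ n x, ‖F n x‖ ≤ C)
    (hlim : ∀ x, Tendsto (fun n => F n x) atTop (𝓝 (f x)))
    (h : ∀ n, ∃ B, Represents μ (F n) B) : ∃ B, Represents μ f B := by
  choose B hB using h
  refine exists_clm_of_tendsto (B := B) (q := fun v => ∫ x, f x ∂(μ v)) (C := |C|) (fun v => ?_)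
    (fun v => ?_) (abs_nonneg _)
  · simp only [hB _ v]
    exact tendsto_integral_of_bdd hμ hF hC hlim v
  · have := isFiniteMeasure_of_univ hμ v
    refine (norm_integral_le_of_norm_le_const (C := |C|) (Eventually.of_forall fun x => ?_)).trans ?_
    · exact le_of_tendsto (hlim x).norm (Eventually.of_forall fun n => (hC n x).trans (le_abs_self C))
    · rw [measureReal_univ_of_univ hμ]

theorem tendsto_inner_of_represents
    (hμ : ∀ v, μ v Set.univ = ENNReal.ofReal (‖v‖ ^ 2))
    {F : ℕ → X → ℂ} {f : X → ℂ} {C : ℝ}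
    (hF : ∀ n, Measurable (F n)) (hC : ∀ n x, ‖F n x‖ ≤ C)
    (hlim : ∀ x, Tendsto (fun n => F n x) atTop (𝓝 (f x)))
    {B : ℕ → V →L[ℂ] V} {B' : V →L[ℂ] V}
    (h : ∀ n, Represents μ (F n) (B n)) (h' : Represents μ f B') (u v : V) :
    Tendsto (fun n => inner ℂ u (B n v)) atTop (𝓝 (inner ℂ u (B' v))) := by
  refine tendsto_inner_of_tendsto_inner_self (fun w => ?_) u v
  simp only [h _ w, h' w]
  exact tendsto_integral_of_bdd hμ hF hC hlim w

end Represents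

/-! ### Bounded Borel functional calculus of a projection-valued measure -/

namespace PVM

variable {V : Type*} [NormedAddCommGroup V] [InnerProductSpace ℂ V] [CompleteSpace V] (E : PVM V)

theorem scalarMeasure_apply (v : V) {S : Set ℝ} (hS : MeasurableSet S) :
    E.scalarMeasure v S = ENNReal.ofReal (‖E.proj S v‖ ^ 2) :=
  Measure.ofMeasurable_apply S hS

theorem scalarMeasure_univ (v : V) : E.scalarMeasure v Set.univ = ENNReal.ofReal (‖v‖ ^ 2) := by
  rw [E.scalarMeasure_apply v MeasurableSet.univ, E.proj_univ, one_apply_eq_self]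

instance (v : V) : IsFiniteMeasure (E.scalarMeasure v) :=
  isFiniteMeasure_of_univ E.scalarMeasure_univ v

theorem inner_proj {S : Set ℝ} (hS : MeasurableSet S) (v : V) :
    inner ℂ v (E.proj S v) = ((‖E.proj S v‖ ^ 2 : ℝ) : ℂ) := by
  refine Complex.ext ?_ ?_
  · rw [E.inner_proj_eq hS, Complex.ofReal_re]
  · rw [Complex.ofReal_im]
    have h := ContinuousLinearMap.isSelfAdjoint_iff'.mp (E.isStarProjection S hS).isSelfAdjoint
    refine Complex.conj_eq_iff_im.1 ?_
    rw [inner_conj_symm]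
    conv_rhs => rw [← h, ContinuousLinearMap.adjoint_inner_right]

theorem represents_proj {S : Set ℝ} (hS : MeasurableSet S) :
    Represents E.scalarMeasure (S.indicator fun _ => 1) (E.proj S) := by
  intro v
  rw [E.inner_proj hS, integral_indicator hS, setIntegral_const, Measure.real,
    E.scalarMeasure_apply v hS, ENNReal.toReal_ofReal (by positivity)]
  simp

theorem exists_represents {f : ℝ → ℂ} (hf : BddMeas f) : ∃ B, Represents E.scalarMeasure f B := by
  refine hf.induction (P := fun f => ∃ B, Represents E.scalarMeasure f B)
    (fun S hS => ⟨_, E.represents_proj hS⟩) ?_ ?_ ?_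
  · rintro f g hf hg ⟨B, hB⟩ ⟨B', hB'⟩
    exact ⟨_, hB.add E.scalarMeasure_univ hf hg hB'⟩
  · rintro c f hf ⟨B, hB⟩
    exact ⟨_, hB.const_smul c⟩
  · intro C F f hF hC _ hlim h
    exact exists_represents_of_tendsto E.scalarMeasure_univ hF hC hlim h

/-- Existence, proved by induction on bounded measurable functions, is what gives content to the
choice behind `integral`. -/
theorem represents_integral {f : ℝ → ℂ} (hf : BddMeas f) :
    Represents E.scalarMeasure f (E.integral f) :=
  Classical.epsilon_spec (E.exists_represents hf)

theorem integral_indicator {S : Set ℝ} (hS : MeasurableSet S) :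
    E.integral (S.indicator fun _ => 1) = E.proj S :=
  (E.represents_integral (bddMeas_indicator hS)).unique (E.represents_proj hS)

theorem integral_add {f g : ℝ → ℂ} (hf : BddMeas f) (hg : BddMeas g) :
    E.integral (f + g) = E.integral f + E.integral g :=
  (E.represents_integral (hf.add hg)).unique
    ((E.represents_integral hf).add E.scalarMeasure_univ hf hg (E.represents_integral hg))

theorem integral_smul {f : ℝ → ℂ} (hf : BddMeas f) (c : ℂ) :
    E.integral (c • f) = c • E.integral f :=
  (E.represents_integral (hf.const_smul c)).unique ((E.represents_integral hf).const_smul c)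

theorem integral_conj {f : ℝ → ℂ} (hf : BddMeas f) :
    E.integral (fun x => (starRingEnd ℂ) (f x)) = ContinuousLinearMap.adjoint (E.integral f) :=
  (E.represents_integral hf.conj).unique (E.represents_integral hf).adjoint

/-- For fixed `g`, multiplicativity is linear in `f` and stable under bounded pointwise limits, so
indicators suffice. -/
theorem represents_mul_of_indicator {g : ℝ → ℂ} (hg : BddMeas g)
    (h : ∀ S, MeasurableSet S →
      Represents E.scalarMeasure ((S.indicator fun _ => 1) * g) (E.proj S * E.integral g))
    {f : ℝ → ℂ} (hf : BddMeas f) :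
    Represents E.scalarMeasure (f * g) (E.integral f * E.integral g) := by
  refine hf.induction
    (P := fun f => Represents E.scalarMeasure (f * g) (E.integral f * E.integral g))
    (fun S hS => ?_) ?_ ?_ ?_
  · rw [E.integral_indicator hS]; exact h S hS
  · intro f f' hf hf' h1 h2
    rw [E.integral_add hf hf', add_mul, add_mul]
    exact h1.add E.scalarMeasure_univ (hf.mul hg) (hf'.mul hg) h2
  · intro c f hf h1
    rw [E.integral_smul hf, smul_mul_assoc, smul_mul_assoc]
    exact h1.const_smul c
  · intro C F f hF hC hf hlim h1 v
    obtain ⟨hgm, D, hD⟩ := hg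
    have h2 := tendsto_inner_of_represents E.scalarMeasure_univ hF hC hlim
      (fun n => E.represents_integral ⟨hF n, C, hC n⟩) (E.represents_integral hf) v (E.integral g v)
    refine tendsto_nhds_unique h2 ?_
    have h3 : ∀ n, inner ℂ v (E.integral (F n) (E.integral g v))
        = ∫ x, (F n * g) x ∂(E.scalarMeasure v) := fun n => h1 n v
    simp only [h3]
    refine tendsto_integral_of_bdd E.scalarMeasure_univ (C := C * D) (fun n => (hF n).mul hgm)
      (fun n x => ?_) (fun x => (hlim x).mul_const _) v
    exact (norm_mul_le _ _).trans
      (mul_le_mul (hC n x) (hD x) (norm_nonneg _) ((norm_nonneg _).trans (hC n x)))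

theorem integral_mul {f g : ℝ → ℂ} (hf : BddMeas f) (hg : BddMeas g) :
    E.integral (f * g) = E.integral f * E.integral g := by
  have hST : ∀ S T, MeasurableSet S → MeasurableSet T →
      Represents E.scalarMeasure ((S.indicator fun _ => 1) * (T.indicator fun _ => 1))
        (E.proj S * E.proj T) := by
    intro S T hS hT
    rw [← E.proj_inter S T hS hT]
    convert E.represents_proj (hS.inter hT) using 1
    ext x
    by_cases h1 : x ∈ S <;> by_cases h2 : x ∈ T <;> simp [h1, h2]
  have hT : ∀ T, MeasurableSet T → ∀ f, BddMeas f →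
      Represents E.scalarMeasure (f * (T.indicator fun _ => 1)) (E.integral f * E.proj T) := by
    intro T hT f hf
    have h1 := E.represents_mul_of_indicator (bddMeas_indicator hT) (fun S hS => by
      rw [E.integral_indicator hT]; exact hST S T hS hT) hf
    rwa [E.integral_indicator hT] at h1
  -- The induction acts on the left factor only. Taking adjoints of the case `ḡ · 1_S` puts the
  -- indicator on the left, and the induction can be used a second time.
  have hS : ∀ S, MeasurableSet S →
      Represents E.scalarMeasure ((S.indicator fun _ => 1) * g) (E.proj S * E.integral g) := by
    intro S hS
    have h1 := (hT S hS _ hg.conj).adjoint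
    rw [E.integral_conj hg, ← ContinuousLinearMap.star_eq_adjoint, star_mul,
      ContinuousLinearMap.star_eq_adjoint (ContinuousLinearMap.adjoint _),
      ContinuousLinearMap.adjoint_adjoint, (E.isStarProjection S hS).isSelfAdjoint.star_eq] at h1
    convert h1 using 1
    ext x
    by_cases hx : x ∈ S <;> simp [hx]
  exact (E.represents_integral (hf.mul hg)).unique (E.represents_mul_of_indicator hg hS hf)

theorem inner_integral_integral {f g : ℝ → ℂ} (hf : BddMeas f) (hg : BddMeas g) (v : V) :
    inner ℂ (E.integral f v) (E.integral g v)
      = ∫ x, (starRingEnd ℂ) (f x) * g x ∂(E.scalarMeasure v) := by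
  rw [← ContinuousLinearMap.adjoint_inner_right, ← E.integral_conj hf]
  have h := E.represents_integral (hf.conj.mul hg) v
  rw [E.integral_mul hf.conj hg] at h
  exact h

theorem norm_integral_sq {f : ℝ → ℂ} (hf : BddMeas f) (v : V) :
    ‖E.integral f v‖ ^ 2 = ∫ x, ‖f x‖ ^ 2 ∂(E.scalarMeasure v) := by
  have h := E.inner_integral_integral hf hf v
  rw [inner_self_eq_norm_sq_to_K] at h
  simp only [Complex.conj_mul'] at h
  have h2 : ∫ x, ((‖f x‖ : ℂ)) ^ 2 ∂(E.scalarMeasure v)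
      = ((∫ x, ‖f x‖ ^ 2 ∂(E.scalarMeasure v) : ℝ) : ℂ) := by
    rw [← integral_complex_ofReal]
    simp
  rw [h2] at h
  exact Complex.ofReal_injective (by rw [Complex.ofReal_pow]; exact h)

theorem ofReal_norm_integral_sq {f : ℝ → ℂ} (hf : BddMeas f) (v : V) :
    ENNReal.ofReal (‖E.integral f v‖ ^ 2) = ∫⁻ x, ‖f x‖ₑ ^ 2 ∂(E.scalarMeasure v) := by
  rw [E.norm_integral_sq hf, ofReal_integral_eq_lintegral_ofReal]
  · simp [ENNReal.ofReal_pow]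
  · have := (hf.mul hf.conj).integrable (E.scalarMeasure v)
    refine this.norm.congr (Eventually.of_forall fun x => ?_)
    simp [pow_two]
  · exact Eventually.of_forall fun x => by positivity

/-- By multiplicativity `E(S) ∫ f dE = ∫ 1_S f dE`, whose norm on `v` is known. -/
theorem scalarMeasure_integral {f : ℝ → ℂ} (hf : BddMeas f) (v : V) :
    E.scalarMeasure (E.integral f v) = (E.scalarMeasure v).withDensity fun x => ‖f x‖ₑ ^ 2 := by
  refine Measure.ext fun S hS => ?_
  have h1 : E.proj S (E.integral f v) = E.integral ((S.indicator fun _ => 1) * f) v := by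
    rw [E.integral_mul (bddMeas_indicator hS) hf, E.integral_indicator hS]
    rfl
  rw [E.scalarMeasure_apply _ hS, withDensity_apply _ hS, h1,
    E.ofReal_norm_integral_sq ((bddMeas_indicator hS).mul hf), ← lintegral_indicator hS]
  refine lintegral_congr fun x => ?_
  by_cases hx : x ∈ S <;> simp [hx]

theorem integral_scalarMeasure_integral {f : ℝ → ℂ} (hf : BddMeas f) (v : V) (g : ℝ → ℂ) :
    ∫ x, g x ∂(E.scalarMeasure (E.integral f v))
      = ∫ x, ((‖f x‖ ^ 2 : ℝ) : ℂ) * g x ∂(E.scalarMeasure v) := by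
  rw [E.scalarMeasure_integral hf]
  have h1 : (fun x => ‖f x‖ₑ ^ 2) = fun x => ((‖f x‖₊ ^ 2 : NNReal) : ℝ≥0∞) := by
    ext x; simp [enorm_eq_nnnorm]
  rw [h1, integral_withDensity_eq_integral_smul (by exact hf.1.nnnorm.pow_const 2)]
  refine integral_congr_ae (Eventually.of_forall fun x => ?_)
  simp [NNReal.smul_def]

end PVM

end KatoSmooth

/-! ### Riesz measures of a representation of `C(X)` -/

namespace KatoSmooth

open Filter Topology

variable {V : Type*} [NormedAddCommGroup V] [InnerProductSpace ℂ V] [CompleteSpace V]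

section Riesz

variable {X : Type*} [TopologicalSpace X]

/-- A real continuous function as a complex one. -/
def complexify (g : C(X, ℝ)) : C(X, ℂ) := ⟨fun x => (g x : ℂ), by fun_prop⟩

/-- With `r = √g` one has `g = r* r`, so the form is `‖Φ(r) v‖²`. -/
theorem inner_complexify_nonneg (Φ : C(X, ℂ) →⋆ₐ[ℂ] (V →L[ℂ] V)) (v : V) {g : C(X, ℝ)}
    (hg : ∀ x, 0 ≤ g x) : 0 ≤ (inner ℂ v (Φ (complexify g) v)).re := by
  let r : C(X, ℝ) := ⟨fun x => √(g x), by fun_prop⟩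
  have h1 : complexify g = star (complexify r) * complexify r := by
    ext x
    simp only [complexify, r, ContinuousMap.mul_apply, ContinuousMap.star_apply,
      ContinuousMap.coe_mk, RCLike.star_def, Complex.conj_ofReal]
    rw [← Complex.ofReal_mul, Real.mul_self_sqrt (hg x)]
  rw [h1, map_mul, map_star]
  change 0 ≤ (inner ℂ v ((star (Φ (complexify r))) (Φ (complexify r) v))).re
  rw [ContinuousLinearMap.star_eq_adjoint, ContinuousLinearMap.adjoint_inner_right,
    ← RCLike.re_eq_complex_re]
  exact inner_self_nonneg

theorem inner_complexify_im (Φ : C(X, ℂ) →⋆ₐ[ℂ] (V →L[ℂ] V)) (v : V) (g : C(X, ℝ)) :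
    (inner ℂ v (Φ (complexify g) v)).im = 0 := by
  have h1 : star (complexify g) = complexify g := by
    ext x
    simp [complexify]
  refine Complex.conj_eq_iff_im.1 ?_
  rw [inner_conj_symm]
  conv_rhs => rw [← h1, map_star, ContinuousLinearMap.star_eq_adjoint,
    ContinuousLinearMap.adjoint_inner_right]

/-- Positivity on real functions feeds the Riesz-Markov-Kakutani theorem; complex functions are
split into real and imaginary parts. -/
theorem exists_measure_of_starAlgHom [CompactSpace X] [T2Space X] [MeasurableSpace X] [BorelSpace X]
    (Φ : C(X, ℂ) →⋆ₐ[ℂ] (V →L[ℂ] V)) (v : V) :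
    ∃ μ : Measure X, IsFiniteMeasure μ ∧ ∀ f : C(X, ℂ), inner ℂ v (Φ f v) = ∫ x, f x ∂μ := by
  let Λ₀ : CompactlySupportedContinuousMap X ℝ →ₗ[ℝ] ℝ :=
    { toFun := fun f => (inner ℂ v (Φ (complexify f.toContinuousMap) v)).re
      map_add' := by
        intro f g
        have h1 : complexify (f + g).toContinuousMap
            = complexify f.toContinuousMap + complexify g.toContinuousMap := by
          ext x; simp [complexify]
        rw [h1, map_add, add_apply, inner_add_right, Complex.add_re]
      map_smul' := by
        intro c f
        have h1 : complexify (c • f).toContinuousMap = (c : ℂ) • complexify f.toContinuousMap := by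
          ext x; simp [complexify]
        rw [h1, map_smul, smul_apply, inner_smul_right]
        simp }
  let Λ : CompactlySupportedContinuousMap X ℝ →ₚ[ℝ] ℝ := PositiveLinearMap.mk₀ Λ₀ fun f hf =>
    inner_complexify_nonneg Φ v fun x => hf x
  refine ⟨RealRMK.rieszMeasure Λ, inferInstance, fun f => ?_⟩
  have hreal : ∀ g : C(X, ℝ), inner ℂ v (Φ (complexify g) v)
      = ((∫ x, g x ∂(RealRMK.rieszMeasure Λ) : ℝ) : ℂ) := by
    intro g
    let g' : CompactlySupportedContinuousMap X ℝ := ⟨g, HasCompactSupport.of_compactSpace g⟩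
    have h1 : ∫ x, g x ∂(RealRMK.rieszMeasure Λ) = (inner ℂ v (Φ (complexify g) v)).re :=
      RealRMK.integral_rieszMeasure Λ g'
    rw [h1]
    refine Complex.ext (by simp) ?_
    rw [inner_complexify_im, Complex.ofReal_im]
  let fr : C(X, ℝ) := ⟨fun x => (f x).re, by fun_prop⟩
  let fi : C(X, ℝ) := ⟨fun x => (f x).im, by fun_prop⟩
  have h2 : f = complexify fr + Complex.I • complexify fi := by
    ext x
    simp only [complexify, fr, fi, ContinuousMap.add_apply, ContinuousMap.smul_apply,
      ContinuousMap.coe_mk, smul_eq_mul]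
    rw [mul_comm, Complex.re_add_im]
  have hfi : Integrable f (RealRMK.rieszMeasure Λ) :=
    f.continuous.integrable_of_hasCompactSupport (HasCompactSupport.of_compactSpace _)
  rw [← integral_re_add_im hfi]
  conv_lhs => rw [h2, map_add, map_smul, add_apply, smul_apply, inner_add_right, inner_smul_right,
    hreal, hreal]
  rw [mul_comm]
  rfl

end Riesz

/-! ### From scalar measures to a projection-valued measure -/

section SpectralSets

variable {X : Type*} [MeasurableSpace X] {μ : V → Measure X}

theorem integral_indicator_one {μ : Measure X} {S : Set X} (hS : MeasurableSet S) :
    ∫ x, S.indicator (fun _ => (1 : ℂ)) x ∂μ = (μ.real S : ℂ) := by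
  rw [integral_indicator hS, setIntegral_const]
  simp

theorem hasSum_measureReal_iUnion {μ : Measure X} [IsFiniteMeasure μ] {S : ℕ → Set X}
    (hS : ∀ n, MeasurableSet (S n)) (hd : Pairwise (Function.onFun Disjoint S)) :
    HasSum (fun n => μ.real (S n)) (μ.real (⋃ n, S n)) := by
  have h3 := measure_iUnion (μ := μ) hd hS
  have h4 : ∑' n, μ (S n) ≠ ⊤ := by rw [← h3]; exact measure_ne_top _ _
  have h5 := ENNReal.hasSum_toReal h4
  rwa [← ENNReal.tsum_toReal_eq (fun n => measure_ne_top _ _), ← h3] at h5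

theorem represents_compl {V : Type*} [NormedAddCommGroup V] [InnerProductSpace ℂ V]
    {μ : V → Measure X} (hμ : ∀ v, μ v Set.univ = ENNReal.ofReal (‖v‖ ^ 2)) {S : Set X} (hS : MeasurableSet S) {P : V →L[ℂ] V}
    (hP : Represents μ (S.indicator fun _ => 1) P) :
    Represents μ (Sᶜ.indicator fun _ => 1) (1 - P) := by
  intro v
  have := isFiniteMeasure_of_univ hμ v
  rw [sub_apply, inner_sub_right, hP v, integral_indicator_one hS, integral_indicator_one hS.compl,
    measureReal_compl hS, measureReal_univ_of_univ hμ, one_apply_eq_self,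
    inner_self_eq_norm_sq_to_K]
  push_cast
  rfl

theorem hasSum_inner_of_represents {V : Type*} [NormedAddCommGroup V] [InnerProductSpace ℂ V]
    {μ : V → Measure X} (hμ : ∀ v, μ v Set.univ = ENNReal.ofReal (‖v‖ ^ 2)) {S : ℕ → Set X} (hS : ∀ n, MeasurableSet (S n))
    (hd : Pairwise (Function.onFun Disjoint S)) {P : ℕ → V →L[ℂ] V} {P' : V →L[ℂ] V}
    (hP : ∀ n, Represents μ ((S n).indicator fun _ => 1) (P n))
    (hP' : Represents μ ((⋃ n, S n).indicator fun _ => 1) P') (u v : V) :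
    HasSum (fun n => inner ℂ u (P n v)) (inner ℂ u (P' v)) := by
  have h1 := tendsto_inner_of_tendsto_inner_self (l := (atTop : Filter (Finset ℕ)))
    (B := fun s => ∑ n ∈ s, P n) (B' := P') (fun w => ?_) u v
  · simp only [sum_apply, inner_sum] at h1
    exact h1
  · have := isFiniteMeasure_of_univ hμ w
    have h6 := Complex.hasSum_ofReal.2 (hasSum_measureReal_iUnion (μ := μ w) hS hd)
    simp only [sum_apply, inner_sum, hP _ w, hP' w, integral_indicator_one (hS _),
      integral_indicator_one (MeasurableSet.iUnion hS)]
    exact h6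

/-- For fixed `T`, the sets `S` with the property form a Dynkin system, and the closed sets are a
π-system generating the Borel sets. -/
theorem represents_mul_inter [TopologicalSpace X] [BorelSpace X] {V : Type*}
    [NormedAddCommGroup V] [InnerProductSpace ℂ V] {μ : V → Measure X}
    (hμ : ∀ v, μ v Set.univ = ENNReal.ofReal (‖v‖ ^ 2)) {P : Set X → V →L[ℂ] V}
    (hP : ∀ S, MeasurableSet S → Represents μ (S.indicator fun _ => 1) (P S)) {T : Set X}
    (hT : MeasurableSet T)
    (h : ∀ S, IsClosed S → Represents μ ((S ∩ T).indicator fun _ => 1) (P S * P T))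
    {S : Set X} (hS : MeasurableSet S) :
    Represents μ ((S ∩ T).indicator fun _ => 1) (P S * P T) := by
  have hgen : ‹MeasurableSpace X› = MeasurableSpace.generateFrom {S : Set X | IsClosed S} :=
    BorelSpace.measurable_eq.trans borel_eq_generateFrom_isClosed
  induction S, hS using MeasurableSpace.induction_on_inter hgen isPiSystem_isClosed with
  | empty => exact h ∅ isClosed_empty
  | basic S hS => exact h S hS
  | compl S hS ih =>
    have h1 : P Sᶜ = 1 - P S := (hP _ hS.compl).unique (represents_compl hμ hS (hP S hS))
    rw [h1, sub_mul, one_mul]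
    intro v
    have := isFiniteMeasure_of_univ hμ v
    rw [sub_apply, inner_sub_right, hP T hT v, ih v, integral_indicator_one hT,
      integral_indicator_one (hS.inter hT), integral_indicator_one (hS.compl.inter hT),
      ← Complex.ofReal_sub, ← measureReal_inter_add_sdiff (s := T) (μ := μ v) hS, Set.inter_comm T S,
      add_sub_cancel_left, Set.sdiff_eq, Set.inter_comm T]
  | iUnion S hd hS ih =>
    intro v
    have := isFiniteMeasure_of_univ hμ v
    have h1 := hasSum_inner_of_represents hμ hS hd (fun n => hP _ (hS n))
      (hP _ (MeasurableSet.iUnion hS)) v (P T v)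
    have h2 : ∀ n, inner ℂ v (P (S n) (P T v)) = ((μ v).real (S n ∩ T) : ℂ) := fun n => by
      rw [← integral_indicator_one ((hS n).inter hT)]
      exact ih n v
    simp only [h2] at h1
    refine h1.unique ?_
    rw [integral_indicator_one ((MeasurableSet.iUnion hS).inter hT), Set.iUnion_inter]
    exact Complex.hasSum_ofReal.2 (hasSum_measureReal_iUnion (fun n => (hS n).inter hT)
      fun i j hij => (hd hij).mono Set.inter_subset_left Set.inter_subset_left)

theorem exists_represents_indicator [TopologicalSpace X] [BorelSpace X]
    (hμ : ∀ v, μ v Set.univ = ENNReal.ofReal (‖v‖ ^ 2))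
    (h : ∀ S, IsClosed S → ∃ P, Represents μ (S.indicator fun _ => 1) P) {S : Set X}
    (hS : MeasurableSet S) : ∃ P, Represents μ (S.indicator fun _ => 1) P := by
  have hgen : ‹MeasurableSpace X› = MeasurableSpace.generateFrom {S : Set X | IsClosed S} :=
    BorelSpace.measurable_eq.trans borel_eq_generateFrom_isClosed
  induction S, hS using MeasurableSpace.induction_on_inter hgen isPiSystem_isClosed with
  | empty => exact h ∅ isClosed_empty
  | basic S hS => exact h S hS
  | compl S hS ih =>
    obtain ⟨P, hP⟩ := ih
    exact ⟨_, represents_compl hμ hS hP⟩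
  | iUnion S hd hS ih =>
    choose P hP using ih
    -- The indicator of a countable union is the bounded pointwise limit of the indicators of its
    -- finite subunions.
    refine exists_represents_of_tendsto hμ (C := 1)
      (F := fun n => (⋃ i ∈ Finset.range n, S i).indicator fun _ => 1) (fun n => ?_) (fun n x => ?_)
      (fun x => ?_) (fun n => ⟨∑ i ∈ Finset.range n, P i, fun v => ?_⟩)
    · exact measurable_const.indicator (Finset.measurableSet_biUnion _ fun i _ => hS i)
    · exact (norm_indicator_le_norm_self _ _).trans (by simp)
    · by_cases hx : x ∈ ⋃ i, S i
      · obtain ⟨i, hi⟩ := Set.mem_iUnion.1 hx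
        refine tendsto_const_nhds.congr' ?_
        filter_upwards [eventually_gt_atTop i] with n hn
        rw [Set.indicator_of_mem hx, Set.indicator_of_mem]
        exact Set.mem_biUnion (Finset.mem_coe.2 (Finset.mem_range.2 hn)) hi
      · refine tendsto_const_nhds.congr fun n => ?_
        rw [Set.indicator_of_notMem hx, Set.indicator_of_notMem]
        intro h'
        obtain ⟨i, _, hi⟩ := Set.mem_iUnion₂.1 h'
        exact hx (Set.mem_iUnion.2 ⟨i, hi⟩)
    · have := isFiniteMeasure_of_univ hμ v
      rw [integral_indicator_one (Finset.measurableSet_biUnion _ fun i _ => hS i),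
        measureReal_biUnion_finset (fun i _ j _ hij => hd hij) (fun i _ => hS i)]
      simp only [sum_apply, inner_sum, hP _ v, integral_indicator_one (hS _)]
      push_cast
      rfl

/-- Operators `P S` whose quadratic forms are measures, and which are multiplicative on closed sets,
form a projection-valued measure; here it is transported to the line by a measurable map. -/
theorem exists_pvm_map [TopologicalSpace X] [BorelSpace X] {P : Set X → V →L[ℂ] V}
    (hμ : ∀ v, μ v Set.univ = ENNReal.ofReal (‖v‖ ^ 2))
    (hP : ∀ S, MeasurableSet S → Represents μ (S.indicator fun _ => 1) (P S))
    (h : ∀ S T, IsClosed S → IsClosed T →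
      Represents μ ((S ∩ T).indicator fun _ => 1) (P S * P T))
    {τ : X → ℝ} (hτ : Measurable τ) :
    ∃ E : PVM V, ∀ v, E.scalarMeasure v = (μ v).map τ := by
  have hsa : ∀ S, MeasurableSet S → IsSelfAdjoint (P S) := by
    intro S hS
    have h1 := (hP S hS).adjoint
    have h2 : (fun x => (starRingEnd ℂ) (S.indicator (fun _ => (1 : ℂ)) x))
        = S.indicator fun _ => 1 := by
      ext x
      by_cases hx : x ∈ S <;> simp [hx]
    rw [h2] at h1
    exact h1.unique (hP S hS)
  have hswap : ∀ S T, MeasurableSet S → MeasurableSet T →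
      Represents μ ((S ∩ T).indicator fun _ => 1) (P S * P T) →
      Represents μ ((T ∩ S).indicator fun _ => 1) (P T * P S) := by
    intro S T hS hT h1
    have h2 := h1.adjoint
    rw [← ContinuousLinearMap.star_eq_adjoint, star_mul, (hsa S hS).star_eq, (hsa T hT).star_eq] at h2
    convert h2 using 1
    ext x
    by_cases hx : x ∈ S <;> by_cases hx' : x ∈ T <;> simp [hx, hx']
  -- Multiplicativity is extended in one variable, exchanged by adjoints, then extended in the
  -- other.
  have hclosed : ∀ S T, IsClosed S → MeasurableSet T →
      Represents μ ((S ∩ T).indicator fun _ => 1) (P S * P T) := fun S T hS hT =>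
    hswap T S hT hS.measurableSet (represents_mul_inter hμ hP hS.measurableSet
      (fun S' hS' => h S' S hS' hS) hT)
  have hmul : ∀ S T, MeasurableSet S → MeasurableSet T → P (S ∩ T) = P S * P T := fun S T hS hT =>
    (hP _ (hS.inter hT)).unique
      (represents_mul_inter hμ hP hT (fun S' hS' => hclosed S' T hS' hT) hS)
  have hnorm : ∀ S, MeasurableSet S → ∀ v, ‖P S v‖ ^ 2 = (μ v).real S := by
    intro S hS v
    have h1 : inner ℂ (P S v) (P S v) = ((μ v).real S : ℂ) := by
      rw [← integral_indicator_one hS, ← hP S hS v]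
      conv_rhs => rw [← Set.inter_self S, hmul S S hS hS]
      rw [← ContinuousLinearMap.adjoint_inner_right, ← ContinuousLinearMap.star_eq_adjoint,
        (hsa S hS).star_eq]
      rfl
    rw [inner_self_eq_norm_sq_to_K] at h1
    exact Complex.ofReal_injective (by rw [Complex.ofReal_pow]; exact h1)
  have hunion : ∀ S : ℕ → Set X, (∀ n, MeasurableSet (S n)) → Pairwise (Function.onFun Disjoint S) →
      ∀ v, HasSum (fun n => P (S n) v) (P (⋃ n, S n) v) := by
    intro S hS hd v
    have := isFiniteMeasure_of_univ hμ v
    have hU := MeasurableSet.iUnion hS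
    -- Strong convergence: the remainder is the projection of the leftover set, so its squared norm
    -- is the measure of that set.
    have hsub : ∀ s : Finset ℕ, ‖∑ n ∈ s, P (S n) v - P (⋃ n, S n) v‖ ^ 2
        = (μ v).real (⋃ n, S n) - ∑ n ∈ s, (μ v).real (S n) := by
      intro s
      have hs : MeasurableSet (⋃ n ∈ s, S n) := Finset.measurableSet_biUnion _ fun n _ => hS n
      have hss : (⋃ n ∈ s, S n) ⊆ ⋃ n, S n := Set.iUnion₂_subset_iUnion _ _
      have e1 : P (⋃ n, S n) - ∑ n ∈ s, P (S n) = P ((⋃ n, S n) \ ⋃ n ∈ s, S n) := by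
        refine ext_of_inner_self fun w => ?_
        have := isFiniteMeasure_of_univ hμ w
        simp only [sub_apply, sum_apply, inner_sub_right, inner_sum, hP _ (hS _) w, hP _ hU w,
          hP _ (hU.diff hs) w, integral_indicator_one (hS _), integral_indicator_one hU,
          integral_indicator_one (hU.diff hs)]
        rw [measureReal_sdiff hss hs,
          measureReal_biUnion_finset (fun i _ j _ hij => hd hij) (fun i _ => hS i)]
        push_cast
        rfl
      rw [norm_sub_rev]
      have e2 : P (⋃ n, S n) v - ∑ n ∈ s, P (S n) v = P ((⋃ n, S n) \ ⋃ n ∈ s, S n) v := by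
        rw [← e1, sub_apply, sum_apply]
      rw [e2, hnorm _ (hU.diff hs), measureReal_sdiff hss hs,
        measureReal_biUnion_finset (fun i _ j _ hij => hd hij) (fun i _ => hS i)]
    have h1 : Tendsto (fun s : Finset ℕ => ‖∑ n ∈ s, P (S n) v - P (⋃ n, S n) v‖ ^ 2) atTop (𝓝 0) := by
      simp only [hsub]
      have h2 : HasSum (fun n => (μ v).real (S n)) ((μ v).real (⋃ n, S n)) :=
        hasSum_measureReal_iUnion hS hd
      have h3 := (tendsto_const_nhds (x := (μ v).real (⋃ n, S n))).sub h2
      rwa [sub_self] at h3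
    refine tendsto_iff_norm_sub_tendsto_zero.2 ?_
    have h4 := h1.sqrt
    simpa using h4
  let E : PVM V :=
    { proj := fun S => P (τ ⁻¹' S)
      isStarProjection := fun S hS =>
        ⟨by
          have h1 := hmul _ _ (hτ hS) (hτ hS)
          rw [Set.inter_self] at h1
          exact h1.symm, hsa _ (hτ hS)⟩
      proj_univ := by
        refine ext_of_inner_self fun v => ?_
        rw [Set.preimage_univ, hP _ MeasurableSet.univ v, integral_indicator_one MeasurableSet.univ,
          measureReal_univ_of_univ hμ, one_apply_eq_self, inner_self_eq_norm_sq_to_K]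
        push_cast
        rfl
      proj_inter := fun S T hS hT => by
        rw [Set.preimage_inter]
        exact hmul _ _ (hτ hS) (hτ hT)
      hasSum_proj := fun S hS hd v => by
        rw [Set.preimage_iUnion]
        exact hunion _ (fun n => hτ (hS n)) (fun i j hij => (hd hij).preimage τ) v }
  refine ⟨E, fun v => Measure.ext fun S hS => ?_⟩
  have := isFiniteMeasure_of_univ hμ v
  rw [E.scalarMeasure_apply v hS, Measure.map_apply hτ hS]
  change ENNReal.ofReal (‖P (τ ⁻¹' S) v‖ ^ 2) = _
  rw [hnorm _ (hτ hS), Measure.real, ENNReal.ofReal_toReal (measure_ne_top _ _)]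

end SpectralSets

/-- A unital star homomorphism from `C(X)` is integration against a projection-valued measure on
`X`; here it is transported to the line by measurable maps. -/
theorem exists_pvm_of_starAlgHom {X : Type*} [TopologicalSpace X] [CompactSpace X] [T2Space X]
    [HasOuterApproxClosed X] [MeasurableSpace X] [BorelSpace X]
    (Φ : C(X, ℂ) →⋆ₐ[ℂ] (V →L[ℂ] V)) :
    ∃ μ : V → Measure X, (∀ f : C(X, ℂ), Represents μ f (Φ f)) ∧
      ∀ τ : X → ℝ, Measurable τ → ∃ E : PVM V, ∀ v, E.scalarMeasure v = (μ v).map τ := by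
  choose μ hfin hμΦ using exists_measure_of_starAlgHom Φ
  have hμ : ∀ v, μ v Set.univ = ENNReal.ofReal (‖v‖ ^ 2) := by
    intro v
    have h1 := hμΦ v 1
    rw [map_one, one_apply_eq_self, inner_self_eq_norm_sq_to_K] at h1
    simp only [ContinuousMap.one_apply, integral_const] at h1
    have h2 : ‖v‖ ^ 2 = (μ v).real Set.univ := by
      refine Complex.ofReal_injective ?_
      rw [Complex.ofReal_pow]
      simpa using h1
    rw [h2, Measure.real, ENNReal.ofReal_toReal (measure_ne_top _ _)]
  have hrep : ∀ f : C(X, ℂ), Represents μ f (Φ f) := fun f v => hμΦ v f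
  -- Continuous functions with values in `[0, 1]` converging pointwise to the indicator of a closed
  -- set.
  let F : ∀ S : Set X, IsClosed S → ℕ → C(X, ℂ) := fun S hS n =>
    ⟨fun x => ((hS.apprSeq n x : ℝ) : ℂ), by fun_prop⟩
  have hF1 : ∀ S hS n x, ‖F S hS n x‖ ≤ 1 := by
    intro S hS n x
    have := HasOuterApproxClosed.apprSeq_apply_le_one hS n x
    simpa [F] using this
  have hFlim : ∀ S hS x, Tendsto (fun n => F S hS n x) atTop (𝓝 (S.indicator (fun _ => 1) x)) := by
    intro S hS x
    have h1 := tendsto_pi_nhds.1 (HasOuterApproxClosed.tendsto_apprSeq hS) x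
    have h2 := (Complex.continuous_ofReal.comp NNReal.continuous_coe).continuousAt.tendsto.comp h1
    have h3 : S.indicator (fun _ => (1 : ℂ)) x
        = (Complex.ofReal ∘ NNReal.toReal) (S.indicator (fun _ => 1) x) := by
      by_cases hx : x ∈ S <;> simp [hx]
    rw [h3]
    exact h2
  have hFm : ∀ S hS n, Measurable (F S hS n) := fun S hS n => (F S hS n).continuous.measurable
  have hex : ∀ S, MeasurableSet S → ∃ P, Represents μ (S.indicator fun _ => 1) P := fun S hS =>
    exists_represents_indicator hμ (fun S hS => exists_represents_of_tendsto hμ (hFm S hS)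
      (hF1 S hS) (hFlim S hS) fun n => ⟨_, hrep _⟩) hS
  choose! P hP using hex
  have hmul : ∀ S T, IsClosed S → IsClosed T →
      Represents μ ((S ∩ T).indicator fun _ => 1) (P S * P T) := by
    intro S T hS hT v
    -- Two successive limits. The approximation of `T` goes first, with `Φ (F S hS n)` moved to the
    -- left slot so that weak convergence suffices.
    have h1 : ∀ n, inner ℂ v (Φ (F S hS n) (P T v))
        = ∫ x, F S hS n x * T.indicator (fun _ => 1) x ∂(μ v) := by
      intro n
      have a1 := tendsto_inner_of_represents hμ (hFm T hT) (hF1 T hT) (hFlim T hT)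
        (fun m => hrep _) (hP T hT.measurableSet) (ContinuousLinearMap.adjoint (Φ (F S hS n)) v) v
      rw [ContinuousLinearMap.adjoint_inner_left] at a1
      refine tendsto_nhds_unique a1 ?_
      have a2 : ∀ m, inner ℂ (ContinuousLinearMap.adjoint (Φ (F S hS n)) v) (Φ (F T hT m) v)
          = ∫ x, F S hS n x * F T hT m x ∂(μ v) := by
        intro m
        rw [ContinuousLinearMap.adjoint_inner_left]
        have a3 := hrep (F S hS n * F T hT m) v
        rw [map_mul] at a3
        exact a3
      simp only [a2]
      refine tendsto_integral_of_bdd hμ (C := 1 * 1) (fun m => (hFm _ _ _).mul (hFm _ _ _))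
        (fun m x => (norm_mul_le _ _).trans ?_) (fun x => (hFlim T hT x).const_mul _) v
      exact mul_le_mul (hF1 _ _ _ _) (hF1 _ _ _ _) (norm_nonneg _) zero_le_one
    have h2 := tendsto_inner_of_represents hμ (hFm S hS) (hF1 S hS) (hFlim S hS)
      (fun m => hrep _) (hP S hS.measurableSet) v (P T v)
    refine tendsto_nhds_unique h2 ?_
    simp only [h1]
    have h3 : ∀ x, (S ∩ T).indicator (fun _ => (1 : ℂ)) x
        = S.indicator (fun _ => 1) x * T.indicator (fun _ => 1) x := by
      intro x
      by_cases hx : x ∈ S <;> by_cases hx' : x ∈ T <;> simp [hx, hx']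
    simp only [h3]
    refine tendsto_integral_of_bdd hμ (C := 1 * 1)
      (fun m => (hFm _ _ _).mul (measurable_const.indicator hT.measurableSet))
      (fun m x => (norm_mul_le _ _).trans ?_) (fun x => (hFlim S hS x).mul_const _) v
    refine mul_le_mul (hF1 _ _ _ _) ?_ (norm_nonneg _) zero_le_one
    exact (norm_indicator_le_norm_self _ _).trans (by simp)
  exact ⟨μ, hrep, fun τ hτ => exists_pvm_map hμ hP hmul hτ⟩

end KatoSmooth

/-! ### Resolvents of a self-adjoint operator -/

namespace KatoSmooth

open Filter Topology

variable {V : Type*} [NormedAddCommGroup V] [InnerProductSpace ℂ V] [CompleteSpace V]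

section Resolvent

variable {H : V →ₗ.[ℂ] V}

theorem isFormalAdjoint_self (hH : IsSelfAdjoint H) : H.IsFormalAdjoint H := by
  have h1 := LinearPMap.adjoint_isFormalAdjoint hH.dense_domain
  rwa [LinearPMap.isSelfAdjoint_def.1 hH] at h1

theorem im_inner_self_eq_zero (hH : IsSelfAdjoint H) (x : H.domain) :
    (inner ℂ (x : V) (H x)).im = 0 := by
  refine Complex.conj_eq_iff_im.1 ?_
  rw [inner_conj_symm]
  exact isFormalAdjoint_self hH x x

/-- Since `⟨x, H x⟩` is real, the imaginary part of `⟨x, (H - μ)x⟩` is `-Im μ ‖x‖²`; Cauchy-Schwarz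
finishes. -/
theorem abs_im_mul_norm_le (hH : IsSelfAdjoint H) (μ : ℂ) (x : H.domain) :
    |μ.im| * ‖(x : V)‖ ≤ ‖H x - μ • (x : V)‖ := by
  by_cases hx : ‖(x : V)‖ = 0
  · rw [hx, mul_zero]; exact norm_nonneg _
  have hpos : 0 < ‖(x : V)‖ := lt_of_le_of_ne (norm_nonneg _) (Ne.symm hx)
  have h1 : (inner ℂ (x : V) (H x - μ • (x : V))).im = -(μ.im * ‖(x : V)‖ ^ 2) := by
    rw [inner_sub_right, inner_smul_right, Complex.sub_im, im_inner_self_eq_zero hH,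
      inner_self_eq_norm_sq_to_K, zero_sub, neg_inj]
    have : (((‖(x : V)‖ : ℝ) : ℂ) ^ 2) = ((‖(x : V)‖ ^ 2 : ℝ) : ℂ) := by push_cast; rfl
    change (μ * ((‖(x : V)‖ : ℝ) : ℂ) ^ 2).im = _
    rw [this, Complex.im_mul_ofReal]
  have h2 : |μ.im| * ‖(x : V)‖ ^ 2 ≤ ‖(x : V)‖ * ‖H x - μ • (x : V)‖ := by
    calc |μ.im| * ‖(x : V)‖ ^ 2 = |(inner ℂ (x : V) (H x - μ • (x : V))).im| := by
          rw [h1, abs_neg, abs_mul, abs_of_nonneg (by positivity : 0 ≤ ‖(x : V)‖ ^ 2)]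
      _ ≤ ‖inner ℂ (x : V) (H x - μ • (x : V))‖ := Complex.abs_im_le_norm _
      _ ≤ _ := norm_inner_le_norm _ _
  nlinarith

theorem eq_zero_of_apply_eq_smul (hH : IsSelfAdjoint H) {μ : ℂ} (hμ : μ.im ≠ 0) {x : H.domain}
    (h : H x - μ • (x : V) = 0) : (x : V) = 0 := by
  have h1 := abs_im_mul_norm_le hH μ x
  rw [h, norm_zero] at h1
  have h2 : 0 < |μ.im| := abs_pos.2 hμ
  exact norm_le_zero_iff.1 (by nlinarith [norm_nonneg (x : V)])

/-- The range of `H - μ` is closed by the lower bound, and a vector orthogonal to it is an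
eigenvector of `H* = H` for `μ̄`, hence zero. -/
theorem exists_apply_sub_smul_eq (hH : IsSelfAdjoint H) {μ : ℂ} (hμ : μ.im ≠ 0) (v : V) :
    ∃ x : H.domain, H x - μ • (x : V) = v := by
  have him : 0 < |μ.im| := abs_pos.2 hμ
  -- On the complete space `H.graph` the operator `H - μ` becomes bounded, and bounded below.
  let L : H.graph →L[ℂ] V :=
    (ContinuousLinearMap.snd ℂ V V - μ • ContinuousLinearMap.fst ℂ V V).comp H.graph.subtypeL
  have hL : ∀ p : H.graph, L p = p.1.2 - μ • p.1.1 := fun p => rfl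
  have hclosed : IsClosed (L.range : Set V) := by
    have : CompleteSpace H.graph := hH.isClosed.completeSpace_coe
    have hb : ∀ p, ‖p‖ ≤ (((|μ.im|)⁻¹ * (1 + ‖μ‖) + 1).toNNReal : ℝ) * ‖L p‖ := by
      rintro ⟨p, hp⟩
      obtain ⟨x, hx1, hx2⟩ := (H.mem_graph_iff).1 hp
      have h1 := abs_im_mul_norm_le hH μ x
      rw [hx1, hx2] at h1
      have h3 : ‖p.1‖ ≤ (|μ.im|)⁻¹ * ‖L ⟨p, hp⟩‖ := by
        rw [inv_mul_eq_div, le_div_iff₀ him, mul_comm]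
        exact h1
      have h4 : ‖p.2‖ ≤ ‖L ⟨p, hp⟩‖ + ‖μ‖ * ‖p.1‖ := by
        rw [hL, ← norm_smul]
        exact norm_le_norm_sub_add _ _
      rw [Real.coe_toNNReal _ (by positivity)]
      change max ‖p.1‖ ‖p.2‖ ≤ _
      have h5 : 0 ≤ ‖μ‖ * (|μ.im|)⁻¹ * ‖L ⟨p, hp⟩‖ := by positivity
      have h6 : ‖μ‖ * ‖p.1‖ ≤ ‖μ‖ * ((|μ.im|)⁻¹ * ‖L ⟨p, hp⟩‖) := by gcongr
      have h7 : 0 ≤ (|μ.im|)⁻¹ * ‖L ⟨p, hp⟩‖ := by positivity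
      refine max_le ?_ ?_ <;> nlinarith [norm_nonneg (L ⟨p, hp⟩)]
    exact (ContinuousLinearMap.antilipschitz_of_bound L hb).isClosed_range L.uniformContinuous
  have : CompleteSpace L.range := hclosed.completeSpace_coe
  have htop : L.range = ⊤ := by
    rw [← Submodule.orthogonal_eq_bot_iff, Submodule.eq_bot_iff]
    intro y hy
    have h1 : ∀ x : H.domain, inner ℂ ((starRingEnd ℂ) μ • y) (x : V) = inner ℂ y (H x) := by
      intro x
      have h2 := (Submodule.mem_orthogonal' _ _).1 hy (L ⟨_, H.mem_graph x⟩) ⟨_, rfl⟩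
      rw [hL, inner_sub_right, inner_smul_right, sub_eq_zero] at h2
      rw [inner_smul_left, Complex.conj_conj]
      exact h2.symm
    have hy' := LinearPMap.mem_adjoint_domain_of_exists y ⟨_, h1⟩
    have hval := LinearPMap.adjoint_apply_eq hH.dense_domain ⟨y, hy'⟩ h1
    have hadj := LinearPMap.isSelfAdjoint_def.1 hH
    have hgr : (y, (starRingEnd ℂ) μ • y) ∈ H.adjoint.graph := by
      rw [← hval]
      exact H.adjoint.mem_graph ⟨y, hy'⟩
    rw [hadj] at hgr
    obtain ⟨x, hx1, hx2⟩ := (H.mem_graph_iff).1 hgr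
    have hx1' : (x : V) = y := hx1
    have hx2' : H x = (starRingEnd ℂ) μ • y := hx2
    rw [← hx1']
    refine eq_zero_of_apply_eq_smul hH (μ := (starRingEnd ℂ) μ) (by simpa using hμ) ?_
    rw [hx2', hx1', sub_self]
  obtain ⟨⟨p, hp⟩, hp'⟩ : v ∈ L.range := by rw [htop]; trivial
  obtain ⟨x, hx1, hx2⟩ := (H.mem_graph_iff).1 hp
  refine ⟨x, ?_⟩
  rw [hx1, hx2]
  exact hp'

theorem exists_isResolventAt (hH : IsSelfAdjoint H) {μ : ℂ} (hμ : μ.im ≠ 0) :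
    ∃ B, IsResolventAt H μ B := by
  let T : H.domain →ₗ[ℂ] V := H.toFun - μ • H.domain.subtype
  have hT : ∀ x, T x = H x - μ • (x : V) := fun x => rfl
  have hinj : Function.Injective T := by
    rw [← LinearMap.ker_eq_bot, LinearMap.ker_eq_bot']
    intro x hx
    exact Subtype.ext (eq_zero_of_apply_eq_smul hH hμ hx)
  let e := LinearEquiv.ofBijective T ⟨hinj, exists_apply_sub_smul_eq hH hμ⟩
  let B : V →L[ℂ] V := (H.domain.subtype.comp (e.symm : V →ₗ[ℂ] H.domain)).mkContinuous (|μ.im|)⁻¹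
    (fun v => by
      have h1 := abs_im_mul_norm_le hH μ (e.symm v)
      rw [← hT, show T (e.symm v) = v from e.apply_symm_apply v] at h1
      rw [inv_mul_eq_div, le_div_iff₀ (abs_pos.2 hμ), mul_comm]
      exact h1)
  have hB : ∀ v, B v = (e.symm v : V) := fun v => rfl
  refine ⟨B, fun v => ⟨by rw [hB]; exact (e.symm v).2, ?_⟩, fun x => ?_⟩
  · exact e.apply_symm_apply v
  · rw [hB, ← hT]
    exact congrArg _ (e.symm_apply_apply x)

theorem isResolventAt_resolventOp (hH : IsSelfAdjoint H) {μ : ℂ} (hμ : μ.im ≠ 0) :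
    IsResolventAt H μ (resolventOp H μ) :=
  Classical.epsilon_spec (exists_isResolventAt hH hμ)

/-- Apply `M` to `(H - ν) N v = v + (μ - ν) N v`. -/
theorem IsResolventAt.sub_eq {V : Type*} [NormedAddCommGroup V] [InnerProductSpace ℂ V]
    {H : V →ₗ.[ℂ] V} {μ ν : ℂ} {N M : V →L[ℂ] V} (hN : IsResolventAt H μ N)
    (hM : IsResolventAt H ν M) : N - M = (μ - ν) • (M * N) := by
  ext v
  obtain ⟨h1, h2⟩ := hN.1 v
  have h3 := hM.2 ⟨N v, h1⟩
  have h4 : M v + (μ - ν) • M (N v) = N v := by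
    rw [← map_smul, ← map_add]
    refine Eq.trans ?_ h3
    congr 1
    have h5 : v + (μ - ν) • N v = H ⟨N v, h1⟩ - μ • N v + (μ - ν) • N v := by rw [h2]
    rw [h5]
    module
  change N v - M v = (μ - ν) • M (N v)
  rw [sub_eq_iff_eq_add', h4]

theorem IsResolventAt.adjoint_eq (hH : IsSelfAdjoint H) {μ : ℂ} {N M : V →L[ℂ] V}
    (hN : IsResolventAt H μ N) (hM : IsResolventAt H ((starRingEnd ℂ) μ) M) : star N = M := by
  rw [ContinuousLinearMap.star_eq_adjoint]
  symm
  rw [ContinuousLinearMap.eq_adjoint_iff]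
  intro u v
  obtain ⟨h1, h2⟩ := hM.1 u
  obtain ⟨h3, h4⟩ := hN.1 v
  conv_lhs => rw [← h4]
  conv_rhs => rw [← h2]
  rw [inner_sub_left, inner_sub_right, inner_smul_left, inner_smul_right, Complex.conj_conj]
  congr 1
  exact (isFormalAdjoint_self hH ⟨M u, h1⟩ ⟨N v, h3⟩).symm

/-- The function `x ↦ (x - μ)⁻¹` on the line. -/
noncomputable def resolventFun (μ : ℂ) (x : ℝ) : ℂ := ((x : ℂ) - μ)⁻¹

theorem sub_ne_zero_of_im {μ : ℂ} (hμ : μ.im ≠ 0) (x : ℝ) : (x : ℂ) - μ ≠ 0 := by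
  intro h
  apply hμ
  have := congrArg Complex.im h
  simpa using this

theorem norm_resolventFun_le {μ : ℂ} (hμ : μ.im ≠ 0) (x : ℝ) :
    ‖resolventFun μ x‖ ≤ (|μ.im|)⁻¹ := by
  rw [resolventFun, norm_inv]
  refine inv_anti₀ (abs_pos.2 hμ) ?_
  simpa using Complex.abs_im_le_norm ((x : ℂ) - μ)

theorem bddMeas_resolventFun {μ : ℂ} (hμ : μ.im ≠ 0) : BddMeas (resolventFun μ) :=
  ⟨by unfold resolventFun; fun_prop, (|μ.im|)⁻¹, norm_resolventFun_le hμ⟩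

end Resolvent

/-! ### The spectral theorem for the resolvent at `i` -/

/-- If `w` has spectral measure concentrated on the zero set of an operator, that operator kills
`w`. -/
theorem measure_ker_eq_zero {X : Type*} [TopologicalSpace X] [CompactSpace X] [MeasurableSpace X]
    [BorelSpace X] {Φ : C(X, ℂ) →⋆ₐ[ℂ] (V →L[ℂ] V)} {μ : V → Measure X}
    (hΦ : ∀ f : C(X, ℂ), Represents μ f (Φ f))
    (hE : ∀ τ : X → ℝ, Measurable τ → ∃ E : PVM V, ∀ v, E.scalarMeasure v = (μ v).map τ)
    (f : C(X, ℂ)) (hinj : Function.Injective (Φ f)) (v : V) : μ v {x | f x = 0} = 0 := by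
  have hS : MeasurableSet {x | f x = 0} := (isClosed_eq f.continuous continuous_const).measurableSet
  -- The available projection-valued measures live on the line, so the zero set is encoded as the
  -- preimage of `{1}`.
  let τ : X → ℝ := {x | f x = 0}.indicator fun _ => 1
  have hτ : Measurable τ := measurable_const.indicator hS
  have hpre : τ ⁻¹' {1} = {x | f x = 0} := by
    ext x
    by_cases hx : f x = 0 <;> simp [τ, hx]
  obtain ⟨E, hEμ⟩ := hE τ hτ
  have h1 : MeasurableSet ({1} : Set ℝ) := measurableSet_singleton 1
  set w := E.proj {1} v with hw
  have h2 : E.proj {1}ᶜ w = 0 := by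
    have h3 := E.proj_inter {1}ᶜ {1} h1.compl h1
    rw [Set.compl_inter_self, E.proj_empty] at h3
    have h4 := congrArg (fun B : V →L[ℂ] V => B v) h3
    exact h4.symm
  have h5 : μ w {x | f x = 0}ᶜ = 0 := by
    rw [← hpre, ← Set.preimage_compl, ← Measure.map_apply hτ h1.compl, ← hEμ,
      E.scalarMeasure_apply w h1.compl, h2]
    simp
  have h6 : inner ℂ (Φ f w) (Φ f w) = 0 := by
    have h7 := hΦ (star f * f) w
    rw [map_mul, map_star] at h7
    rw [← ContinuousLinearMap.adjoint_inner_right, ← ContinuousLinearMap.star_eq_adjoint]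
    refine h7.trans (integral_eq_zero_of_ae ?_)
    have h8 : ∀ᵐ x ∂(μ w), f x = 0 := h5
    filter_upwards [h8] with x hx
    simp [hx]
  have h9 : w = 0 := hinj (by rw [inner_self_eq_zero.1 h6, map_zero])
  rw [← hpre, ← Measure.map_apply hτ h1, ← hEμ, E.scalarMeasure_apply v h1, ← hw, h9]
  simp

/-- `N` is normal and satisfies `N - N* = 2i N*N`, so its spectrum lies on the circle `Im z = |z|²`.
Inversion sends the nonzero points of that circle to `x - i` with `x = Re z⁻¹` real. Pushing the
measures forward along `z ↦ Re z⁻¹` turns `z` into `(x - i)⁻¹`. -/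
theorem exists_pvm_integral_eq_resolvent {H : V →ₗ.[ℂ] V} (hH : IsSelfAdjoint H) {N : V →L[ℂ] V}
    (hN : IsResolventAt H Complex.I N) :
    ∃ E : PVM V, E.integral (resolventFun Complex.I) = N := by
  have hI : ((starRingEnd ℂ) Complex.I).im ≠ 0 := by simp
  obtain ⟨M, hM⟩ := exists_isResolventAt hH hI
  have hNM : star N = M := hN.adjoint_eq hH hM
  have h1 : N - M = (2 * Complex.I) • (M * N) := by
    rw [hN.sub_eq hM, Complex.conj_I]
    congr 1
    ring
  have h2 : N - M = (2 * Complex.I) • (N * M) := by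
    have h3 := hM.sub_eq hN
    rw [Complex.conj_I] at h3
    rw [← neg_sub, h3, ← neg_smul]
    congr 1
    ring
  have hnormal : IsStarNormal N := by
    refine ⟨?_⟩
    rw [hNM]
    have h3 := h1.symm.trans h2
    exact smul_right_injective _ (by simp : (2 * Complex.I) ≠ 0) h3
  have hinj : Function.Injective N := by
    intro u v huv
    obtain ⟨a1, a2⟩ := hN.1 u
    obtain ⟨b1, b2⟩ := hN.1 v
    have h3 : (⟨N u, a1⟩ : H.domain) = ⟨N v, b1⟩ := Subtype.ext huv
    rw [← a2, ← b2, h3, huv]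
  let Φ : C(spectrum ℂ N, ℂ) →⋆ₐ[ℂ] (V →L[ℂ] V) := cfcHom hnormal
  let id' : C(spectrum ℂ N, ℂ) := (ContinuousMap.id ℂ).restrict (spectrum ℂ N)
  have hid : Φ id' = N := cfcHom_id hnormal
  -- The operator identity becomes an identity of functions because the continuous functional
  -- calculus is injective.
  have hcircle : id' - star id' = (2 * Complex.I) • (star id' * id') := by
    refine cfcHom_injective hnormal ?_
    change Φ _ = Φ _
    rw [map_sub, map_smul, map_mul, map_star, hid, hNM, h1]
  obtain ⟨μ, hΦ, hE⟩ := exists_pvm_of_starAlgHom Φ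
  have hτ : Measurable fun z : spectrum ℂ N => ((z : ℂ)⁻¹).re := by fun_prop
  obtain ⟨E, hEμ⟩ := hE _ hτ
  have hI' : Complex.I.im ≠ 0 := by simp
  refine ⟨E, (E.represents_integral (bddMeas_resolventFun hI')).unique fun v => ?_⟩
  rw [hEμ, integral_map hτ.aemeasurable (bddMeas_resolventFun hI').1.aestronglyMeasurable]
  have h4 := hΦ id' v
  rw [hid] at h4
  rw [h4]
  refine integral_congr_ae ?_
  -- The point `0`, where inversion fails, is null because `N` is injective.
  have h5 : ∀ᵐ z ∂(μ v), id' z ≠ 0 := by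
    have := measure_ker_eq_zero hΦ hE id' (by rw [hid]; exact hinj) v
    rw [ae_iff]
    simpa using this
  filter_upwards [h5] with z hz
  have hz' : (z : ℂ) ≠ 0 := hz
  have h6 : (z : ℂ) - (starRingEnd ℂ) (z : ℂ)
      = 2 * Complex.I * ((starRingEnd ℂ) (z : ℂ) * z) :=
    congrArg (fun f : C(spectrum ℂ N, ℂ) => f z) hcircle
  have h7 : (z : ℂ).im = Complex.normSq z := by
    have := congrArg Complex.im h6
    simp only [Complex.sub_im, Complex.conj_im, Complex.mul_im, Complex.mul_re, Complex.conj_re,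
      Complex.I_re, Complex.I_im, Complex.re_ofNat, Complex.im_ofNat] at this
    rw [Complex.normSq_apply]
    linarith
  have h8 : ((((z : ℂ)⁻¹).re : ℝ) : ℂ) - Complex.I = (z : ℂ)⁻¹ := by
    refine Complex.ext (by simp) ?_
    have h9 : Complex.normSq (z : ℂ) ≠ 0 := by simpa using hz'
    rw [Complex.inv_im, h7, Complex.sub_im, Complex.ofReal_im, Complex.I_im, neg_div,
      div_self h9]
    ring
  change (z : ℂ) = resolventFun Complex.I _
  rw [resolventFun, h8, inv_inv]

end KatoSmooth

/-! ### The spectral theorem for unbounded self-adjoint operators -/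

namespace KatoSmooth

open Filter Topology

variable {V : Type*} [NormedAddCommGroup V] [InnerProductSpace ℂ V] [CompleteSpace V]
  {H : V →ₗ.[ℂ] V}

theorem resolventFun_mul_sub {μ : ℂ} (hμ : μ.im ≠ 0) (x : ℝ) :
    resolventFun μ x * ((x : ℂ) - μ) = 1 :=
  inv_mul_cancel₀ (sub_ne_zero_of_im hμ x)

theorem norm_resolventFun_sq_mul {μ : ℂ} (hμ : μ.im ≠ 0) (x : ℝ) :
    ((‖resolventFun μ x‖ ^ 2 : ℝ) : ℂ) * ((x : ℂ) - μ) = (starRingEnd ℂ) (resolventFun μ x) := by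
  have h1 : ((‖resolventFun μ x‖ ^ 2 : ℝ) : ℂ)
      = (starRingEnd ℂ) (resolventFun μ x) * resolventFun μ x := by
    rw [Complex.conj_mul']; push_cast; rfl
  rw [h1, mul_assoc, resolventFun_mul_sub hμ, mul_one]

theorem sq_le_of_im (μ : ℂ) (x : ℝ) : x ^ 2 ≤ 2 * ‖(x : ℂ) - μ‖ ^ 2 + 2 * ‖μ‖ ^ 2 := by
  have h1 : |x| ≤ ‖(x : ℂ) - μ‖ + ‖μ‖ := by
    have := norm_le_norm_sub_add (x : ℂ) μ
    rwa [Complex.norm_real, Real.norm_eq_abs] at this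
  have h2 : x ^ 2 ≤ (‖(x : ℂ) - μ‖ + ‖μ‖) ^ 2 := by
    rw [← sq_abs x]
    exact pow_le_pow_left₀ (abs_nonneg _) h1 2
  nlinarith [sq_nonneg (‖(x : ℂ) - μ‖ - ‖μ‖)]

/-- The range of `∫ (x - μ)⁻¹ dE` consists of vectors for which `x²` is integrable. -/
theorem integrable_sq_scalarMeasure_resolvent (E : PVM V) {μ : ℂ} (hμ : μ.im ≠ 0) (v : V) :
    Integrable (fun x : ℝ => x ^ 2) (E.scalarMeasure (E.integral (resolventFun μ) v)) := by
  refine ⟨by fun_prop, ?_⟩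
  have hm := (bddMeas_resolventFun hμ).1
  rw [E.scalarMeasure_integral (bddMeas_resolventFun hμ), hasFiniteIntegral_iff_enorm,
    lintegral_withDensity_eq_lintegral_mul _ (by fun_prop) (by fun_prop)]
  refine lt_of_le_of_lt (lintegral_mono (g := fun _ => ENNReal.ofReal
    (2 + 2 * ‖μ‖ ^ 2 * ((|μ.im|)⁻¹) ^ 2)) fun x => ?_) ?_
  · rw [Pi.mul_apply, ← ofReal_norm, ← ofReal_norm, ← ENNReal.ofReal_pow (norm_nonneg _),
      ← ENNReal.ofReal_mul (by positivity)]
    refine ENNReal.ofReal_le_ofReal ?_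
    have h0 : ‖(x : ℂ) - μ‖ ≠ 0 := norm_ne_zero_iff.2 (sub_ne_zero_of_im hμ x)
    have h2 := norm_resolventFun_le hμ x
    have h3 : ‖resolventFun μ x‖ ^ 2 * ‖(x : ℂ) - μ‖ ^ 2 = 1 := by
      rw [← mul_pow, ← norm_mul, resolventFun_mul_sub hμ]; simp
    rw [norm_pow, Real.norm_eq_abs, sq_abs]
    calc ‖resolventFun μ x‖ ^ 2 * x ^ 2
        ≤ ‖resolventFun μ x‖ ^ 2 * (2 * ‖(x : ℂ) - μ‖ ^ 2 + 2 * ‖μ‖ ^ 2) := by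
          gcongr; exact sq_le_of_im μ x
      _ = 2 + 2 * ‖μ‖ ^ 2 * ‖resolventFun μ x‖ ^ 2 := by linear_combination 2 * h3
      _ ≤ _ := by gcongr
  · rw [lintegral_const]
    exact ENNReal.mul_lt_top ENNReal.ofReal_lt_top (measure_lt_top _ _)

/-- The spectral theorem: a self-adjoint operator has a spectral resolution. -/
theorem exists_isResolutionOf (hH : IsSelfAdjoint H) : ∃ E : PVM V, E.IsResolutionOf H := by
  have hI : Complex.I.im ≠ 0 := by simp
  obtain ⟨N, hN⟩ := exists_isResolventAt hH hI
  obtain ⟨E, hE⟩ := exists_pvm_integral_eq_resolvent hH hN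
  have hb := bddMeas_resolventFun hI
  refine ⟨E, fun v => ⟨fun hv => ?_, fun hv => ?_⟩, fun v => ?_⟩
  -- Every `v` in the domain is `N (H v - i v)`, so it lies in the range of the resolvent.
  · have h1 := integrable_sq_scalarMeasure_resolvent E hI (H ⟨v, hv⟩ - Complex.I • v)
    have h2 : N (H ⟨v, hv⟩ - Complex.I • v) = v := hN.2 ⟨v, hv⟩
    rwa [hE, h2] at h1
  -- Conversely it suffices that `x ↦ ⟨v, H x⟩` is bounded, since `H* = H`.
  · have hadj := LinearPMap.isSelfAdjoint_def.1 hH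
    rw [← hadj, LinearPMap.mem_adjoint_domain_iff]
    -- The truncations of `x - i` invert the resolvent function on `[-n, n]`. They give `E([-n, n])
    -- v = N* y` with `‖y‖² ≤ K` uniformly in `n`, whence `|⟨v, u⟩| ≤ √K ‖N u‖`, to be used with `u
    -- = (H - i)x`.
    let g : ℕ → ℝ → ℂ := fun n => (Set.Icc (-(n : ℝ)) n).indicator fun x => (x : ℂ) - Complex.I
    have hSm : ∀ n : ℕ, MeasurableSet (Set.Icc (-(n : ℝ)) n) := fun n => measurableSet_Icc
    have hg : ∀ n, BddMeas (g n) := by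
      intro n
      refine ⟨Measurable.indicator (by fun_prop) (hSm n), n + 1, fun x => ?_⟩
      by_cases hx : x ∈ Set.Icc (-(n : ℝ)) n
      · simp only [g, Set.indicator_of_mem hx]
        refine (norm_sub_le _ _).trans ?_
        rw [Complex.norm_real, Complex.norm_I, Real.norm_eq_abs]
        gcongr
        exact abs_le.2 hx
      · simp only [g, Set.indicator_of_notMem hx, norm_zero]
        positivity
    have hgh : ∀ n, (fun x => (starRingEnd ℂ) (resolventFun Complex.I x)) *
        (fun x => (starRingEnd ℂ) (g n x)) = (Set.Icc (-(n : ℝ)) n).indicator fun _ => 1 := by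
      intro n
      ext x
      rw [Pi.mul_apply, ← map_mul]
      by_cases hx : x ∈ Set.Icc (-(n : ℝ)) n
      · simp only [g, Set.indicator_of_mem hx, resolventFun_mul_sub hI, map_one]
      · simp only [g, Set.indicator_of_notMem hx, mul_zero, map_zero]
    have hfi : Integrable (fun x : ℝ => x ^ 2 + 1) (E.scalarMeasure v) := hv.add (integrable_const _)
    set K : ℝ := ∫ x : ℝ, x ^ 2 + 1 ∂(E.scalarMeasure v) with hK
    have hgn : ∀ n, ‖E.integral (fun x => (starRingEnd ℂ) (g n x)) v‖ ^ 2 ≤ K := by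
      intro n
      rw [E.norm_integral_sq (hg n).conj]
      refine integral_mono_of_nonneg (Eventually.of_forall fun x => by positivity) hfi
        (Eventually.of_forall fun x => ?_)
      simp only [RCLike.norm_conj]
      by_cases hx : x ∈ Set.Icc (-(n : ℝ)) n
      · simp only [g, Set.indicator_of_mem hx]
        rw [← Complex.normSq_eq_norm_sq, Complex.normSq_apply]
        simp
        nlinarith
      · simp only [g, Set.indicator_of_notMem hx, norm_zero]
        rw [zero_pow two_ne_zero]
        positivity
    have hbound : ∀ u : V, ‖inner ℂ v u‖ ≤ √K * ‖N u‖ := by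
      intro u
      have h1 : Tendsto (fun n : ℕ => inner ℂ u (E.proj (Set.Icc (-(n : ℝ)) n) v)) atTop
          (𝓝 (inner ℂ u ((1 : V →L[ℂ] V) v))) := by
        refine tendsto_inner_of_represents E.scalarMeasure_univ (C := 1)
          (F := fun n : ℕ => (Set.Icc (-(n : ℝ)) n).indicator fun _ => 1)
          (f := Set.univ.indicator fun _ => 1)
          (fun n => measurable_const.indicator (hSm n))
          (fun n x => (norm_indicator_le_norm_self _ _).trans (by simp)) (fun x => ?_)
          (fun n => E.represents_proj (hSm n))
          (by rw [← E.proj_univ]; exact E.represents_proj MeasurableSet.univ) u v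
        refine tendsto_const_nhds.congr' ?_
        obtain ⟨m, hm⟩ := exists_nat_ge |x|
        filter_upwards [eventually_ge_atTop m] with n hn
        have hmn : (m : ℝ) ≤ n := by exact_mod_cast hn
        rw [Set.indicator_of_mem (Set.mem_univ _), Set.indicator_of_mem]
        exact abs_le.1 (hm.trans hmn)
      rw [one_apply_eq_self] at h1
      rw [← inner_conj_symm, RCLike.norm_conj]
      refine le_of_tendsto h1.norm (Eventually.of_forall fun n => ?_)
      have h2 : E.proj (Set.Icc (-(n : ℝ)) n) v = ContinuousLinearMap.adjoint N
          (E.integral (fun x => (starRingEnd ℂ) (g n x)) v) := by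
        rw [← E.integral_indicator (hSm n), ← hgh n, E.integral_mul hb.conj (hg n).conj,
          E.integral_conj hb, hE]
        rfl
      rw [h2, ContinuousLinearMap.adjoint_inner_right, mul_comm]
      refine (norm_inner_le_norm _ _).trans ?_
      gcongr
      exact Real.le_sqrt_of_sq_le (hgn n)
    refine AddMonoidHomClass.continuous_of_bound ((innerₛₗ ℂ v).comp H.toFun) (√K + ‖v‖) fun x => ?_
    change ‖inner ℂ v (H x)‖ ≤ (√K + ‖v‖) * ‖(x : V)‖
    have h1 := hbound (H x - Complex.I • (x : V))
    rw [hN.2 x] at h1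
    have h2 : inner ℂ v (H x) = inner ℂ v (H x - Complex.I • (x : V))
        + Complex.I * inner ℂ v (x : V) := by
      rw [inner_sub_right, inner_smul_right]; ring
    rw [h2, add_mul]
    refine (norm_add_le _ _).trans (add_le_add h1 ?_)
    rw [norm_mul, Complex.norm_I, one_mul]
    exact norm_inner_le_norm _ _
  -- With `v = N w` and `H v = w + i v`, both sides are integrals against the spectral measure of
  -- `w`, and the claim becomes `|r|² (x - i) = r̄` for `r = (x - i)⁻¹`.
  · set w := H v - Complex.I • (v : V) with hw
    have hv : N w = (v : V) := hN.2 v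
    have hHv : H v = w + Complex.I • (v : V) := by rw [hw]; abel
    rw [hHv, inner_add_right, inner_smul_right, ← hv, ← hE,
      E.integral_scalarMeasure_integral hb, E.inner_integral_integral hb hb,
      ← ContinuousLinearMap.adjoint_inner_right, ← E.integral_conj hb,
      E.represents_integral hb.conj w, ← integral_const_mul, ← MeasureTheory.integral_add]
    · refine integral_congr_ae (Eventually.of_forall fun x => ?_)
      simp only
      have h1 := norm_resolventFun_sq_mul hI x
      have h2 : ((‖resolventFun Complex.I x‖ ^ 2 : ℝ) : ℂ)
          = (starRingEnd ℂ) (resolventFun Complex.I x) * resolventFun Complex.I x := by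
        rw [Complex.conj_mul']; push_cast; rfl
      rw [← h2]
      linear_combination -h1
    · exact hb.conj.integrable _
    · exact ((hb.conj.mul hb).const_smul Complex.I).integrable _

theorem isResolutionOf_spectralResolution (hH : IsSelfAdjoint H) :
    (spectralResolution H).IsResolutionOf H :=
  Classical.epsilon_spec (exists_isResolutionOf hH)

theorem injective_integral_conj_resolventFun (E : PVM V) {μ : ℂ} (hμ : μ.im ≠ 0) {v : V}
    (h : E.integral (fun x => (starRingEnd ℂ) (resolventFun μ x)) v = 0) : v = 0 := by
  have hb := bddMeas_resolventFun hμ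
  have hb' : BddMeas fun x => (starRingEnd ℂ) (resolventFun μ x) := hb.conj
  have h1 := E.ofReal_norm_integral_sq hb' v
  rw [h, norm_zero, zero_pow two_ne_zero, ENNReal.ofReal_zero, eq_comm,
    lintegral_eq_zero_iff (by have := hb'.1; fun_prop)] at h1
  have h2 : ∀ᵐ _ ∂(E.scalarMeasure v), False := by
    filter_upwards [h1] with x hx
    have hx' : (starRingEnd ℂ) (resolventFun μ x) = 0 := by simpa using hx
    rw [map_eq_zero, resolventFun, inv_eq_zero] at hx'
    exact sub_ne_zero_of_im hμ x hx'
  rw [eventually_false_iff_eq_bot, ae_eq_bot] at h2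
  have h3 := E.scalarMeasure_univ v
  rw [h2, Measure.coe_zero, Pi.zero_apply] at h3
  have h4 : ‖v‖ ^ 2 ≤ 0 := ENNReal.ofReal_eq_zero.1 h3.symm
  have h5 : ‖v‖ = 0 := by nlinarith [norm_nonneg v]
  exact norm_eq_zero.1 h5

/-- A resolution determines `⟨y, H y⟩` only on the diagonal. With `R = ∫ (x - μ)⁻¹ dE`, the form
`⟨v, R*((H - μ)R - 1)v⟩` involves `H` only through `⟨Rv, H Rv⟩` and can be computed to vanish.
Polarization gives `R*((H - μ)R - 1) = 0`, and `R*` is injective. -/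
theorem resolventOp_eq_integral (hH : IsSelfAdjoint H) {E : PVM V} (hE : E.IsResolutionOf H) {μ : ℂ}
    (hμ : μ.im ≠ 0) : resolventOp H μ = E.integral (resolventFun μ) := by
  have hb := bddMeas_resolventFun hμ
  have hdom : ∀ v, E.integral (resolventFun μ) v ∈ H.domain := fun v =>
    (hE.1 _).2 (integrable_sq_scalarMeasure_resolvent E hμ v)
  let R' : V →ₗ[ℂ] H.domain :=
    (E.integral (resolventFun μ) : V →ₗ[ℂ] V).codRestrict H.domain hdom
  let B : V →ₗ[ℂ] V := H.toFun.comp R' - μ • (E.integral (resolventFun μ) : V →ₗ[ℂ] V)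
  have hB : ∀ v, B v = H ⟨_, hdom v⟩ - μ • E.integral (resolventFun μ) v := fun v => rfl
  let Q : V →ₗ[ℂ] V := (ContinuousLinearMap.adjoint (E.integral (resolventFun μ)) : V →ₗ[ℂ] V).comp
    (B - LinearMap.id)
  have hQ : ∀ v, Q v = ContinuousLinearMap.adjoint (E.integral (resolventFun μ)) (B v - v) :=
    fun v => rfl
  have hdiag : ∀ v, inner ℂ v (Q v) = 0 := by
    intro v
    rw [hQ, ContinuousLinearMap.adjoint_inner_right, inner_sub_right, hB, inner_sub_right,
      hE.2 ⟨_, hdom v⟩, inner_smul_right, E.inner_integral_integral hb hb,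
      ← ContinuousLinearMap.adjoint_inner_right, ← E.integral_conj hb,
      E.represents_integral hb.conj v, E.integral_scalarMeasure_integral hb, ← integral_const_mul,
      sub_sub, ← MeasureTheory.integral_add, ← MeasureTheory.integral_sub]
    · refine integral_eq_zero_of_ae (Eventually.of_forall fun x => ?_)
      have h1 := norm_resolventFun_sq_mul hμ x
      have h2 : ((‖resolventFun μ x‖ ^ 2 : ℝ) : ℂ)
          = (starRingEnd ℂ) (resolventFun μ x) * resolventFun μ x := by
        rw [Complex.conj_mul']; push_cast; rfl
      simp only [Pi.zero_apply]
      rw [← h2]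
      linear_combination h1
    -- The unbounded factor `x` is harmless: `|r|² x = r̄ + μ |r|²`.
    · have h3 : BddMeas fun x : ℝ => ((‖resolventFun μ x‖ ^ 2 : ℝ) : ℂ) * x := by
        have h4 : (fun x : ℝ => ((‖resolventFun μ x‖ ^ 2 : ℝ) : ℂ) * x)
            = (fun x => (starRingEnd ℂ) (resolventFun μ x)) +
              μ • ((fun x => (starRingEnd ℂ) (resolventFun μ x)) * resolventFun μ) := by
          ext x
          have h1 := norm_resolventFun_sq_mul hμ x
          have h2 : ((‖resolventFun μ x‖ ^ 2 : ℝ) : ℂ)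
              = (starRingEnd ℂ) (resolventFun μ x) * resolventFun μ x := by
            rw [Complex.conj_mul']; push_cast; rfl
          simp only [Pi.add_apply, Pi.smul_apply, Pi.mul_apply, smul_eq_mul]
          rw [← h2]
          linear_combination h1
        rw [h4]
        exact hb.conj.add ((hb.conj.mul hb).const_smul μ)
      exact h3.integrable _
    · exact (((hb.conj.mul hb).const_smul μ).add hb.conj).integrable _
    · exact ((hb.conj.mul hb).const_smul μ).integrable _
    · exact hb.conj.integrable _
  have hQ0 : ∀ v, Q v = 0 := by
    intro v
    refine ext_inner_left ℂ fun u => ?_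
    rw [inner_eq_polar Q u v]
    simp only [polar, hdiag]
    simp
  have hR : ∀ v, H ⟨_, hdom v⟩ - μ • E.integral (resolventFun μ) v = v := by
    intro v
    have h1 := hQ0 v
    rw [hQ, ← E.integral_conj hb] at h1
    rw [← hB]
    exact sub_eq_zero.1 (injective_integral_conj_resolventFun E hμ h1)
  ext v
  have h1 := (isResolventAt_resolventOp hH hμ).2 ⟨_, hdom v⟩
  have h2 := hR v
  conv_lhs => rw [← h2]
  exact h1

end KatoSmooth

/-! ### Resolvents as Fourier transforms of the unitary group -/

namespace KatoSmooth

open Filter Topology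

theorem integral_polar {V : Type*} [NormedAddCommGroup V] [InnerProductSpace ℂ V] {α : Type*}
    [MeasurableSpace α] {ν : Measure α} {q : V → α → ℂ} (hq : ∀ y, Integrable (q y) ν) (u v : V) :
    ∫ a, polar (fun y => q y a) u v ∂ν = polar (fun y => ∫ a, q y a ∂ν) u v := by
  simp only [polar]
  have h1 : Integrable (fun a => q (u + v) a - q (u - v) a) ν := (hq _).sub (hq _)
  have h2 : Integrable (fun a => q (u + v) a - q (u - v) a - Complex.I * q (u + Complex.I • v) a) ν :=
    h1.sub ((hq _).const_mul _)
  rw [integral_div, integral_add h2 ((hq _).const_mul _), integral_sub h1 ((hq _).const_mul _),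
    integral_sub (hq _) (hq _), integral_const_mul, integral_const_mul]

section Scalar

theorem integrable_exp_neg_mul_abs {ε : ℝ} (hε : 0 < ε) :
    Integrable fun t : ℝ => Real.exp (-ε * |t|) := by
  rw [← integrableOn_univ, ← Set.Iic_union_Ioi (a := (0 : ℝ))]
  refine IntegrableOn.union ?_ ?_
  · refine (integrableOn_exp_mul_Iic hε 0).congr_fun (fun t ht => ?_) measurableSet_Iic
    simp only [abs_of_nonpos (Set.mem_Iic.1 ht)]
    congr 1
    ring
  · refine (exp_neg_integrableOn_Ioi 0 hε).congr_fun (fun t ht => ?_) measurableSet_Ioi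
    simp only [abs_of_pos (Set.mem_Ioi.1 ht)]

open scoped FourierTransform in
/-- Plancherel's theorem in the normalization `∫ exp (i s t) g t dt`. -/
theorem lintegral_integral_exp_sq {g : ℝ → ℂ} (h1 : Integrable g) (h2 : MemLp g 2) :
    ∫⁻ s : ℝ, ‖∫ t : ℝ, Complex.exp (Complex.I * s * t) * g t‖ₑ ^ 2
      = ENNReal.ofReal (2 * Real.pi) * ∫⁻ t, ‖g t‖ₑ ^ 2 := by
  have hcont : Continuous (𝓕 g) :=
    VectorFourier.fourierIntegral_continuous Real.continuous_fourierChar (by fun_prop) h1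
  have hpi : (2 * Real.pi) ≠ 0 := by positivity
  have hne : (-(2 * Real.pi)⁻¹) ≠ 0 := by simp
  have h3 : ∀ s : ℝ, ∫ t : ℝ, Complex.exp (Complex.I * s * t) * g t
      = 𝓕 g (-(2 * Real.pi)⁻¹ * s) := by
    intro s
    rw [Real.fourier_real_eq_integral_exp_smul]
    refine integral_congr_ae (Eventually.of_forall fun t => ?_)
    simp only [smul_eq_mul]
    congr 2
    have : -2 * Real.pi * t * (-(2 * Real.pi)⁻¹ * s) = s * t := by field_simp
    rw [this]
    push_cast
    ring
  simp only [h3]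
  have hm : Measurable fun ξ => ‖𝓕 g ξ‖ₑ ^ 2 := by fun_prop
  rw [← lintegral_fourier_sq h1 h2,
    ← lintegral_map (μ := volume) hm (by fun_prop : Measurable fun s : ℝ => -(2 * Real.pi)⁻¹ * s),
    Real.map_volume_mul_left hne, lintegral_smul_measure, smul_eq_mul]
  congr 2
  rw [inv_neg, inv_inv, abs_neg, abs_of_pos (by positivity)]

theorem integral_exp_Ioi {μ : ℂ} (hμ : 0 < μ.im) (x : ℝ) :
    ∫ t in Set.Ioi (0 : ℝ), Complex.exp (Complex.I * (μ - x) * t)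
      = -Complex.I * resolventFun μ x := by
  rw [integral_exp_mul_complex_Ioi (by simpa using hμ)]
  have h0 := sub_ne_zero_of_im hμ.ne' x
  have h1 : (μ - x : ℂ) ≠ 0 := by rw [← neg_sub]; exact neg_ne_zero.2 h0
  rw [resolventFun]
  simp only [Complex.ofReal_zero, mul_zero, Complex.exp_zero]
  field_simp
  rw [Complex.I_sq]
  ring

theorem integral_exp_Iic {μ : ℂ} (hμ : μ.im < 0) (x : ℝ) :
    ∫ t in Set.Iic (0 : ℝ), Complex.exp (Complex.I * (μ - x) * t)
      = Complex.I * resolventFun μ x := by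
  rw [integral_exp_mul_complex_Iic (by simpa using hμ)]
  have h0 := sub_ne_zero_of_im hμ.ne x
  have h1 : (μ - x : ℂ) ≠ 0 := by rw [← neg_sub]; exact neg_ne_zero.2 h0
  rw [resolventFun]
  simp only [Complex.ofReal_zero, mul_zero, Complex.exp_zero]
  field_simp
  rw [Complex.I_sq]
  ring

theorem exp_weight_mul_exp {s x ε : ℝ} (μ : ℂ) (t : ℝ) (hμ : Complex.I * μ * t
      = Complex.I * s * t + ((-ε * |t| : ℝ) : ℂ)) :
    ((Real.exp (-ε * |t|) : ℝ) : ℂ) * Complex.exp (Complex.I * (s - x) * t)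
      = Complex.exp (Complex.I * (μ - x) * t) := by
  rw [Complex.ofReal_exp, ← Complex.exp_add]
  congr 1
  linear_combination -hμ

/-- The upper half-plane uses positive times and the lower one negative times, so the two weights
have disjoint supports and add up to `exp(-ε|t|)`. -/
theorem weight_Ioi (s x : ℝ) {ε : ℝ} (hε : 0 < ε) :
    ∫ t : ℝ, (Set.Ioi (0 : ℝ)).indicator (fun t => ((Real.exp (-ε * |t|) : ℝ) : ℂ)) t *
      Complex.exp (Complex.I * (s - x) * t)
      = (-Complex.I • resolventFun (s + ε * Complex.I)) x := by
  have h1 := integral_exp_Ioi (μ := s + ε * Complex.I) (by simpa using hε) x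
  rw [Pi.smul_apply, smul_eq_mul, ← h1, ← integral_indicator measurableSet_Ioi]
  refine integral_congr_ae (Eventually.of_forall fun t => ?_)
  by_cases ht : t ∈ Set.Ioi (0 : ℝ)
  · simp only [Set.indicator_of_mem ht]
    refine exp_weight_mul_exp _ _ ?_
    rw [abs_of_pos ht]
    push_cast
    linear_combination (ε * t : ℂ) * Complex.I_sq
  · simp only [Set.indicator_of_notMem ht, zero_mul]

theorem weight_Iic (s x : ℝ) {ε : ℝ} (hε : 0 < ε) :
    ∫ t : ℝ, (Set.Iic (0 : ℝ)).indicator (fun t => ((Real.exp (-ε * |t|) : ℝ) : ℂ)) t *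
      Complex.exp (Complex.I * (s - x) * t)
      = (Complex.I • resolventFun (s - ε * Complex.I)) x := by
  have h1 := integral_exp_Iic (μ := s - ε * Complex.I) (by simpa using hε) x
  rw [Pi.smul_apply, smul_eq_mul, ← h1, ← integral_indicator measurableSet_Iic]
  refine integral_congr_ae (Eventually.of_forall fun t => ?_)
  by_cases ht : t ∈ Set.Iic (0 : ℝ)
  · simp only [Set.indicator_of_mem ht]
    refine exp_weight_mul_exp _ _ ?_
    rw [abs_of_nonpos ht]
    push_cast
    linear_combination -(ε * t : ℂ) * Complex.I_sq
  · simp only [Set.indicator_of_notMem ht, zero_mul]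

end Scalar

namespace PVM

variable {V : Type*} [NormedAddCommGroup V] [InnerProductSpace ℂ V] [CompleteSpace V] (E : PVM V)

theorem continuous_inner_integral {F : ℝ → ℝ → ℂ} {C : ℝ} (hm : ∀ s, Measurable (F s))
    (hC : ∀ s x, ‖F s x‖ ≤ C) (hc : ∀ x, Continuous fun s => F s x) (u v : V) :
    Continuous fun s => inner ℂ u (E.integral (F s) v) := by
  rw [continuous_iff_continuousAt]
  intro s₀
  refine tendsto_inner_of_tendsto_inner_self (fun w => ?_) u v
  simp only [E.represents_integral ⟨hm _, C, hC _⟩ w]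
  have h1 : Continuous fun s => ∫ x, F s x ∂(E.scalarMeasure w) :=
    continuous_of_dominated (fun s => (hm s).aestronglyMeasurable)
      (fun s => Eventually.of_forall (hC s)) (integrable_const C) (Eventually.of_forall hc)
  exact h1.continuousAt

/-- The unitary group `∫ exp (-i t x) dE(x)`. -/
noncomputable def unitary (t : ℝ) : V →L[ℂ] V :=
  E.integral fun x => Complex.exp (-Complex.I * t * x)

theorem norm_exp_unitary (t x : ℝ) : ‖Complex.exp (-Complex.I * t * x)‖ = 1 := by
  rw [Complex.norm_exp]
  simp

theorem bddMeas_unitary (t : ℝ) : BddMeas fun x : ℝ => Complex.exp (-Complex.I * t * x) :=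
  ⟨by fun_prop, 1, fun x => (norm_exp_unitary t x).le⟩

theorem continuous_inner_unitary (u v : V) : Continuous fun t => inner ℂ u (E.unitary t v) :=
  E.continuous_inner_integral (fun t => (bddMeas_unitary t).1) (fun t x => (norm_exp_unitary t x).le)
    (fun x => by fun_prop) u v

theorem norm_unitary (t : ℝ) (v : V) : ‖E.unitary t v‖ = ‖v‖ := by
  have h1 := E.norm_integral_sq (bddMeas_unitary t) v
  simp only [norm_exp_unitary, one_pow, MeasureTheory.integral_const, smul_eq_mul, mul_one,
    measureReal_univ_of_univ E.scalarMeasure_univ] at h1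
  exact (sq_eq_sq₀ (norm_nonneg _) (norm_nonneg _)).1 h1

theorem norm_inner_unitary_le (t : ℝ) (u v : V) : ‖inner ℂ u (E.unitary t v)‖ ≤ ‖u‖ * ‖v‖ := by
  rw [← E.norm_unitary t v]
  exact norm_inner_le_norm _ _

theorem integrable_mul_inner_unitary {w : ℝ → ℂ} (hw : Integrable w) (u v : V) :
    Integrable fun t => w t * inner ℂ u (E.unitary t v) :=
  hw.mul_bdd (c := ‖u‖ * ‖v‖) (E.continuous_inner_unitary u v).aestronglyMeasurable
    (Eventually.of_forall fun t => E.norm_inner_unitary_le t u v)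

/-- If `W` is the Fourier transform of `w`, then `∫ W dE` is the integral of `w` against the
unitary group. -/
theorem inner_integral_eq_integral_unitary {w : ℝ → ℂ} (hw : Integrable w) {W : ℝ → ℂ}
    (hW : BddMeas W) (h : ∀ x : ℝ, ∫ t : ℝ, w t * Complex.exp (-Complex.I * t * x) = W x) (u v : V) :
    inner ℂ u (E.integral W v) = ∫ t, w t * inner ℂ u (E.unitary t v) := by
  -- Fubini is applied on the diagonal, where the form is a positive measure; polarization then
  -- gives general `u` and `v`.
  have hdiag : ∀ y : V, inner ℂ y (E.integral W y) = ∫ t, w t * inner ℂ y (E.unitary t y) := by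
    intro y
    rw [E.represents_integral hW y]
    simp only [← h]
    rw [integral_integral_swap]
    · refine integral_congr_ae (Eventually.of_forall fun t => ?_)
      simp only
      rw [MeasureTheory.integral_const_mul, ← E.represents_integral (bddMeas_unitary t) y]
      rfl
    · have h1 : Integrable (fun p : ℝ × ℝ => w p.2) ((E.scalarMeasure y).prod volume) :=
        hw.comp_snd _
      refine h1.mul_bdd (c := 1) (Measurable.aestronglyMeasurable (by fun_prop)) ?_
      exact Eventually.of_forall fun p => (norm_exp_unitary p.2 p.1).le
  have h2 : ∀ B : V →L[ℂ] V, inner ℂ u (B v) = polar (fun y => inner ℂ y (B y)) u v :=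
    fun B => inner_eq_polar (B : V →ₗ[ℂ] V) u v
  rw [h2]
  simp only [hdiag]
  rw [← integral_polar fun y => E.integrable_mul_inner_unitary hw y y]
  refine integral_congr_ae (Eventually.of_forall fun t => ?_)
  simp only [h2, polar]
  ring

/-- As a function of `s` the matrix coefficient is the Fourier integral of `w t * ⟨u, U t v⟩`, where
`U` is the unitary group. The exponential bound on `w` puts this in `L¹ ∩ L²`, so Plancherel
applies. -/
theorem lintegral_inner_sq_of_weight {w : ℝ → ℂ} (hwm : Measurable w) {ε : ℝ} (hε : 0 < ε)
    (hw : ∀ t, ‖w t‖ ≤ Real.exp (-ε * |t|)) {W : ℝ → ℝ → ℂ} (hW : ∀ s, BddMeas (W s))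
    (h : ∀ s x : ℝ, ∫ t : ℝ, w t * Complex.exp (Complex.I * (s - x) * t) = W s x) (u v : V) :
    ∫⁻ s, ‖inner ℂ u (E.integral (W s) v)‖ₑ ^ 2
      = ENNReal.ofReal (2 * Real.pi) * ∫⁻ t, ‖w t‖ₑ ^ 2 * ‖inner ℂ u (E.unitary t v)‖ₑ ^ 2 := by
  have hwi : Integrable w := (integrable_exp_neg_mul_abs hε).mono' hwm.aestronglyMeasurable
    (Eventually.of_forall hw)
  have hw1 : ∀ t, ‖w t‖ ≤ 1 := fun t => (hw t).trans (Real.exp_le_one_iff.2 (by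
    have := mul_nonneg hε.le (abs_nonneg t); linarith))
  have hgi := E.integrable_mul_inner_unitary hwi u v
  have hg2 : MemLp (fun t => w t * inner ℂ u (E.unitary t v)) 2 := by
    refine (memLp_two_iff_integrable_sq_norm hgi.aestronglyMeasurable).2 ?_
    have h1 := hgi.norm.mul_bdd (c := 1 * (‖u‖ * ‖v‖)) hgi.norm.aestronglyMeasurable
      (Eventually.of_forall fun t => by
        rw [norm_norm, norm_mul]
        exact mul_le_mul (hw1 t) (E.norm_inner_unitary_le t u v) (norm_nonneg _) zero_le_one)
    simpa only [sq] using h1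
  have h2 := lintegral_integral_exp_sq hgi hg2
  have h3 : ∀ s : ℝ, ∫ t : ℝ, Complex.exp (Complex.I * s * t) * (w t * inner ℂ u (E.unitary t v))
      = inner ℂ u (E.integral (W s) v) := by
    intro s
    have h4 : Integrable fun t : ℝ => Complex.exp (Complex.I * s * t) * w t :=
      hwi.bdd_mul (c := 1) (Measurable.aestronglyMeasurable (by fun_prop))
        (Eventually.of_forall fun t => by rw [Complex.norm_exp]; simp)
    rw [E.inner_integral_eq_integral_unitary h4 (hW s)]
    · simp only [mul_assoc]
    · intro x
      rw [← h]
      refine integral_congr_ae (Eventually.of_forall fun t => ?_)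
      simp only
      rw [mul_comm (Complex.exp _) (w t), mul_assoc, ← Complex.exp_add]
      congr 2
      ring
  simp only [h3] at h2
  rw [h2]
  simp only [enorm_mul, mul_pow]

theorem continuous_inner_resolvent {ε : ℝ} (hε : 0 < ε) (u v : V) :
    (Continuous fun s : ℝ => inner ℂ u (E.integral (resolventFun (s + ε * Complex.I)) v)) ∧
      Continuous fun s : ℝ => inner ℂ u (E.integral (resolventFun (s - ε * Complex.I)) v) := by
  have hp : ∀ s : ℝ, (s + ε * Complex.I : ℂ).im ≠ 0 := fun s => by simpa using hε.ne'
  have hn : ∀ s : ℝ, (s - ε * Complex.I : ℂ).im ≠ 0 := fun s => by simpa using hε.ne'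
  constructor
  · refine E.continuous_inner_integral (C := ε⁻¹) (fun s => (bddMeas_resolventFun (hp s)).1)
      (fun s x => ?_) (fun x => ?_) u v
    · simpa [abs_of_pos hε] using norm_resolventFun_le (hp s) x
    · exact Continuous.inv₀ (by fun_prop) fun s => sub_ne_zero_of_im (hp s) x
  · refine E.continuous_inner_integral (C := ε⁻¹) (fun s => (bddMeas_resolventFun (hn s)).1)
      (fun s x => ?_) (fun x => ?_) u v
    · simpa [abs_of_pos hε] using norm_resolventFun_le (hn s) x
    · exact Continuous.inv₀ (by fun_prop) fun s => sub_ne_zero_of_im (hn s) x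

theorem integrable_indicator_exp_mul {S : Set ℝ} (hS : MeasurableSet S) {ε : ℝ} (hε : 0 < ε)
    (s x : ℝ) : Integrable fun t : ℝ =>
      S.indicator (fun t => ((Real.exp (-ε * |t|) : ℝ) : ℂ)) t *
        Complex.exp (Complex.I * (s - x) * t) := by
  refine ((integrable_exp_neg_mul_abs hε).ofReal.indicator hS).mul_bdd (c := 1)
    (Measurable.aestronglyMeasurable (by fun_prop)) (Eventually.of_forall fun t => ?_)
  rw [Complex.norm_exp]
  simp

theorem norm_indicator_exp_le (S : Set ℝ) (ε t : ℝ) :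
    ‖S.indicator (fun t => ((Real.exp (-ε * |t|) : ℝ) : ℂ)) t‖ ≤ Real.exp (-ε * |t|) := by
  refine (norm_indicator_le_norm_self _ _).trans (le_of_eq ?_)
  rw [Complex.norm_real, Real.norm_eq_abs, Real.abs_exp]

/-- Plancherel on each half-line; the supports being disjoint, the squared weights add up to the
square of the full weight. -/
theorem lintegral_inner_resolvent_add_sq {ε : ℝ} (hε : 0 < ε) (u v : V) :
    (∫⁻ s : ℝ, (‖inner ℂ u (E.integral (resolventFun (s + ε * Complex.I)) v)‖ₑ ^ 2 +
      ‖inner ℂ u (E.integral (resolventFun (s - ε * Complex.I)) v)‖ₑ ^ 2))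
      = ENNReal.ofReal (2 * Real.pi) *
        ∫⁻ t, ENNReal.ofReal (Real.exp (-ε * |t|)) ^ 2 * ‖inner ℂ u (E.unitary t v)‖ₑ ^ 2 := by
  have hp : ∀ s : ℝ, (s + ε * Complex.I : ℂ).im ≠ 0 := fun s => by simpa using hε.ne'
  have hn : ∀ s : ℝ, (s - ε * Complex.I : ℂ).im ≠ 0 := fun s => by simpa using hε.ne'
  have hm : ∀ S : Set ℝ, MeasurableSet S →
      Measurable (S.indicator fun t => ((Real.exp (-ε * |t|) : ℝ) : ℂ)) := fun S hS =>
    Measurable.indicator (by fun_prop) hS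
  have h1 := E.lintegral_inner_sq_of_weight (hm _ measurableSet_Ioi) hε
    (norm_indicator_exp_le _ ε) (fun s => (bddMeas_resolventFun (hp s)).const_smul (-Complex.I))
    (fun s x => weight_Ioi s x hε) u v
  have h2 := E.lintegral_inner_sq_of_weight (hm _ measurableSet_Iic) hε
    (norm_indicator_exp_le _ ε) (fun s => (bddMeas_resolventFun (hn s)).const_smul Complex.I)
    (fun s x => weight_Iic s x hε) u v
  have e1 : ∀ s : ℝ, ‖inner ℂ u (E.integral (-Complex.I • resolventFun (s + ε * Complex.I)) v)‖ₑ
      = ‖inner ℂ u (E.integral (resolventFun (s + ε * Complex.I)) v)‖ₑ := by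
    intro s
    rw [E.integral_smul (bddMeas_resolventFun (hp s)), smul_apply, inner_smul_right, enorm_mul]
    simp [← ofReal_norm]
  have e2 : ∀ s : ℝ, ‖inner ℂ u (E.integral (Complex.I • resolventFun (s - ε * Complex.I)) v)‖ₑ
      = ‖inner ℂ u (E.integral (resolventFun (s - ε * Complex.I)) v)‖ₑ := by
    intro s
    rw [E.integral_smul (bddMeas_resolventFun (hn s)), smul_apply, inner_smul_right, enorm_mul]
    simp [← ofReal_norm]
  simp only [e1] at h1
  simp only [e2] at h2
  have hmeas : Measurable fun s : ℝ =>
      ‖inner ℂ u (E.integral (resolventFun (s + ε * Complex.I)) v)‖ₑ ^ 2 :=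
    ((E.continuous_inner_resolvent hε u v).1.measurable).enorm.pow_const 2
  have hU := (E.continuous_inner_unitary u v).measurable
  have hmi := hm _ (measurableSet_Ioi (a := (0 : ℝ)))
  rw [lintegral_add_left hmeas, h1, h2, ← mul_add, ← lintegral_add_left (by fun_prop)]
  congr 1
  refine lintegral_congr fun t => ?_
  have e3 : ‖((Real.exp (-ε * |t|) : ℝ) : ℂ)‖ₑ = ENNReal.ofReal (Real.exp (-ε * |t|)) := by
    rw [← ofReal_norm, Complex.norm_real, Real.norm_eq_abs, Real.abs_exp]
  rcases lt_or_ge 0 t with ht | ht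
  · rw [Set.indicator_of_mem (Set.mem_Ioi.2 ht), Set.indicator_of_notMem (by simpa using ht), e3]
    simp
  · rw [Set.indicator_of_notMem (by simpa using ht), Set.indicator_of_mem (Set.mem_Iic.2 ht), e3]
    simp

/-- Since `-i r₊ + i r₋ = -i (r₊ - r₋)`, the jump is up to a phase the transform of the full weight.
Its integral therefore equals that of the sum of squares. -/
theorem lintegral_inner_resolvent_sub_sq {ε : ℝ} (hε : 0 < ε) (u v : V) :
    (∫⁻ s : ℝ, ‖inner ℂ u ((E.integral (resolventFun (s + ε * Complex.I)) -
      E.integral (resolventFun (s - ε * Complex.I))) v)‖ₑ ^ 2)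
      = ENNReal.ofReal (2 * Real.pi) *
        ∫⁻ t, ENNReal.ofReal (Real.exp (-ε * |t|)) ^ 2 * ‖inner ℂ u (E.unitary t v)‖ₑ ^ 2 := by
  have hp : ∀ s : ℝ, (s + ε * Complex.I : ℂ).im ≠ 0 := fun s => by simpa using hε.ne'
  have hn : ∀ s : ℝ, (s - ε * Complex.I : ℂ).im ≠ 0 := fun s => by simpa using hε.ne'
  have hbp := fun s : ℝ => (bddMeas_resolventFun (hp s)).const_smul (-Complex.I)
  have hbn := fun s : ℝ => (bddMeas_resolventFun (hn s)).const_smul Complex.I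
  have h1 := E.lintegral_inner_sq_of_weight (w := fun t => ((Real.exp (-ε * |t|) : ℝ) : ℂ))
    (by fun_prop) hε (fun t => by rw [Complex.norm_real, Real.norm_eq_abs, Real.abs_exp])
    (fun s => (hbp s).add (hbn s))
    (fun s x => by
      rw [Pi.add_apply, ← weight_Ioi s x hε, ← weight_Iic s x hε, ← MeasureTheory.integral_add
        (integrable_indicator_exp_mul measurableSet_Ioi hε s x)
        (integrable_indicator_exp_mul measurableSet_Iic hε s x)]
      refine integral_congr_ae (Eventually.of_forall fun t => ?_)
      rcases lt_or_ge 0 t with ht | ht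
      · simp only [Set.indicator_of_mem (Set.mem_Ioi.2 ht),
          Set.indicator_of_notMem (by simpa using ht : t ∉ Set.Iic 0), zero_mul, add_zero]
      · simp only [Set.indicator_of_notMem (by simpa using ht : t ∉ Set.Ioi 0),
          Set.indicator_of_mem (Set.mem_Iic.2 ht), zero_mul, zero_add]) u v
  have e1 : ∀ s : ℝ, ‖inner ℂ u (E.integral (-Complex.I • resolventFun (s + ε * Complex.I) +
      Complex.I • resolventFun (s - ε * Complex.I)) v)‖ₑ
      = ‖inner ℂ u ((E.integral (resolventFun (s + ε * Complex.I)) -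
        E.integral (resolventFun (s - ε * Complex.I))) v)‖ₑ := by
    intro s
    rw [E.integral_add (hbp s) (hbn s), E.integral_smul (bddMeas_resolventFun (hp s)),
      E.integral_smul (bddMeas_resolventFun (hn s)), neg_smul, neg_add_eq_sub, ← smul_sub,
      smul_apply, inner_smul_right, enorm_mul, ← neg_sub, neg_apply, inner_neg_right, enorm_neg]
    simp [← ofReal_norm, inner_sub_right]
  have e3 : ∀ t : ℝ, ‖((Real.exp (-ε * |t|) : ℝ) : ℂ)‖ₑ = ENNReal.ofReal (Real.exp (-ε * |t|)) := by
    intro t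
    rw [← ofReal_norm, Complex.norm_real, Real.norm_eq_abs, Real.abs_exp]
  simp only [e1, e3] at h1
  exact h1

end PVM

end KatoSmooth

/-! ### Poisson kernels and limits of integrals -/

namespace KatoSmooth

open Filter Topology

section Poisson

theorem enorm_resolventFun_sq (μ : ℂ) (x : ℝ) :
    ‖resolventFun μ x‖ₑ ^ 2 = ENNReal.ofReal (((x - μ.re) ^ 2 + μ.im ^ 2)⁻¹) := by
  rw [← ofReal_norm, ← ENNReal.ofReal_pow (norm_nonneg _), resolventFun, norm_inv, inv_pow,
    ← Complex.normSq_eq_norm_sq, Complex.normSq_apply]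
  congr 2
  simp
  ring

theorem inv_sq_add_sq {ε : ℝ} (hε : 0 < ε) (y : ℝ) :
    (y ^ 2 + ε ^ 2)⁻¹ = (ε ^ 2)⁻¹ * (1 + (y / ε) ^ 2)⁻¹ := by
  rw [← mul_inv]
  congr 1
  field_simp
  ring

theorem lintegral_inv_sq_add_sq {ε : ℝ} (hε : 0 < ε) (a : ℝ) :
    ∫⁻ x : ℝ, ENNReal.ofReal (((x - a) ^ 2 + ε ^ 2)⁻¹) = ENNReal.ofReal (Real.pi / ε) := by
  have h1 : Integrable fun x : ℝ => ((x - a) ^ 2 + ε ^ 2)⁻¹ := by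
    have h2 := ((integrable_inv_one_add_sq.comp_div hε.ne').comp_sub_right a).const_mul (ε ^ 2)⁻¹
    refine h2.congr (Eventually.of_forall fun x => ?_)
    exact (inv_sq_add_sq hε _).symm
  rw [← ofReal_integral_eq_lintegral_ofReal h1 (Eventually.of_forall fun x => by positivity)]
  congr 1
  simp only [inv_sq_add_sq hε]
  rw [integral_const_mul, integral_sub_right_eq_self (fun x => (1 + (x / ε) ^ 2)⁻¹),
    Measure.integral_comp_div (fun x => (1 + x ^ 2)⁻¹), integral_univ_inv_one_add_sq, smul_eq_mul,
    abs_of_pos hε]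
  field_simp

theorem lintegral_Ioo_inv_sq_add_sq {ε : ℝ} (hε : 0 < ε) (x : ℝ) {a b : ℝ} (hab : a < b) :
    ∫⁻ s in Set.Ioo a b, ENNReal.ofReal (((x - s) ^ 2 + ε ^ 2)⁻¹)
      = ENNReal.ofReal ((Real.arctan ((b - x) / ε) - Real.arctan ((a - x) / ε)) / ε) := by
  have hc : Continuous fun s : ℝ => ((x - s) ^ 2 + ε ^ 2)⁻¹ :=
    Continuous.inv₀ (by fun_prop) fun s => by positivity
  have hi : IntegrableOn (fun s : ℝ => ((x - s) ^ 2 + ε ^ 2)⁻¹) (Set.Ioo a b) :=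
    (hc.integrableOn_Icc (a := a) (b := b)).mono_set Set.Ioo_subset_Icc_self
  rw [← ofReal_integral_eq_lintegral_ofReal hi (Eventually.of_forall fun s => by positivity),
    ← integral_Ioc_eq_integral_Ioo, ← intervalIntegral.integral_of_le hab.le]
  congr 1
  have hd : ∀ s ∈ Set.uIcc a b, HasDerivAt (fun s => Real.arctan ((s - x) / ε) / ε)
      (((x - s) ^ 2 + ε ^ 2)⁻¹) s := by
    intro s _
    have h1 : HasDerivAt (fun s => (s - x) / ε) (1 / ε) s :=
      ((hasDerivAt_id s).sub_const x).div_const ε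
    have h2 := (h1.arctan).div_const ε
    refine h2.congr_deriv ?_
    rw [show (x - s) ^ 2 = (s - x) ^ 2 by ring, inv_sq_add_sq hε]
    ring
  rw [intervalIntegral.integral_eq_sub_of_hasDerivAt hd (hc.intervalIntegrable _ _)]
  ring

/-- A measure dominated by a multiple of Lebesgue measure on intervals has bounded Poisson
integrals. -/
theorem lintegral_inv_sq_add_sq_le {ν : Measure ℝ} {c : ℝ≥0∞} (hc : c ≠ ⊤)
    (h : ∀ a b : ℝ, a < b → ν (Set.Ioo a b) ≤ c * ENNReal.ofReal (b - a)) {ε : ℝ} (hε : 0 < ε)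
    (a : ℝ) : ∫⁻ x, ENNReal.ofReal (((x - a) ^ 2 + ε ^ 2)⁻¹) ∂ν ≤ c * ENNReal.ofReal (Real.pi / ε) := by
  have hm : Measurable fun x : ℝ => ((x - a) ^ 2 + ε ^ 2)⁻¹ := by fun_prop
  have hnn : ∀ x : ℝ, 0 ≤ ((x - a) ^ 2 + ε ^ 2)⁻¹ := fun x => by positivity
  rw [← lintegral_inv_sq_add_sq hε a,
    lintegral_eq_lintegral_meas_lt ν (Eventually.of_forall hnn) hm.aemeasurable,
    lintegral_eq_lintegral_meas_lt volume (Eventually.of_forall hnn) hm.aemeasurable,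
    ← lintegral_const_mul' _ _ hc]
  -- Layer cake for both measures: each superlevel set of the kernel is empty or an open interval
  -- centred at `a`, where the hypothesis applies.
  refine setLIntegral_mono' measurableSet_Ioi fun t ht => ?_
  have ht' : 0 < t := ht
  have hset : {x : ℝ | t < ((x - a) ^ 2 + ε ^ 2)⁻¹} = {x : ℝ | (x - a) ^ 2 < t⁻¹ - ε ^ 2} := by
    ext x
    simp only [Set.mem_ofPred_eq]
    rw [lt_inv_comm₀ ht' (by positivity), lt_sub_iff_add_lt]
  rw [hset]
  rcases le_or_gt (t⁻¹ - ε ^ 2) 0 with hd | hd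
  · have hempty : {x : ℝ | (x - a) ^ 2 < t⁻¹ - ε ^ 2} = ∅ := by
      ext x
      simp only [Set.mem_ofPred_eq, Set.mem_empty_iff_false, iff_false, not_lt]
      exact hd.trans (sq_nonneg _)
    rw [hempty]
    simp
  · have hIoo : {x : ℝ | (x - a) ^ 2 < t⁻¹ - ε ^ 2}
        = Set.Ioo (a - √(t⁻¹ - ε ^ 2)) (a + √(t⁻¹ - ε ^ 2)) := by
      ext x
      simp only [Set.mem_ofPred_eq, Set.mem_Ioo]
      rw [← sq_abs, ← Real.lt_sqrt (abs_nonneg _), abs_lt]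
      constructor <;> rintro ⟨h1, h2⟩ <;> constructor <;> linarith
    have hs : 0 < √(t⁻¹ - ε ^ 2) := Real.sqrt_pos.2 hd
    rw [hIoo, Real.volume_Ioo]
    exact h _ _ (by linarith)

theorem tendsto_arctan_sub {a b x : ℝ} (hx : x ∈ Set.Ioo a b) {ε : ℕ → ℝ} (hε : ∀ n, 0 < ε n)
    (hlim : Tendsto ε atTop (𝓝 0)) :
    Tendsto (fun n => Real.arctan ((b - x) / ε n) - Real.arctan ((a - x) / ε n)) atTop
      (𝓝 Real.pi) := by
  have h0 : Tendsto (fun n => (ε n)⁻¹) atTop atTop :=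
    tendsto_inv_nhdsGT_zero.comp (tendsto_nhdsWithin_iff.2 ⟨hlim, Eventually.of_forall hε⟩)
  have h1 : Tendsto (fun n => (b - x) / ε n) atTop atTop :=
    h0.const_mul_atTop (sub_pos.2 hx.2)
  have h2 : Tendsto (fun n => (a - x) / ε n) atTop atBot :=
    h0.const_mul_atTop_of_neg (sub_neg.2 hx.1)
  have h3 := (tendsto_nhds_of_tendsto_nhdsWithin (Real.tendsto_arctan_atTop.comp h1)).sub
    (tendsto_nhds_of_tendsto_nhdsWithin (Real.tendsto_arctan_atBot.comp h2))
  rw [show Real.pi = Real.pi / 2 - -(Real.pi / 2) by ring]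
  exact h3

theorem sq_lintegral_le {α : Type*} [MeasurableSpace α] {ν : Measure α} {f : α → ℝ≥0∞}
    (hf : AEMeasurable f ν) : (∫⁻ x, f x ∂ν) ^ 2 ≤ ν Set.univ * ∫⁻ x, f x ^ 2 ∂ν := by
  have h1 := ENNReal.lintegral_mul_le_Lp_mul_Lq ν (p := 2) (q := 2) .two_two hf
    (aemeasurable_const (b := (1 : ℝ≥0∞)))
  simp only [Pi.mul_apply, mul_one, ENNReal.rpow_two, one_pow, lintegral_const, one_mul] at h1
  have h2 : ∀ y : ℝ≥0∞, (y ^ (1 / 2 : ℝ)) ^ 2 = y := fun y => by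
    rw [← ENNReal.rpow_two, ← ENNReal.rpow_mul]; norm_num
  calc (∫⁻ x, f x ∂ν) ^ 2 ≤ ((∫⁻ x, f x ^ 2 ∂ν) ^ (1 / 2 : ℝ) * ν Set.univ ^ (1 / 2 : ℝ)) ^ 2 := by
        gcongr
    _ = _ := by rw [mul_pow, h2, h2, mul_comm]

/-- The weight is at most `1`, and Fatou's lemma along `ε = 1/(n+1)` gives the other inequality,
with no finiteness assumption on `F`. -/
theorem iSup_lintegral_exp_weight {F : ℝ → ℝ≥0∞} (hF : Measurable F) :
    ⨆ (ε : ℝ) (_ : 0 < ε), ∫⁻ t, ENNReal.ofReal (Real.exp (-ε * |t|)) ^ 2 * F t = ∫⁻ t, F t := by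
  refine le_antisymm (iSup₂_le fun ε hε => lintegral_mono fun t => ?_) ?_
  · have h1 : ENNReal.ofReal (Real.exp (-ε * |t|)) ≤ 1 := by
      rw [← ENNReal.ofReal_one]
      refine ENNReal.ofReal_le_ofReal (Real.exp_le_one_iff.2 ?_)
      have := mul_nonneg hε.le (abs_nonneg t)
      linarith
    calc ENNReal.ofReal (Real.exp (-ε * |t|)) ^ 2 * F t ≤ 1 ^ 2 * F t := by gcongr
      _ = F t := by simp
  · have hlim : Tendsto (fun n : ℕ => 1 / ((n : ℝ) + 1)) atTop (𝓝 0) :=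
      tendsto_one_div_add_atTop_nhds_zero_nat
    have h1 : ∀ t, Tendsto (fun n : ℕ =>
        ENNReal.ofReal (Real.exp (-(1 / ((n : ℝ) + 1)) * |t|)) ^ 2 * F t) atTop (𝓝 (F t)) := by
      intro t
      have h2 : Tendsto (fun n : ℕ => Real.exp (-(1 / ((n : ℝ) + 1)) * |t|)) atTop (𝓝 1) := by
        have h3 := (Real.continuous_exp.tendsto _).comp ((hlim.neg).mul_const |t|)
        simp only [neg_zero, zero_mul, Real.exp_zero] at h3
        exact h3
      have h4 := ENNReal.Tendsto.pow (n := 2) (ENNReal.tendsto_ofReal h2)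
      have h5 := ENNReal.Tendsto.mul_const (b := F t) h4 (Or.inl (by simp))
      simpa using h5
    calc ∫⁻ t, F t = ∫⁻ t, liminf (fun n : ℕ =>
          ENNReal.ofReal (Real.exp (-(1 / ((n : ℝ) + 1)) * |t|)) ^ 2 * F t) atTop :=
          lintegral_congr fun t => (h1 t).liminf_eq.symm
      _ ≤ liminf (fun n : ℕ => ∫⁻ t,
          ENNReal.ofReal (Real.exp (-(1 / ((n : ℝ) + 1)) * |t|)) ^ 2 * F t) atTop :=
          lintegral_liminf_le fun n => by fun_prop
      _ ≤ _ := by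
        refine liminf_le_of_le (by isBoundedDefault) fun y hy => ?_
        obtain ⟨n, hn⟩ := hy.exists
        exact hn.trans (le_iSup₂ (f := fun (ε : ℝ) (_ : 0 < ε) =>
          ∫⁻ t, ENNReal.ofReal (Real.exp (-ε * |t|)) ^ 2 * F t) (1 / ((n : ℝ) + 1)) (by positivity))

end Poisson

end KatoSmooth

/-! ### Resolvent integrals, time integrals and resolvent norms -/

namespace KatoSmooth

open Filter Topology

variable {V : Type*} [NormedAddCommGroup V] [InnerProductSpace ℂ V] [CompleteSpace V]
  {H A : V →ₗ.[ℂ] V}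

theorem measurable_extNorm_unitary [TopologicalSpace.SeparableSpace V] (hA : A.IsClosed)
    (hAd : Dense (A.domain : Set V)) (E : PVM V) (v : V) :
    Measurable fun t => extNorm A (E.unitary t v) ^ 2 := by
  obtain ⟨s, e, -, he⟩ := exists_orthonormal_extNorm_sq hA hAd
  simp only [he]
  refine Measurable.tsum fun j => ?_
  exact (E.continuous_inner_unitary _ _).measurable.enorm.pow_const 2

/-- The scalar identities are summed over the orthonormal family; all terms are nonnegative, so sums
and integrals commute and infinite values are allowed. -/
theorem lintegral_extNorm_resolvent_add_sq [TopologicalSpace.SeparableSpace V] (hA : A.IsClosed)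
    (hAd : Dense (A.domain : Set V)) (E : PVM V) {ε : ℝ} (hε : 0 < ε) (v : V) :
    ∫⁻ s : ℝ, (extNorm A (E.integral (resolventFun (s + ε * Complex.I)) v) ^ 2 +
        extNorm A (E.integral (resolventFun (s - ε * Complex.I)) v) ^ 2)
      = ENNReal.ofReal (2 * Real.pi) *
        ∫⁻ t, ENNReal.ofReal (Real.exp (-ε * |t|)) ^ 2 * extNorm A (E.unitary t v) ^ 2 := by
  obtain ⟨s, e, -, he⟩ := exists_orthonormal_extNorm_sq hA hAd
  simp only [he, ← ENNReal.tsum_add, ← ENNReal.tsum_mul_left]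
  rw [lintegral_tsum, lintegral_tsum, ← ENNReal.tsum_mul_left]
  · exact tsum_congr fun j => E.lintegral_inner_resolvent_add_sq hε _ v
  · intro j
    have := (E.continuous_inner_unitary (A.adjoint (e j)) v).measurable
    fun_prop
  · intro j
    have h1 := (E.continuous_inner_resolvent hε (A.adjoint (e j)) v).1.measurable
    have h2 := (E.continuous_inner_resolvent hε (A.adjoint (e j)) v).2.measurable
    exact ((h1.enorm.pow_const 2).add (h2.enorm.pow_const 2)).aemeasurable

theorem lintegral_extNorm_resolvent_sub_sq [TopologicalSpace.SeparableSpace V] (hA : A.IsClosed)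
    (hAd : Dense (A.domain : Set V)) (E : PVM V) {ε : ℝ} (hε : 0 < ε) (v : V) :
    ∫⁻ s : ℝ, extNorm A ((E.integral (resolventFun (s + ε * Complex.I)) -
        E.integral (resolventFun (s - ε * Complex.I))) v) ^ 2
      = ENNReal.ofReal (2 * Real.pi) *
        ∫⁻ t, ENNReal.ofReal (Real.exp (-ε * |t|)) ^ 2 * extNorm A (E.unitary t v) ^ 2 := by
  obtain ⟨s, e, -, he⟩ := exists_orthonormal_extNorm_sq hA hAd
  simp only [he, ← ENNReal.tsum_mul_left]
  rw [lintegral_tsum, lintegral_tsum, ← ENNReal.tsum_mul_left]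
  · exact tsum_congr fun j => E.lintegral_inner_resolvent_sub_sq hε _ v
  · intro j
    have := (E.continuous_inner_unitary (A.adjoint (e j)) v).measurable
    fun_prop
  · intro j
    have h1 := (E.continuous_inner_resolvent hε (A.adjoint (e j)) v).1
    have h2 := (E.continuous_inner_resolvent hε (A.adjoint (e j)) v).2
    simp only [sub_apply, inner_sub_right]
    exact ((h1.sub h2).measurable.enorm.pow_const 2).aemeasurable

theorem im_add_mul_I_ne_zero {ε : ℝ} (hε : 0 < ε) (s : ℝ) : (s + ε * Complex.I : ℂ).im ≠ 0 := by
  simpa using hε.ne'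

theorem im_sub_mul_I_ne_zero {ε : ℝ} (hε : 0 < ε) (s : ℝ) : (s - ε * Complex.I : ℂ).im ≠ 0 := by
  simpa using hε.ne'

/-- The equality holds for each `φ` separately: for fixed `ε` by Plancherel, then by the supremum
over `ε`. The constants agree because `2π / (4π²) = 1 / (2π)`. -/
theorem resolventIntegralSup_eq_timeIntegralSup [TopologicalSpace.SeparableSpace V]
    (hH : IsSelfAdjoint H) (hA : A.IsClosed) (hAd : Dense (A.domain : Set V)) :
    resolventIntegralSup H A = timeIntegralSup H A := by
  have hE := isResolutionOf_spectralResolution hH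
  set E := spectralResolution H with hEdef
  refine iSup_congr fun φ => iSup_congr fun _ => ?_
  have hev : ∀ t, evolution H t φ = E.unitary t φ := fun t => rfl
  simp only [hev]
  rw [← iSup_lintegral_exp_weight (measurable_extNorm_unitary hA hAd E φ)]
  simp only [ENNReal.mul_iSup]
  refine iSup_congr fun ε => iSup_congr fun hε => ?_
  have h1 : ∀ s : ℝ, resolventOp H (s + ε * Complex.I)
      = E.integral (resolventFun (s + ε * Complex.I)) := fun s =>
    resolventOp_eq_integral hH hE (im_add_mul_I_ne_zero hε s)
  have h2 : ∀ s : ℝ, resolventOp H (s - ε * Complex.I)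
      = E.integral (resolventFun (s - ε * Complex.I)) := fun s =>
    resolventOp_eq_integral hH hE (im_sub_mul_I_ne_zero hε s)
  simp only [h1, h2]
  rw [lintegral_extNorm_resolvent_add_sq hA hAd E hε, ← mul_assoc,
    ← ENNReal.ofReal_mul (by positivity)]
  congr 2
  have := Real.pi_ne_zero
  field_simp
  norm_num

theorem inner_resolvent_sub_resolvent (hH : IsSelfAdjoint H) {μ : ℂ} (hμ : μ.im ≠ 0) (v : V) :
    inner ℂ v ((resolventOp H μ - resolventOp H (starRingEnd ℂ μ)) v)
      = (μ - starRingEnd ℂ μ) * ((‖resolventOp H μ v‖ ^ 2 : ℝ) : ℂ) := by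
  have hN := isResolventAt_resolventOp hH hμ
  have hM := isResolventAt_resolventOp hH (μ := starRingEnd ℂ μ) (by simpa using hμ)
  rw [hN.sub_eq hM, ← hN.adjoint_eq hH hM, ContinuousLinearMap.star_eq_adjoint, smul_apply,
    inner_smul_right]
  congr 1
  change inner ℂ v (ContinuousLinearMap.adjoint (resolventOp H μ) (resolventOp H μ v)) = _
  rw [ContinuousLinearMap.adjoint_inner_right, inner_self_eq_norm_sq_to_K]
  push_cast
  rfl

theorem norm_inner_resolvent_sub_resolvent (hH : IsSelfAdjoint H) {μ : ℂ} (hμ : μ.im ≠ 0) (v : V) :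
    ‖inner ℂ v ((resolventOp H μ - resolventOp H (starRingEnd ℂ μ)) v)‖
      = 2 * |μ.im| * ‖resolventOp H μ v‖ ^ 2 := by
  rw [inner_resolvent_sub_resolvent hH hμ, norm_mul, Complex.sub_conj, Complex.norm_real,
    norm_mul, Complex.norm_I, mul_one, Complex.norm_real, Real.norm_eq_abs, Real.norm_eq_abs,
    abs_mul, abs_two, abs_of_nonneg (by positivity : 0 ≤ ‖resolventOp H μ v‖ ^ 2)]

theorem resolventDiffSup_eq_resolventNormSup (hH : IsSelfAdjoint H) :
    resolventDiffSup H A = resolventNormSup H A := by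
  refine iSup_congr fun φ => iSup_congr fun _ => iSup_congr fun μ => iSup_congr fun hμ => ?_
  rw [norm_inner_resolvent_sub_resolvent hH hμ]
  congr 1
  have := Real.pi_ne_zero
  field_simp

theorem ofReal_norm_resolvent_sq (hH : IsSelfAdjoint H) {μ : ℂ} (hμ : μ.im ≠ 0) (v : V) :
    ENNReal.ofReal (‖resolventOp H μ v‖ ^ 2)
      = ∫⁻ x, ENNReal.ofReal (((x - μ.re) ^ 2 + |μ.im| ^ 2)⁻¹)
          ∂((spectralResolution H).scalarMeasure v) := by
  rw [resolventOp_eq_integral hH (isResolutionOf_spectralResolution hH) hμ,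
    PVM.ofReal_norm_integral_sq _ (bddMeas_resolventFun hμ)]
  simp only [enorm_resolventFun_sq, sq_abs]

/-- The supremum on the right bounds the spectral measure of `A* φ` by a multiple of length on
intervals; a Poisson kernel of width `|Im μ|` has Lebesgue integral `π / |Im μ|`. -/
theorem resolventNormSup_le_spectralProjSup (hH : IsSelfAdjoint H) :
    resolventNormSup H A ≤ spectralProjSup H A := by
  by_cases hc : spectralProjSup H A = ⊤
  · rw [hc]; exact le_top
  refine iSup_le fun φ => iSup_le fun hφ => iSup_le fun μ => iSup_le fun hμ => ?_
  have him : 0 < |μ.im| := abs_pos.2 hμ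
  have h1 : ∀ a b : ℝ, a < b → (spectralResolution H).scalarMeasure (A.adjoint φ) (Set.Ioo a b)
      ≤ spectralProjSup H A * ENNReal.ofReal (b - a) := by
    intro a b hab
    have h2 : ENNReal.ofReal (‖spectralProj H (Set.Ioo a b) (A.adjoint φ)‖ ^ 2 / (b - a))
        ≤ spectralProjSup H A :=
      le_iSup_of_le φ (le_iSup_of_le hφ (le_iSup_of_le a (le_iSup_of_le b (le_iSup_of_le hab le_rfl))))
    rw [PVM.scalarMeasure_apply _ _ measurableSet_Ioo]
    have hba : 0 < b - a := sub_pos.2 hab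
    calc ENNReal.ofReal (‖spectralProj H (Set.Ioo a b) (A.adjoint φ)‖ ^ 2)
        = ENNReal.ofReal (‖spectralProj H (Set.Ioo a b) (A.adjoint φ)‖ ^ 2 / (b - a)) *
          ENNReal.ofReal (b - a) := by
          rw [← ENNReal.ofReal_mul (by positivity), div_mul_cancel₀ _ hba.ne']
      _ ≤ _ := by gcongr
  have h3 := lintegral_inv_sq_add_sq_le hc h1 him μ.re
  rw [← ofReal_norm_resolvent_sq hH hμ] at h3
  calc ENNReal.ofReal (1 / Real.pi * ‖resolventOp H μ (A.adjoint φ)‖ ^ 2 * |μ.im|)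
      = ENNReal.ofReal (|μ.im| / Real.pi) *
        ENNReal.ofReal (‖resolventOp H μ (A.adjoint φ)‖ ^ 2) := by
        rw [← ENNReal.ofReal_mul (by positivity)]
        congr 1
        ring
    _ ≤ ENNReal.ofReal (|μ.im| / Real.pi) *
        (spectralProjSup H A * ENNReal.ofReal (Real.pi / |μ.im|)) := by gcongr
    _ = spectralProjSup H A := by
        rw [mul_left_comm, ← ENNReal.ofReal_mul (by positivity)]
        have h4 : |μ.im| / Real.pi * (Real.pi / |μ.im|) = 1 := by
          have := Real.pi_ne_zero
          field_simp
        rw [h4, ENNReal.ofReal_one, mul_one]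

/-- The duality between bounds for `R(μ) A*` and for `A R(μ)`. -/
theorem extNorm_resolvent_le (hH : IsSelfAdjoint H) (hA : A.IsClosed)
    (hAd : Dense (A.domain : Set V)) (hfin : resolventNormSup H A ≠ ⊤) {μ : ℂ} (hμ : μ.im ≠ 0)
    (w : V) : extNorm A (resolventOp H μ w) ^ 2
      ≤ ENNReal.ofReal (Real.pi * (resolventNormSup H A).toReal / |μ.im| * ‖w‖ ^ 2) := by
  set c := (resolventNormSup H A).toReal with hc
  have hc0 : 0 ≤ c := ENNReal.toReal_nonneg
  have him : 0 < |μ.im| := abs_pos.2 hμ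
  have hμ' : ((starRingEnd ℂ) μ).im ≠ 0 := by simpa using hμ
  have hadj := (isResolventAt_resolventOp hH hμ).adjoint_eq hH (isResolventAt_resolventOp hH hμ')
  have hunit : ∀ φ : A.adjoint.domain, ‖(φ : V)‖ = 1 →
      ‖resolventOp H ((starRingEnd ℂ) μ) (A.adjoint φ)‖ ^ 2 ≤ Real.pi * c / |μ.im| := by
    intro φ hφ
    have h1 : ENNReal.ofReal (1 / Real.pi * ‖resolventOp H ((starRingEnd ℂ) μ) (A.adjoint φ)‖ ^ 2 *
        |((starRingEnd ℂ) μ).im|) ≤ resolventNormSup H A :=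
      le_iSup_of_le φ (le_iSup_of_le hφ (le_iSup_of_le _ (le_iSup_of_le hμ' le_rfl)))
    rw [ENNReal.ofReal_le_iff_le_toReal hfin, ← hc, Complex.conj_im, abs_neg] at h1
    rw [le_div_iff₀ him]
    have hpi := Real.pi_pos
    calc _ = Real.pi * (1 / Real.pi * ‖resolventOp H ((starRingEnd ℂ) μ) (A.adjoint φ)‖ ^ 2 *
          |μ.im|) := by field_simp
      _ ≤ Real.pi * c := by gcongr
  have hall : ∀ φ : A.adjoint.domain,
      ‖resolventOp H ((starRingEnd ℂ) μ) (A.adjoint φ)‖ ≤ √(Real.pi * c / |μ.im|) * ‖(φ : V)‖ := by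
    intro φ
    by_cases hφ : φ = 0
    · have h0 : A.adjoint φ = 0 := by rw [hφ]; exact map_zero A.adjoint.toFun
      rw [h0, map_zero, norm_zero]
      positivity
    have hn : ‖(φ : V)‖ ≠ 0 := by simpa using hφ
    have h1 := hunit (((‖(φ : V)‖⁻¹ : ℝ) : ℂ) • φ) (by
      rw [Submodule.coe_smul, norm_smul, Complex.norm_real, norm_inv, norm_norm, inv_mul_cancel₀ hn])
    have h2 : A.adjoint (((‖(φ : V)‖⁻¹ : ℝ) : ℂ) • φ) = ((‖(φ : V)‖⁻¹ : ℝ) : ℂ) • A.adjoint φ :=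
      map_smul A.adjoint.toFun _ _
    rw [h2, map_smul, norm_smul, Complex.norm_real, norm_inv, norm_norm] at h1
    have h3 := Real.le_sqrt_of_sq_le h1
    rwa [inv_mul_le_iff₀ (lt_of_le_of_ne (norm_nonneg _) (Ne.symm hn)), mul_comm] at h3
  -- `⟨A*φ, R(μ)w⟩ = ⟨R(μ̄)A*φ, w⟩`, which also forces `R(μ)w` into `D(A)`.
  have h4 := extNorm_le_of_inner_adjoint hA hAd (v := resolventOp H μ w)
    (K := √(Real.pi * c / |μ.im|) * ‖w‖) (by positivity) (fun φ => by
      rw [← ContinuousLinearMap.adjoint_inner_left, ← ContinuousLinearMap.star_eq_adjoint, hadj]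
      refine (norm_inner_le_norm _ _).trans ?_
      calc _ ≤ √(Real.pi * c / |μ.im|) * ‖(φ : V)‖ * ‖w‖ := by gcongr; exact hall φ
        _ = _ := by ring)
  calc extNorm A (resolventOp H μ w) ^ 2 ≤ ENNReal.ofReal (√(Real.pi * c / |μ.im|) * ‖w‖) ^ 2 := by
        gcongr
    _ = _ := by
        rw [← ENNReal.ofReal_pow (by positivity), mul_pow, Real.sq_sqrt (by positivity)]

/-- By Tonelli: integrating the kernel in `s` gives `π/ε` at every spectral point `x`. -/
theorem lintegral_norm_resolvent_sq (hH : IsSelfAdjoint H) {ε : ℝ} (hε : 0 < ε) (v : V) :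
    ∫⁻ s : ℝ, ENNReal.ofReal (‖resolventOp H (s + ε * Complex.I) v‖ ^ 2)
      = ENNReal.ofReal (Real.pi / ε * ‖v‖ ^ 2) := by
  have h1 : ∀ s : ℝ, ENNReal.ofReal (‖resolventOp H (s + ε * Complex.I) v‖ ^ 2)
      = ∫⁻ x, ENNReal.ofReal (((s - x) ^ 2 + ε ^ 2)⁻¹)
        ∂((spectralResolution H).scalarMeasure v) := by
    intro s
    rw [ofReal_norm_resolvent_sq hH (im_add_mul_I_ne_zero hε s)]
    refine lintegral_congr fun x => ?_
    congr 2
    simp [abs_of_pos hε]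
    ring
  simp only [h1]
  rw [lintegral_lintegral_swap (Measurable.aemeasurable (by fun_prop))]
  simp only [lintegral_inv_sq_add_sq hε]
  rw [lintegral_const, PVM.scalarMeasure_univ, ← ENNReal.ofReal_mul (by positivity)]

/-- The jump is `2iε R(s - iε) R(s + iε)`. Duality bounds `A R(s - iε)` uniformly in `s`, and the
other factor is square integrable in `s`. The powers of `ε` cancel: `(2ε)² · (πc/ε) · (π/ε) = 4π²c`.
-/
theorem timeIntegralSup_le_resolventNormSup [TopologicalSpace.SeparableSpace V]
    (hH : IsSelfAdjoint H) (hA : A.IsClosed) (hAd : Dense (A.domain : Set V)) :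
    timeIntegralSup H A ≤ resolventNormSup H A := by
  by_cases hfin : resolventNormSup H A = ⊤
  · rw [hfin]; exact le_top
  have hE := isResolutionOf_spectralResolution hH
  set E := spectralResolution H with hEdef
  set c := (resolventNormSup H A).toReal with hc
  have hc0 : 0 ≤ c := ENNReal.toReal_nonneg
  refine iSup_le fun φ => iSup_le fun hφ => ?_
  have hev : ∀ t, evolution H t φ = E.unitary t φ := fun t => rfl
  simp only [hev]
  rw [← iSup_lintegral_exp_weight (measurable_extNorm_unitary hA hAd E φ)]
  simp only [ENNReal.mul_iSup]
  refine iSup_le fun ε => iSup_le fun hε => ?_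
  have hpi := Real.pi_pos
  have hbound : ENNReal.ofReal (2 * Real.pi) *
      ∫⁻ t, ENNReal.ofReal (Real.exp (-ε * |t|)) ^ 2 * extNorm A (E.unitary t φ) ^ 2
      ≤ ENNReal.ofReal (4 * Real.pi ^ 2 * c) := by
    rw [← lintegral_extNorm_resolvent_sub_sq hA hAd E hε]
    have h1 : ∀ s : ℝ, extNorm A ((E.integral (resolventFun (s + ε * Complex.I)) -
        E.integral (resolventFun (s - ε * Complex.I))) φ) ^ 2
        ≤ ENNReal.ofReal (4 * Real.pi * c * ε) *
          ENNReal.ofReal (‖resolventOp H (s + ε * Complex.I) φ‖ ^ 2) := by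
      intro s
      have hp := im_add_mul_I_ne_zero hε s
      have hn := im_sub_mul_I_ne_zero hε s
      rw [← resolventOp_eq_integral hH hE hp, ← resolventOp_eq_integral hH hE hn,
        (isResolventAt_resolventOp hH hp).sub_eq (isResolventAt_resolventOp hH hn)]
      have h2 : ((s + ε * Complex.I - (s - ε * Complex.I) : ℂ) •
          (resolventOp H (s - ε * Complex.I) * resolventOp H (s + ε * Complex.I))) φ
          = resolventOp H (s - ε * Complex.I)
            ((2 * ε * Complex.I : ℂ) • resolventOp H (s + ε * Complex.I) φ) := by
        rw [map_smul, smul_apply]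
        congr 1
        ring
      rw [h2]
      refine (extNorm_resolvent_le hH hA hAd hfin hn _).trans ?_
      rw [← ENNReal.ofReal_mul (by positivity)]
      refine ENNReal.ofReal_le_ofReal (le_of_eq ?_)
      have h3 : |(s - ε * Complex.I : ℂ).im| = ε := by simp [abs_of_pos hε]
      have h4 : ‖(2 * ε * Complex.I : ℂ)‖ = 2 * ε := by simp [abs_of_pos hε]
      rw [h3, norm_smul, h4, ← hc]
      field_simp
      ring
    refine (lintegral_mono h1).trans ?_
    rw [lintegral_const_mul' _ _ ENNReal.ofReal_ne_top, lintegral_norm_resolvent_sq hH hε, hφ,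
      ← ENNReal.ofReal_mul (by positivity)]
    refine ENNReal.ofReal_le_ofReal (le_of_eq ?_)
    field_simp
  calc _ = ENNReal.ofReal (1 / (4 * Real.pi ^ 2)) * (ENNReal.ofReal (2 * Real.pi) *
        ∫⁻ t, ENNReal.ofReal (Real.exp (-ε * |t|)) ^ 2 * extNorm A (E.unitary t φ) ^ 2) := by
        rw [← mul_assoc, ← ENNReal.ofReal_mul (by positivity)]
        congr 2
        field_simp
        norm_num
    _ ≤ ENNReal.ofReal (1 / (4 * Real.pi ^ 2)) * ENNReal.ofReal (4 * Real.pi ^ 2 * c) := by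
        gcongr
    _ = ENNReal.ofReal c := by
        rw [← ENNReal.ofReal_mul (by positivity)]
        congr 1
        field_simp
    _ = resolventNormSup H A := ENNReal.ofReal_toReal hfin

end KatoSmooth

/-! ### Stone's formula and the spectral projections -/

namespace KatoSmooth

open Filter Topology

variable {V : Type*} [NormedAddCommGroup V] [InnerProductSpace ℂ V] [CompleteSpace V]
  {H A : V →ₗ.[ℂ] V}

/-- `E(S)` commutes with `∫ f dE` and is a self-adjoint idempotent. This allows `A*φ` to be replaced
by its projection in the left slot. -/
theorem PVM.inner_integral_proj (E : PVM V) {f : ℝ → ℂ} (hf : BddMeas f) {S : Set ℝ}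
    (hS : MeasurableSet S) (v : V) :
    inner ℂ v (E.integral f (E.proj S v)) = inner ℂ (E.proj S v) (E.integral f (E.proj S v)) := by
  have hb : BddMeas (S.indicator fun _ => (1 : ℂ)) := bddMeas_indicator hS
  have h1 : E.integral f * E.proj S = E.proj S * (E.integral f * E.proj S) := by
    rw [← E.integral_indicator hS, ← E.integral_mul hf hb, ← E.integral_mul hb (hf.mul hb)]
    congr 1
    ext x
    by_cases hx : x ∈ S <;> simp [hx]
  have h2 : E.integral f (E.proj S v) = E.proj S (E.integral f (E.proj S v)) :=
    congrArg (fun B : V →L[ℂ] V => B v) h1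
  conv_lhs => rw [h2, ← ContinuousLinearMap.adjoint_inner_left,
    ContinuousLinearMap.isSelfAdjoint_iff'.mp (E.isStarProjection S hS).isSelfAdjoint]

theorem PVM.ae_mem_scalarMeasure_proj (E : PVM V) {S : Set ℝ} (hS : MeasurableSet S) (v : V) :
    ∀ᵐ x ∂(E.scalarMeasure (E.proj S v)), x ∈ S := by
  have h1 : E.proj Sᶜ (E.proj S v) = 0 := by
    have h3 := E.proj_inter Sᶜ S hS.compl hS
    rw [Set.compl_inter_self, E.proj_empty] at h3
    exact (congrArg (fun B : V →L[ℂ] V => B v) h3).symm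
  have h2 : E.scalarMeasure (E.proj S v) Sᶜ = 0 := by
    rw [E.scalarMeasure_apply _ hS.compl, h1]
    simp
  exact h2

/-- The square integrated over the line of the resolvent jump is controlled by the time integral. -/
theorem lintegral_inner_resolvent_sub_sq_le (hH : IsSelfAdjoint H)
    (hAd : Dense (A.domain : Set V)) {φ : A.adjoint.domain} (hφ : ‖(φ : V)‖ = 1) {ε : ℝ}
    (hε : 0 < ε) (χ : V) :
    ∫⁻ s : ℝ, ‖inner ℂ (A.adjoint φ) ((resolventOp H (s + ε * Complex.I) -
        resolventOp H (s - ε * Complex.I)) χ)‖ₑ ^ 2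
      ≤ ENNReal.ofReal ((2 * Real.pi) ^ 2 * ‖χ‖ ^ 2) * timeIntegralSup H A := by
  by_cases hχ : ‖χ‖ = 0
  · rw [norm_eq_zero.1 hχ]
    simp
  have hpos : 0 < ‖χ‖ := lt_of_le_of_ne (norm_nonneg _) (Ne.symm hχ)
  have hpi := Real.pi_pos
  have hE := isResolutionOf_spectralResolution hH
  set E := spectralResolution H with hEdef
  set χ' : V := ((‖χ‖⁻¹ : ℝ) : ℂ) • χ with hχ'
  have hχ1 : ‖χ'‖ = 1 := by
    rw [hχ', norm_smul, Complex.norm_real, norm_inv, norm_norm, inv_mul_cancel₀ hχ]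
  have hχχ : χ = ((‖χ‖ : ℝ) : ℂ) • χ' := by
    rw [hχ', smul_smul, ← Complex.ofReal_mul, mul_inv_cancel₀ hχ, Complex.ofReal_one, one_smul]
  have h1 : ∫⁻ t, extNorm A (E.unitary t χ') ^ 2
      ≤ ENNReal.ofReal (2 * Real.pi) * timeIntegralSup H A := by
    have h2 : ENNReal.ofReal (1 / (2 * Real.pi)) * ∫⁻ t, extNorm A (E.unitary t χ') ^ 2
        ≤ timeIntegralSup H A := le_iSup₂_of_le (f := fun (φ : V) (_ : ‖φ‖ = 1) =>
          ENNReal.ofReal (1 / (2 * Real.pi)) * ∫⁻ t : ℝ, extNorm A (evolution H t φ) ^ 2) χ' hχ1 le_rfl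
    calc ∫⁻ t, extNorm A (E.unitary t χ') ^ 2 = ENNReal.ofReal (2 * Real.pi) *
          (ENNReal.ofReal (1 / (2 * Real.pi)) * ∫⁻ t, extNorm A (E.unitary t χ') ^ 2) := by
          rw [← mul_assoc, ← ENNReal.ofReal_mul (by positivity), mul_one_div_cancel (by positivity),
            ENNReal.ofReal_one, one_mul]
      _ ≤ _ := by gcongr
  have h3 : ∫⁻ t, ENNReal.ofReal (Real.exp (-ε * |t|)) ^ 2 *
      ‖inner ℂ (A.adjoint φ) (E.unitary t χ')‖ₑ ^ 2 ≤ ∫⁻ t, extNorm A (E.unitary t χ') ^ 2 := by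
    refine lintegral_mono fun t => ?_
    have h4 : ENNReal.ofReal (Real.exp (-ε * |t|)) ≤ 1 := by
      rw [← ENNReal.ofReal_one]
      refine ENNReal.ofReal_le_ofReal (Real.exp_le_one_iff.2 ?_)
      have := mul_nonneg hε.le (abs_nonneg t)
      linarith
    calc _ ≤ 1 ^ 2 * extNorm A (E.unitary t χ') ^ 2 := by
          gcongr
          exact enorm_inner_adjoint_le_extNorm hAd _ hφ
      _ = _ := by simp
  have h5 : ∀ s : ℝ, ‖inner ℂ (A.adjoint φ) ((resolventOp H (s + ε * Complex.I) -
        resolventOp H (s - ε * Complex.I)) χ)‖ₑ ^ 2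
      = ENNReal.ofReal (‖χ‖ ^ 2) * ‖inner ℂ (A.adjoint φ)
        ((E.integral (resolventFun (s + ε * Complex.I)) -
          E.integral (resolventFun (s - ε * Complex.I))) χ')‖ₑ ^ 2 := by
    intro s
    rw [resolventOp_eq_integral hH hE (im_add_mul_I_ne_zero hε s),
      resolventOp_eq_integral hH hE (im_sub_mul_I_ne_zero hε s)]
    conv_lhs => rw [hχχ, map_smul, inner_smul_right, enorm_mul, mul_pow]
    congr 1
    rw [← ofReal_norm, Complex.norm_real, norm_norm, ENNReal.ofReal_pow (norm_nonneg _)]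
  simp only [h5]
  rw [lintegral_const_mul' _ _ ENNReal.ofReal_ne_top, E.lintegral_inner_resolvent_sub_sq hε]
  calc _ ≤ ENNReal.ofReal (‖χ‖ ^ 2) * (ENNReal.ofReal (2 * Real.pi) *
        (ENNReal.ofReal (2 * Real.pi) * timeIntegralSup H A)) := by
        gcongr
        exact h3.trans h1
    _ = _ := by
        rw [← mul_assoc, ← mul_assoc, ← ENNReal.ofReal_mul (by positivity),
          ← ENNReal.ofReal_mul (by positivity)]
        congr 2
        ring

/-- The jump paired with `A*φ` and `χ` equals its diagonal form at `χ`, a Poisson integral.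
Integrated over `(a,b)` it tends to `2π‖χ‖²`, while Cauchy-Schwarz bounds the square of each such
integral by `(b - a) (2π)² ‖χ‖²` times the time supremum. -/
theorem spectralProjSup_le_timeIntegralSup (hH : IsSelfAdjoint H)
    (hAd : Dense (A.domain : Set V)) : spectralProjSup H A ≤ timeIntegralSup H A := by
  by_cases hfin : timeIntegralSup H A = ⊤
  · rw [hfin]; exact le_top
  refine iSup_le fun φ => iSup_le fun hφ => iSup_le fun a => iSup_le fun b => iSup_le fun hab => ?_
  have hE := isResolutionOf_spectralResolution hH
  set E := spectralResolution H with hEdef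
  have hpi := Real.pi_pos
  have hba : 0 < b - a := sub_pos.2 hab
  set χ := spectralProj H (Set.Ioo a b) (A.adjoint φ) with hχ
  have hχE : χ = E.proj (Set.Ioo a b) (A.adjoint φ) := rfl
  let ε : ℕ → ℝ := fun n => 1 / ((n : ℝ) + 1)
  have hε : ∀ n, 0 < ε n := fun n => by positivity
  have hεlim : Tendsto ε atTop (𝓝 0) := tendsto_one_div_add_atTop_nhds_zero_nat
  let h : ℕ → ℝ → ℝ≥0∞ := fun n s => ‖inner ℂ (A.adjoint φ)
    ((resolventOp H (s + ε n * Complex.I) - resolventOp H (s - ε n * Complex.I)) χ)‖ₑ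
  have hval : ∀ n s, h n s = ENNReal.ofReal (2 * ε n) *
      ∫⁻ x, ENNReal.ofReal (((x - s) ^ 2 + ε n ^ 2)⁻¹) ∂(E.scalarMeasure χ) := by
    intro n s
    have hp := im_add_mul_I_ne_zero (hε n) s
    have hn := im_sub_mul_I_ne_zero (hε n) s
    have hconj : (starRingEnd ℂ) (s + ε n * Complex.I) = s - ε n * Complex.I := by
      simp [sub_eq_add_neg]
    have e1 : inner ℂ (A.adjoint φ)
        ((resolventOp H (s + ε n * Complex.I) - resolventOp H (s - ε n * Complex.I)) χ)
        = inner ℂ χ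
        ((resolventOp H (s + ε n * Complex.I) - resolventOp H (s - ε n * Complex.I)) χ) := by
      rw [sub_apply, inner_sub_right, inner_sub_right, resolventOp_eq_integral hH hE hp,
        resolventOp_eq_integral hH hE hn, hχE,
        E.inner_integral_proj (bddMeas_resolventFun hp) measurableSet_Ioo,
        E.inner_integral_proj (bddMeas_resolventFun hn) measurableSet_Ioo]
    have e2 := norm_inner_resolvent_sub_resolvent hH hp χ
    rw [hconj] at e2
    have e3 : |(s + ε n * Complex.I : ℂ).im| = ε n := by simp [abs_of_pos (hε n)]
    have e4 : (s + ε n * Complex.I : ℂ).re = s := by simp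
    have e5 := ofReal_norm_resolvent_sq hH hp χ
    rw [e3, e4] at e5
    simp only [h]
    rw [e1, ← ofReal_norm, e2, e3, ENNReal.ofReal_mul (by have := hε n; positivity), e5]
  have hmeas : ∀ n, Measurable (h n) := by
    intro n
    simp only [h]
    have h1 : ∀ s : ℝ, resolventOp H (s + ε n * Complex.I)
        = E.integral (resolventFun (s + ε n * Complex.I)) := fun s =>
      resolventOp_eq_integral hH hE (im_add_mul_I_ne_zero (hε n) s)
    have h2 : ∀ s : ℝ, resolventOp H (s - ε n * Complex.I)
        = E.integral (resolventFun (s - ε n * Complex.I)) := fun s =>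
      resolventOp_eq_integral hH hE (im_sub_mul_I_ne_zero (hε n) s)
    simp only [h1, h2, sub_apply, inner_sub_right]
    have h3 := E.continuous_inner_resolvent (hε n) (A.adjoint φ) χ
    exact (h3.1.sub h3.2).measurable.enorm
  have hupper : ∀ n, (∫⁻ s in Set.Ioo a b, h n s) ^ 2 ≤ ENNReal.ofReal (b - a) *
      (ENNReal.ofReal ((2 * Real.pi) ^ 2 * ‖χ‖ ^ 2) * timeIntegralSup H A) := by
    intro n
    refine (sq_lintegral_le (hmeas n).aemeasurable).trans ?_
    rw [Measure.restrict_apply_univ, Real.volume_Ioo]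
    gcongr
    exact (setLIntegral_le_lintegral _ _).trans
      (lintegral_inner_resolvent_sub_sq_le hH hAd hφ (hε n) χ)
  -- Tonelli integrates the Poisson kernel in `s` over `(a,b)`, producing the arctangent difference.
  have hfi : ∀ n, ∫⁻ s in Set.Ioo a b, h n s = ∫⁻ x, ENNReal.ofReal (2 *
      (Real.arctan ((b - x) / ε n) - Real.arctan ((a - x) / ε n))) ∂(E.scalarMeasure χ) := by
    intro n
    simp only [hval]
    rw [lintegral_const_mul' _ _ ENNReal.ofReal_ne_top,
      lintegral_lintegral_swap (Measurable.aemeasurable (by fun_prop)),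
      ← lintegral_const_mul' _ _ ENNReal.ofReal_ne_top]
    refine lintegral_congr fun x => ?_
    have := hε n
    rw [lintegral_Ioo_inv_sq_add_sq (hε n) x hab, ← ENNReal.ofReal_mul (by positivity)]
    congr 1
    field_simp
  have hlim : Tendsto (fun n => ∫⁻ s in Set.Ioo a b, h n s) atTop
      (𝓝 (ENNReal.ofReal (2 * Real.pi * ‖χ‖ ^ 2))) := by
    simp only [hfi]
    have e1 : ENNReal.ofReal (2 * Real.pi * ‖χ‖ ^ 2)
        = ∫⁻ _, ENNReal.ofReal (2 * Real.pi) ∂(E.scalarMeasure χ) := by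
      rw [lintegral_const, E.scalarMeasure_univ, ← ENNReal.ofReal_mul (by positivity)]
    rw [e1]
    refine tendsto_lintegral_of_dominated_convergence (fun _ => ENNReal.ofReal (2 * Real.pi))
      (fun n => by fun_prop) (fun n => Eventually.of_forall fun x => ?_) ?_ ?_
    · refine ENNReal.ofReal_le_ofReal ?_
      have := Real.arctan_lt_pi_div_two ((b - x) / ε n)
      have := Real.neg_pi_div_two_lt_arctan ((a - x) / ε n)
      linarith
    · rw [← e1]; exact ENNReal.ofReal_ne_top
    -- The spectral measure of `χ` is carried by the open interval, so no half contributions from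
    -- the endpoints arise.
    · filter_upwards [E.ae_mem_scalarMeasure_proj measurableSet_Ioo (A.adjoint φ)] with x hx
      exact ENNReal.tendsto_ofReal ((tendsto_arctan_sub hx hε hεlim).const_mul 2)
  have hfinal := le_of_tendsto (ENNReal.Tendsto.pow (n := 2) hlim) (Eventually.of_forall hupper)
  set c := (timeIntegralSup H A).toReal with hc
  have hc0 : 0 ≤ c := ENNReal.toReal_nonneg
  rw [← ENNReal.ofReal_toReal hfin, ← hc] at hfinal ⊢
  rw [← ENNReal.ofReal_mul (by positivity), ← ENNReal.ofReal_mul (by positivity),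
    ← ENNReal.ofReal_pow (by positivity), ENNReal.ofReal_le_ofReal_iff (by positivity)] at hfinal
  refine ENNReal.ofReal_le_ofReal ?_
  rw [div_le_iff₀ hba]
  -- The estimate is quadratic in `‖χ‖²` on the left and linear on the right; one factor `(2π)²‖χ‖²`
  -- is cancelled.
  by_cases hm : ‖χ‖ ^ 2 = 0
  · rw [hm]; positivity
  have hmpos : 0 < (2 * Real.pi) ^ 2 * ‖χ‖ ^ 2 := by positivity
  refine le_of_mul_le_mul_left ?_ hmpos
  calc _ = (2 * Real.pi * ‖χ‖ ^ 2) ^ 2 := by ring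
    _ ≤ _ := hfinal
    _ = _ := by ring

end KatoSmooth

/-! ### Conclusion -/

theorem theorem14p1 {V : Type*} [NormedAddCommGroup V] [InnerProductSpace ℂ V] [CompleteSpace V]
    [TopologicalSpace.SeparableSpace V] (H A : V →ₗ.[ℂ] V) (hH : IsSelfAdjoint H)
    (hA : A.IsClosed) (hAd : Dense (A.domain : Set V)) :
    (KatoSmooth.resolventIntegralSup H A = KatoSmooth.smoothNormSq H A ∧
      KatoSmooth.timeIntegralSup H A = KatoSmooth.smoothNormSq H A ∧
      KatoSmooth.spectralProjSup H A = KatoSmooth.smoothNormSq H A ∧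
      KatoSmooth.resolventDiffSup H A = KatoSmooth.smoothNormSq H A ∧
      KatoSmooth.resolventNormSup H A = KatoSmooth.smoothNormSq H A) ∧
    [KatoSmooth.IsHSmooth H A, KatoSmooth.resolventIntegralSup H A < ⊤,
      KatoSmooth.timeIntegralSup H A < ⊤, KatoSmooth.spectralProjSup H A < ⊤,
      KatoSmooth.resolventDiffSup H A < ⊤, KatoSmooth.resolventNormSup H A < ⊤].TFAE := by
  have h12 : KatoSmooth.timeIntegralSup H A = KatoSmooth.smoothNormSq H A :=
    (KatoSmooth.resolventIntegralSup_eq_timeIntegralSup hH hA hAd).symm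
  -- The next three inequalities close a cycle, so each of them is an equality.
  have h25 := KatoSmooth.timeIntegralSup_le_resolventNormSup hH hA hAd
  have h53 := KatoSmooth.resolventNormSup_le_spectralProjSup (A := A) hH
  have h32 := KatoSmooth.spectralProjSup_le_timeIntegralSup hH hAd
  have h3 : KatoSmooth.spectralProjSup H A = KatoSmooth.smoothNormSq H A :=
    (le_antisymm h32 (h25.trans h53)).trans h12
  have h5 : KatoSmooth.resolventNormSup H A = KatoSmooth.smoothNormSq H A :=
    (le_antisymm (h53.trans h32) h25).trans h12
  have h4 : KatoSmooth.resolventDiffSup H A = KatoSmooth.smoothNormSq H A :=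
    (KatoSmooth.resolventDiffSup_eq_resolventNormSup hH).trans h5
  refine ⟨⟨rfl, h12, h3, h4, h5⟩, ?_⟩
  rw [h12, h3, h4, h5]
  refine List.tfae_of_forall (KatoSmooth.smoothNormSq H A < ⊤) _ fun p hp => ?_
  simp only [List.mem_cons, List.not_mem_nil, or_false] at hp
  rcases hp with rfl | rfl | rfl | rfl | rfl | rfl <;> exact Iff.rfl
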